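/- Let $\ell,\rho_1,\rho_2,\rho_3,\kappa,b,\delta,\beta>0$. Let $g:[0,\infty)\to\mathbb R$ be continuous, summable, of total mass $\int_0^\infty g(s)\,ds=1$, and differentiable on $\mathbb R^+=(0,\infty)$, and let $\mu=-g'$ be such that (i) $\mu$ is nonnegative, nonincreasing and absolutely continuous on $\mathbb R^+$, with $\mu(0)=\lim_{s\to0}\mu(s)\in(0,\infty)$; (ii) there is $\nu>0$ with $\mu'(s)+\nu\mu(s)\le 0$ for almost every $s>0$. All spaces are real and consist of functions on $(0,\ell)$; $\|\cdot\|$ is the norm of $L^2$. Let $L^2_*=\{f\in L^2:\int_0^\ell f\,dx=0\}$ and $H^1_*=H^1\cap L^2_*$, let $H^1_0$ carry the inner product $\langle u_x,v_x\rangle$, and let $$\mathcal M=L^2(\mathbb R^+,\mu(s)\,ds;H^1_0),\qquad \langle\eta,\xi\rangle_{\mathcal M}=\int_0^\infty\mu(s)\langle\eta_x(s),\xi_x(s)\rangle\,ds .$$ Let $T\eta=-D\eta$ with domain $$\mathcal D(T)=\Big\{\eta\in\mathcal M:\ D\eta\in\mathcal M,\ \lim_{s\to0}\|\eta_x(s)\|=0\Big\},$$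 where $D$ is the weak derivative in $s$ (taken on the open set $\{s>0:\mu(s)>0\}$, on which the elements of $\mathcal M$ are determined). Let $$\mathcal H=H^1_0\times L^2\times H^1_*\times L^2_*\times L^2\times\mathcal M$$ be normed by $$\|(\varphi,\tilde\varphi,\psi,\tilde\psi,\theta,\eta)\|_{\mathcal H}^2=\kappa\|\varphi_x+\psi\|^2+\rho_1\|\tilde\varphi\|^2+b\|\psi_x\|^2+\rho_2\|\tilde\psi\|^2+\rho_3\|\theta\|^2+\tfrac1\beta\|\eta\|_{\mathcal M}^2 .$$ Let $A$ be the linear operator in $\mathcal H$ with domain $$\mathcal D(A)=\Big\{(\varphi,\tilde\varphi,\psi,\tilde\psi,\theta,\eta)\in\mathcal H:\ \varphi\in H^2,\ \tilde\varphi\in H^1_0,\ \psi_x\in H^1_0,\ \tilde\psi\in H^1_*,\ \theta\in H^1_0,\ \eta\in\mathcal D(T),\ \int_0^\infty\mu(s)\eta(s)\,ds\in H^2\Big\}$$ given by $$A\begin{pmatrix}\varphi\\ \tilde\varphi\\ \psi\\ \tilde\psi\\ \theta\\ \eta\end{pmatrix}=\begin{pmatrix}\tilde\varphi\\ \frac{\kappa}{\rho_1}(\varphi_x+\psi)_x\\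 \tilde\psi\\ \frac b{\rho_2}\psi_{xx}-\frac\kappa{\rho_2}(\varphi_x+\psi)-\frac\delta{\rho_2}\theta_x\\ \frac1{\beta\rho_3}\big(\int_0^\infty\mu(s)\eta(s)\,ds\big)_{xx}-\frac\delta{\rho_3}\tilde\psi_x\\ T\eta+\theta\end{pmatrix}.$$ Then $A$ is the infinitesimal generator of a strongly continuous semigroup of linear contractions $S(t)=e^{tA}:\mathcal H\to\mathcal H$, $t\ge0$, and this semigroup is uniquely determined by $A$. -/

import Mathlib

open Set Filter Topology MeasureTheory
open scoped ContDiff ENNReal NNReal RealInnerProductSpace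

noncomputable section

namespace TimoGP

/-- `φ` is a real test function on the open set `U`, i.e. `φ ∈ C_c^∞(U)`. -/
structure IsTest (U : Set ℝ) (φ : ℝ → ℝ) : Prop where
  smooth : ContDiff ℝ ∞ φ
  compact : HasCompactSupport φ
  subset : tsupport φ ⊆ U

/-- `v` is the weak derivative of `u` on the open set `U` (for functions `u`, `v` with values in a
Banach space `E` that are locally integrable on `U`). -/
def IsWeakDeriv {E : Type*} [NormedAddCommGroup E] [NormedSpace ℝ E]
    (U : Set ℝ) (u v : ℝ → E) : Prop :=
  ∀ φ : ℝ → ℝ, IsTest U φ → ∫ x in U, deriv φ x • u x = - ∫ x in U, φ x • v x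

lemma IsTest.deriv {U : Set ℝ} {φ : ℝ → ℝ} (h : IsTest U φ) : IsTest U (deriv φ) where
  smooth := h.smooth.iterate_deriv 1
  compact := h.compact.deriv
  subset := tsupport_deriv_subset.trans h.subset

section generic

variable {E : Type*} [NormedAddCommGroup E] [NormedSpace ℝ E]

lemma IsTest.integrableOn_smul {U : Set ℝ} {φ : ℝ → ℝ} (h : IsTest U φ) {u : ℝ → E}
    (hu : LocallyIntegrableOn u U) : IntegrableOn (fun x => φ x • u x) U := by
  have hK : IsCompact (tsupport φ) := h.compact
  have h1 : IntegrableOn u (tsupport φ) :=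
    hu.integrableOn_compact_subset h.subset hK
  have h2 : IntegrableOn (fun x => φ x • u x) (tsupport φ) :=
    h1.continuousOn_smul h.smooth.continuous.continuousOn hK
  refine IntegrableOn.mono_set ?_ (subset_univ U)
  rw [integrableOn_univ]
  refine (integrableOn_iff_integrable_of_support_subset ?_).1 h2
  intro x hx
  apply subset_tsupport
  intro h0
  exact hx (by simp [h0])

/-- The graph of the weak derivative in `L²(ν; E) × L²(ν; E)`. -/
def weakGraph (ν : Measure ℝ) (U : Set ℝ) (hac : volume.restrict U ≪ ν)
    (hloc : ∀ f : Lp E 2 ν, LocallyIntegrableOn f U) : Submodule ℝ (Lp E 2 ν × Lp E 2 ν) where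
  carrier := {p | IsWeakDeriv U p.1 p.2}
  zero_mem' := by
    intro φ _
    have h0 : ∀ᵐ x ∂(volume.restrict U), (0 : Lp E 2 ν) x = 0 := hac (Lp.coeFn_zero E 2 ν)
    rw [integral_eq_zero_of_ae, integral_eq_zero_of_ae, neg_zero]
    · filter_upwards [h0] with x hx
      rw [Prod.snd_zero, hx, smul_zero]; rfl
    · filter_upwards [h0] with x hx
      rw [Prod.fst_zero, hx, smul_zero]; rfl
  add_mem' := by
    intro p q hp hq φ hφ
    have h1 := hac (Lp.coeFn_add p.1 q.1)
    have h2 := hac (Lp.coeFn_add p.2 q.2)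
    have e1 : ∫ x in U, _root_.deriv φ x • (p + q).1 x =
        ∫ x in U, (_root_.deriv φ x • p.1 x + _root_.deriv φ x • q.1 x) :=
      integral_congr_ae (by filter_upwards [h1] with x hx; rw [Prod.fst_add, hx, Pi.add_apply, smul_add])
    have e2 : ∫ x in U, φ x • (p + q).2 x = ∫ x in U, (φ x • p.2 x + φ x • q.2 x) :=
      integral_congr_ae (by filter_upwards [h2] with x hx; rw [Prod.snd_add, hx, Pi.add_apply, smul_add])
    rw [e1, e2, integral_add (hφ.deriv.integrableOn_smul (hloc _))
      (hφ.deriv.integrableOn_smul (hloc _)), integral_add (hφ.integrableOn_smul (hloc _))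
      (hφ.integrableOn_smul (hloc _)), hp φ hφ, hq φ hφ]
    abel
  smul_mem' := by
    intro c p hp φ hφ
    have h1 := hac (Lp.coeFn_smul c p.1)
    have h2 := hac (Lp.coeFn_smul c p.2)
    have e1 : ∫ x in U, _root_.deriv φ x • (c • p).1 x = ∫ x in U, c • (_root_.deriv φ x • p.1 x) :=
      integral_congr_ae (by 
        filter_upwards [h1] with x hx; rw [Prod.smul_fst, hx, Pi.smul_apply, smul_comm c])
    have e2 : ∫ x in U, φ x • (c • p).2 x = ∫ x in U, c • (φ x • p.2 x) :=
      integral_congr_ae (by 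
        filter_upwards [h2] with x hx; rw [Prod.smul_snd, hx, Pi.smul_apply, smul_comm c])
    rw [e1, e2, integral_smul, integral_smul, hp φ hφ, smul_neg]

lemma weakGraph_single [CompleteSpace E] {ν : Measure ℝ} {U : Set ℝ}
    (hac : volume.restrict U ≪ ν)
    (hloc : ∀ f : Lp E 2 ν, LocallyIntegrableOn f U) (hU : IsOpen U)
    (hν : ν ≪ volume.restrict U) :
    ∀ p ∈ weakGraph ν U hac hloc, p.1 = 0 → p.2 = 0 := by
  rintro ⟨u, v⟩ hp (rfl : u = 0)
  have h0 : ∀ᵐ x ∂(volume.restrict U), (0 : Lp E 2 ν) x = 0 := hac (Lp.coeFn_zero E 2 ν)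
  have key : ∀ᵐ x, x ∈ U → v x = 0 := by
    refine hU.ae_eq_zero_of_integral_contDiff_smul_eq_zero (hloc v) ?_
    intro g h1 h2 h3
    have := hp g ⟨h1, h2, h3⟩
    rw [integral_eq_zero_of_ae, eq_comm, neg_eq_zero] at this
    · rwa [setIntegral_eq_integral_of_forall_compl_eq_zero] at this
      intro x hx
      have : g x = 0 := by
        by_contra h
        exact hx (h3 (subset_tsupport _ h))
      simp [this]
    · filter_upwards [h0] with x hx
      change _ • (0 : Lp E 2 ν) x = 0
      rw [hx, smul_zero]
  rw [← ae_restrict_iff' hU.measurableSet] at key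
  exact (Lp.eq_zero_iff_ae_eq_zero).2 (hν key)

/-- The weak derivative as an unbounded linear operator in `L²(ν; E)`, with its maximal domain. -/
def weakD (ν : Measure ℝ) (U : Set ℝ) (hac : volume.restrict U ≪ ν)
    (hloc : ∀ f : Lp E 2 ν, LocallyIntegrableOn f U) : Lp E 2 ν →ₗ.[ℝ] Lp E 2 ν :=
  (weakGraph ν U hac hloc).toLinearPMap

end generic

/-! ### Function spaces on the interval `(0, ℓ)` -/

/-- The real Hilbert space `L²(0, ℓ)`. -/
abbrev L2 (ℓ : ℝ) : Type := Lp ℝ 2 (volume.restrict (Ioo 0 ℓ))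

lemma L2.integrable {ℓ : ℝ} (f : L2 ℓ) : IntegrableOn f (Ioo 0 ℓ) :=
  (Lp.memLp f).integrable (by norm_num)

lemma L2.locallyIntegrableOn {ℓ : ℝ} (f : L2 ℓ) : LocallyIntegrableOn f (Ioo 0 ℓ) :=
  f.integrable.locallyIntegrableOn

/-- The graph of the weak derivative `d/dx` in `L²(0, ℓ)`. -/
def gradGraph (ℓ : ℝ) : Submodule ℝ (L2 ℓ × L2 ℓ) :=
  weakGraph (volume.restrict (Ioo 0 ℓ)) (Ioo 0 ℓ) .rfl L2.locallyIntegrableOn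

/-- The weak derivative `d/dx` in `L²(0, ℓ)`, with domain `H¹(0, ℓ)`. -/
def grad (ℓ : ℝ) : L2 ℓ →ₗ.[ℝ] L2 ℓ :=
  weakD (volume.restrict (Ioo 0 ℓ)) (Ioo 0 ℓ) .rfl L2.locallyIntegrableOn

/-- The Sobolev space `H¹(0, ℓ)`: the functions in `L²(0, ℓ)` with a weak derivative
in `L²(0, ℓ)`. -/
def H1 (ℓ : ℝ) : Submodule ℝ (L2 ℓ) := (grad ℓ).domain

open Classical in
/-- The weak derivative `u_x`; it is meaningful for `u ∈ H¹(0, ℓ)` and set to `0` otherwise. -/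
def dx {ℓ : ℝ} (u : L2 ℓ) : L2 ℓ := if h : u ∈ H1 ℓ then grad ℓ ⟨u, h⟩ else 0

lemma gradGraph_single (ℓ : ℝ) : ∀ p ∈ gradGraph ℓ, p.1 = 0 → p.2 = 0 :=
  weakGraph_single _ _ isOpen_Ioo .rfl

lemma mem_gradGraph {ℓ : ℝ} {u v : L2 ℓ} :
    (u, v) ∈ gradGraph ℓ ↔ IsWeakDeriv (Ioo 0 ℓ) u v := Iff.rfl

lemma graph_grad (ℓ : ℝ) : (grad ℓ).graph = gradGraph ℓ :=
  Submodule.toLinearPMap_graph_eq _ (gradGraph_single ℓ)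

lemma mem_gradGraph_iff {ℓ : ℝ} {u v : L2 ℓ} :
    (u, v) ∈ gradGraph ℓ ↔ u ∈ H1 ℓ ∧ dx u = v := by
  rw [← graph_grad, LinearPMap.mem_graph_iff]
  constructor
  · rintro ⟨y, rfl, rfl⟩
    exact ⟨y.2, by unfold dx; rw [dif_pos (show (y : L2 ℓ) ∈ H1 ℓ from y.2)]⟩
  · rintro ⟨h, rfl⟩
    exact ⟨⟨u, h⟩, rfl, by unfold dx; rw [dif_pos h]⟩

lemma mem_H1_iff {ℓ : ℝ} {u : L2 ℓ} : u ∈ H1 ℓ ↔ ∃ v : L2 ℓ, IsWeakDeriv (Ioo 0 ℓ) u v := by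
  simp_rw [← mem_gradGraph, mem_gradGraph_iff]
  simp

lemma graph_dx {ℓ : ℝ} {u : L2 ℓ} (h : u ∈ H1 ℓ) : (u, dx u) ∈ gradGraph ℓ :=
  mem_gradGraph_iff.2 ⟨h, rfl⟩

lemma dx_add {ℓ : ℝ} {u v : L2 ℓ} (hu : u ∈ H1 ℓ) (hv : v ∈ H1 ℓ) :
    dx (u + v) = dx u + dx v :=
  (mem_gradGraph_iff.1 ((gradGraph ℓ).add_mem (graph_dx hu) (graph_dx hv))).2

lemma dx_smul {ℓ : ℝ} {u : L2 ℓ} (c : ℝ) (hu : u ∈ H1 ℓ) : dx (c • u) = c • dx u :=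
  (mem_gradGraph_iff.1 ((gradGraph ℓ).smul_mem c (graph_dx hu))).2

/-- The Sobolev space `H²(0, ℓ)`. -/
def H2 (ℓ : ℝ) : Submodule ℝ (L2 ℓ) where
  carrier := {u | u ∈ H1 ℓ ∧ dx u ∈ H1 ℓ}
  zero_mem' := by
    have h : dx (0 : L2 ℓ) = 0 := by simpa using dx_smul (0 : ℝ) (H1 ℓ).zero_mem
    exact ⟨(H1 ℓ).zero_mem, by rw [h]; exact (H1 ℓ).zero_mem⟩
  add_mem' := fun ⟨a, b⟩ ⟨c, d⟩ =>
    ⟨(H1 ℓ).add_mem a c, by rw [dx_add a c]; exact (H1 ℓ).add_mem b d⟩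
  smul_mem' := fun r _ ⟨a, b⟩ =>
    ⟨(H1 ℓ).smul_mem r a, by rw [dx_smul r a]; exact (H1 ℓ).smul_mem r b⟩

/-- The pairs `(φ, φ')` with `φ ∈ C_c^∞(0, ℓ)`, as elements of `L²(0, ℓ) × L²(0, ℓ)`. -/
def testGraph (ℓ : ℝ) : Set (L2 ℓ × L2 ℓ) :=
  {p | ∃ φ : ℝ → ℝ, IsTest (Ioo 0 ℓ) φ ∧ p.1 =ᵐ[volume.restrict (Ioo 0 ℓ)] φ ∧
    p.2 =ᵐ[volume.restrict (Ioo 0 ℓ)] deriv φ}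

/-- The Sobolev space `H¹₀(0, ℓ)`: the closure of `C_c^∞(0, ℓ)` in `H¹(0, ℓ)`, that is, the
functions `u ∈ H¹(0, ℓ)` such that `(φₙ, φₙ') → (u, u_x)` in `L² × L²` for some test functions
`φₙ`. -/
def H10 (ℓ : ℝ) : Submodule ℝ (L2 ℓ) where
  carrier := {u | u ∈ H1 ℓ ∧ (u, dx u) ∈ closure (testGraph ℓ)}
  zero_mem' := by
    have h : dx (0 : L2 ℓ) = 0 := by simpa using dx_smul (0 : ℝ) (H1 ℓ).zero_mem
    refine ⟨(H1 ℓ).zero_mem, subset_closure ⟨0, ⟨contDiff_const, HasCompactSupport.zero, ?_⟩, ?_, ?_⟩⟩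
    · simp [tsupport]
    · exact Lp.coeFn_zero _ _ _
    · simp only [h]
      filter_upwards [Lp.coeFn_zero ℝ 2 (volume.restrict (Ioo 0 ℓ))] with x hx
      rw [hx]; simp
  add_mem' := by
    rintro u v ⟨hu, hu'⟩ ⟨hv, hv'⟩
    refine ⟨(H1 ℓ).add_mem hu hv, ?_⟩
    rw [dx_add hu hv]
    refine map_mem_closure₂ (f := fun p q : L2 ℓ × L2 ℓ => p + q) continuous_add hu' hv' ?_
    rintro p ⟨φ, hφ, h1, h2⟩ q ⟨χ, hχ, h3, h4⟩
    refine ⟨φ + χ, ⟨hφ.smooth.add hχ.smooth, hφ.compact.add hχ.compact,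
      (tsupport_add φ χ).trans (union_subset hφ.subset hχ.subset)⟩, ?_, ?_⟩
    · filter_upwards [h1, h3, Lp.coeFn_add p.1 q.1] with x a b c
      rw [Prod.fst_add, c, Pi.add_apply, Pi.add_apply, a, b]
    · filter_upwards [h2, h4, Lp.coeFn_add p.2 q.2] with x a b c
      rw [Prod.snd_add, c, Pi.add_apply, a, b, deriv_add]
      · exact (hφ.smooth.differentiable (by simp)) x
      · exact (hχ.smooth.differentiable (by simp)) x
  smul_mem' := by
    rintro c u ⟨hu, hu'⟩
    refine ⟨(H1 ℓ).smul_mem c hu, ?_⟩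
    rw [dx_smul c hu]
    refine map_mem_closure (f := fun p : L2 ℓ × L2 ℓ => c • p) (continuous_const_smul c) hu' ?_
    rintro p ⟨φ, hφ, h1, h2⟩
    refine ⟨c • φ, ⟨hφ.smooth.const_smul c, hφ.compact.smul_left, ?_⟩, ?_, ?_⟩
    · exact (tsupport_smul_subset_right (fun _ => c) φ).trans hφ.subset
    · filter_upwards [h1, Lp.coeFn_smul c p.1] with x a b
      rw [Prod.smul_fst, b, Pi.smul_apply, Pi.smul_apply, a]
    · filter_upwards [h2, Lp.coeFn_smul c p.2] with x a b
      rw [Prod.smul_snd, b, Pi.smul_apply, a, deriv_const_smul_field]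

lemma H10_le_H1 (ℓ : ℝ) : H10 ℓ ≤ H1 ℓ := fun _ h => h.1

/-- The space `L²_*(0, ℓ)` of functions with zero mean. -/
def L2s (ℓ : ℝ) : Submodule ℝ (L2 ℓ) where
  carrier := {f | ∫ x in Ioo 0 ℓ, f x = 0}
  zero_mem' := by
    rw [Set.mem_ofPred_eq, integral_eq_zero_of_ae (Lp.coeFn_zero _ _ _)]
  add_mem' := by
    intro f g hf hg
    simp only [Set.mem_ofPred_eq] at *
    rw [integral_congr_ae (Lp.coeFn_add f g)]
    simp only [Pi.add_apply]
    rw [integral_add f.integrable g.integrable, hf, hg, add_zero]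
  smul_mem' := by
    intro c f hf
    simp only [Set.mem_ofPred_eq] at *
    rw [integral_congr_ae (Lp.coeFn_smul c f)]
    simp only [Pi.smul_apply]
    rw [integral_smul, hf, smul_zero]

/-- The space `H¹_*(0, ℓ) = H¹(0, ℓ) ∩ L²_*(0, ℓ)`. -/
def H1s (ℓ : ℝ) : Submodule ℝ (L2 ℓ) := H1 ℓ ⊓ L2s ℓ


lemma IsTest.memLp {ℓ : ℝ} {φ : ℝ → ℝ} (h : IsTest (Ioo 0 ℓ) φ) :
    MemLp φ 2 (volume.restrict (Ioo 0 ℓ)) :=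
  h.smooth.continuous.memLp_of_hasCompactSupport h.compact

lemma IsTest.continuous_pairing {ℓ : ℝ} {φ : ℝ → ℝ} (h : IsTest (Ioo 0 ℓ) φ) :
    Continuous (fun u : L2 ℓ => ∫ x in Ioo 0 ℓ, φ x • u x) := by
  have e : (fun u : L2 ℓ => ∫ x in Ioo 0 ℓ, φ x • u x) = fun u => ⟪u, h.memLp.toLp φ⟫ := by
    funext u
    rw [L2.inner_def]
    refine integral_congr_ae ?_
    filter_upwards [h.memLp.coeFn_toLp] with x hx
    rw [hx]
    simp
  rw [e]
  fun_prop

lemma isClosed_gradGraph (ℓ : ℝ) : IsClosed (gradGraph ℓ : Set (L2 ℓ × L2 ℓ)) := by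
  have : (gradGraph ℓ : Set (L2 ℓ × L2 ℓ)) = ⋂ (φ : ℝ → ℝ) (_ : IsTest (Ioo 0 ℓ) φ),
      {p | ∫ x in Ioo 0 ℓ, _root_.deriv φ x • p.1 x = - ∫ x in Ioo 0 ℓ, φ x • p.2 x} := by
    ext p
    simp only [mem_iInter]
    rfl
  rw [this]
  refine isClosed_iInter fun φ => isClosed_iInter fun hφ => ?_
  exact isClosed_eq (hφ.deriv.continuous_pairing.comp continuous_fst)
    (hφ.continuous_pairing.comp continuous_snd).neg

lemma IsTest.eq_integral {ℓ : ℝ} {φ : ℝ → ℝ} (h : IsTest (Ioo 0 ℓ) φ) {x : ℝ}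
    (hx : x ∈ Ioo 0 ℓ) : φ x = ∫ t in Ioo 0 x, _root_.deriv φ t := by
  have h0 : φ 0 = 0 := by
    by_contra h0
    exact lt_irrefl _ (h.subset (subset_tsupport _ h0)).1
  have := intervalIntegral.integral_deriv_eq_sub (f := φ) (a := 0) (b := x)
    (fun t _ => h.smooth.differentiable (by simp) t)
    ((h.deriv.smooth.continuous).intervalIntegrable _ _)
  rw [intervalIntegral.integral_of_le hx.1.le, integral_Ioc_eq_integral_Ioo, h0, sub_zero] at this
  exact this.symm

lemma poincare_test (ℓ : ℝ) : ∃ C : ℝ, 0 ≤ C ∧ ∀ p ∈ testGraph ℓ, ‖p.1‖ ≤ C * ‖p.2‖ := by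
  set ν := volume.restrict (Ioo 0 ℓ) with hν
  let one : L2 ℓ := Lp.const 2 ν (1 : ℝ)
  refine ⟨(ν.real univ) ^ (1 / 2 : ℝ) * ‖one‖, by positivity, ?_⟩
  rintro p ⟨φ, hφ, h1, h2⟩
  have hb : ∀ᵐ x ∂ν, ‖p.1 x‖ ≤ ‖one‖ * ‖p.2‖ := by
    have hi : ∫ t in Ioo 0 ℓ, |p.2 t| ≤ ‖one‖ * ‖p.2‖ := by
      have hm : MemLp (fun t => |p.2 t|) 2 ν := (Lp.memLp p.2).abs
      have e : ∫ t in Ioo 0 ℓ, |p.2 t| = ⟪one, hm.toLp _⟫ := by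
        rw [L2.inner_def]
        refine integral_congr_ae ?_
        filter_upwards [hm.coeFn_toLp, Lp.coeFn_const (p := 2) (μ := ν) (1 : ℝ)] with x hx hx'
        rw [hx, hx']
        simp
      have en : ‖hm.toLp _‖ = ‖p.2‖ := by
        rw [Lp.norm_toLp, Lp.norm_def]
        congr 1
        exact eLpNorm_congr_norm_ae (by simp)
      rw [e, ← en]
      exact real_inner_le_norm _ _
    filter_upwards [h1, ae_restrict_mem measurableSet_Ioo] with x hx hxm
    rw [hx, hφ.eq_integral hxm]
    calc ‖∫ t in Ioo 0 x, deriv φ t‖ ≤ ∫ t in Ioo 0 x, ‖deriv φ t‖ :=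
          norm_integral_le_integral_norm _
      _ ≤ ∫ t in Ioo 0 ℓ, ‖deriv φ t‖ := by
          refine setIntegral_mono_set ?_ (by filter_upwards with t; positivity)
            (Ioo_subset_Ioo_right hxm.2.le).eventuallyLE
          exact (hφ.deriv.smooth.continuous.integrable_of_hasCompactSupport
            hφ.deriv.compact).norm.integrableOn
      _ = ∫ t in Ioo 0 ℓ, |p.2 t| := by
          refine integral_congr_ae ?_
          filter_upwards [h2] with t ht
          rw [ht]; rfl
      _ ≤ _ := hi
  have := Lp.norm_le_of_ae_bound (p := 2) (by positivity) hb
  refine this.trans (le_of_eq ?_)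
  have e : ((measureUnivNNReal ν : ℝ≥0) : ℝ) = ν.real univ := rfl
  rw [e, ENNReal.toReal_ofNat, one_div, mul_assoc]

lemma poincare (ℓ : ℝ) : ∃ C : ℝ, 0 ≤ C ∧ ∀ u ∈ H10 ℓ, ‖u‖ ≤ C * ‖dx u‖ := by
  obtain ⟨C, hC, h⟩ := poincare_test ℓ
  refine ⟨C, hC, fun u hu => ?_⟩
  have hc : IsClosed {p : L2 ℓ × L2 ℓ | ‖p.1‖ ≤ C * ‖p.2‖} :=
    isClosed_le continuous_fst.norm (continuous_const.mul continuous_snd.norm)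
  have hs : testGraph ℓ ⊆ {p : L2 ℓ × L2 ℓ | ‖p.1‖ ≤ C * ‖p.2‖} := fun p hp => h p hp
  have hm : (u, dx u) ∈ {p : L2 ℓ × L2 ℓ | ‖p.1‖ ≤ C * ‖p.2‖} := closure_minimal hs hc hu.2
  exact hm

/-- The space `H¹₀(0, ℓ)` as a space of its own, to be normed by `‖u_x‖`. -/
def H10Space (ℓ : ℝ) : Type := ↥(H10 ℓ)

instance (ℓ : ℝ) : AddCommGroup (H10Space ℓ) := inferInstanceAs (AddCommGroup ↥(H10 ℓ))
instance (ℓ : ℝ) : Module ℝ (H10Space ℓ) := inferInstanceAs (Module ℝ ↥(H10 ℓ))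

/-- The inclusion `H¹₀(0, ℓ) → L²(0, ℓ)`. -/
def H10Space.val {ℓ : ℝ} : H10Space ℓ →ₗ[ℝ] L2 ℓ := (H10 ℓ).subtype

/-- An element of `H¹₀(0, ℓ)` from a function in `L²(0, ℓ)` that lies in it. -/
def H10Space.mk {ℓ : ℝ} (u : L2 ℓ) (h : u ∈ H10 ℓ) : H10Space ℓ := ⟨u, h⟩

lemma H10Space.val_mem {ℓ : ℝ} (u : H10Space ℓ) : u.val ∈ H10 ℓ := Subtype.property u

lemma H10Space.val_mem_H1 {ℓ : ℝ} (u : H10Space ℓ) : u.val ∈ H1 ℓ := u.val_mem.1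

lemma H10Space.val_injective {ℓ : ℝ} : Function.Injective (H10Space.val (ℓ := ℓ)) :=
  Subtype.val_injective

/-- The derivative `u ↦ u_x` on `H¹₀(0, ℓ)`. -/
def H10Space.D {ℓ : ℝ} : H10Space ℓ →ₗ[ℝ] L2 ℓ where
  toFun u := dx u.val
  map_add' u v := by rw [map_add, dx_add u.val_mem_H1 v.val_mem_H1]
  map_smul' c u := by rw [map_smul, dx_smul c u.val_mem_H1]; rfl

lemma H10Space.eq_zero {ℓ : ℝ} {u : H10Space ℓ} (h : dx u.val = 0) : u = 0 := by
  obtain ⟨C, _, hC⟩ := poincare ℓ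
  have := hC _ u.val_mem
  rw [h, norm_zero, mul_zero] at this
  exact H10Space.val_injective (by rw [norm_le_zero_iff.1 this, map_zero])

/-- The inner product `⟨u_x, v_x⟩` on `H¹₀(0, ℓ)`. -/
@[reducible] def H10Space.core (ℓ : ℝ) : InnerProductSpace.Core ℝ (H10Space ℓ) where
  inner u v := ⟪dx u.val, dx v.val⟫
  conj_inner_symm u v := real_inner_comm (dx u.val) (dx v.val)
  re_inner_nonneg u := real_inner_self_nonneg (x := dx u.val)
  add_left u v w := by
    rw [map_add, dx_add u.val_mem_H1 v.val_mem_H1, inner_add_left]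
  smul_left u v c := by
    rw [map_smul, dx_smul c u.val_mem_H1, inner_smul_left]
  definite u h := H10Space.eq_zero (inner_self_eq_zero.1 h)

instance (ℓ : ℝ) : NormedAddCommGroup (H10Space ℓ) :=
  (H10Space.core ℓ).toNormedAddCommGroup

instance (ℓ : ℝ) : InnerProductSpace ℝ (H10Space ℓ) := InnerProductSpace.ofCore (H10Space.core ℓ).toCore

lemma H10Space.inner_eq {ℓ : ℝ} (u v : H10Space ℓ) : ⟪u, v⟫ = ⟪dx u.val, dx v.val⟫ := rfl

lemma H10Space.norm_eq {ℓ : ℝ} (u : H10Space ℓ) : ‖u‖ = ‖dx u.val‖ := by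
  rw [@norm_eq_sqrt_real_inner (H10Space ℓ), H10Space.inner_eq, ← norm_eq_sqrt_real_inner]

instance (ℓ : ℝ) : CompleteSpace (H10Space ℓ) := by
  obtain ⟨C, hC0, hC⟩ := poincare ℓ
  refine Metric.complete_of_cauchySeq_tendsto fun u hu => ?_
  have hn : ∀ m n, dist (dx (u m).val) (dx (u n).val) = dist (u m) (u n) := by
    intro m n
    rw [dist_eq_norm, dist_eq_norm, H10Space.norm_eq]
    exact congrArg _ (map_sub H10Space.D (u m) (u n)).symm
  have hn' : ∀ m n, dist ((u m).val) ((u n).val) ≤ C * dist (u m) (u n) := by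
    intro m n
    rw [dist_eq_norm, dist_eq_norm, H10Space.norm_eq, ← map_sub]
    exact hC _ (u m - u n).val_mem
  have h1 : CauchySeq fun n => dx (u n).val := by
    rw [Metric.cauchySeq_iff] at hu ⊢
    simpa only [hn] using hu
  have h2 : CauchySeq fun n => (u n).val := by
    rw [Metric.cauchySeq_iff] at hu ⊢
    intro ε hε
    obtain ⟨N, hN⟩ := hu (ε / (C + 1)) (by positivity)
    refine ⟨N, fun m hm n hn => (hn' m n).trans_lt ?_⟩
    have := hN m hm n hn
    calc C * dist (u m) (u n) ≤ (C + 1) * dist (u m) (u n) := by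
          gcongr; linarith
      _ < (C + 1) * (ε / (C + 1)) := by gcongr
      _ = ε := by field_simp
  obtain ⟨v, hv⟩ := cauchySeq_tendsto_of_complete h1
  obtain ⟨w, hw⟩ := cauchySeq_tendsto_of_complete h2
  have hp := hw.prodMk_nhds hv
  have hg : (w, v) ∈ gradGraph ℓ :=
    (isClosed_gradGraph ℓ).mem_of_tendsto hp
      (Eventually.of_forall fun n => graph_dx (u n).val_mem_H1)
  have ht : (w, v) ∈ closure (testGraph ℓ) :=
    isClosed_closure.mem_of_tendsto hp (Eventually.of_forall fun n => (u n).val_mem.2)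
  obtain ⟨hw1, rfl⟩ := mem_gradGraph_iff.1 hg
  let w' : H10Space ℓ := H10Space.mk w ⟨hw1, ht⟩
  refine ⟨w', ?_⟩
  rw [tendsto_iff_dist_tendsto_zero] at hv ⊢
  refine hv.congr fun n => ?_
  rw [dist_eq_norm, dist_eq_norm, H10Space.norm_eq]
  exact congrArg _ (map_sub H10Space.D (u n) w').symm

lemma continuous_integral_L2 (ℓ : ℝ) : Continuous (fun u : L2 ℓ => ∫ x in Ioo 0 ℓ, u x) := by
  have e : (fun u : L2 ℓ => ∫ x in Ioo 0 ℓ, u x) =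
      fun u => ⟪u, (Lp.const 2 (volume.restrict (Ioo 0 ℓ)) (1 : ℝ) : L2 ℓ)⟫ := by
    funext u
    rw [L2.inner_def]
    refine integral_congr_ae ?_
    filter_upwards [Lp.coeFn_const (p := 2) (μ := volume.restrict (Ioo 0 ℓ)) (1 : ℝ)] with x hx
    rw [hx]
    simp
  rw [e]
  fun_prop

/-- The derivative of an `H¹₀` function has zero mean. -/
lemma dx_mem_L2s {ℓ : ℝ} {u : L2 ℓ} (hu : u ∈ H10 ℓ) : dx u ∈ L2s ℓ := by
  have hc : IsClosed {p : L2 ℓ × L2 ℓ | ∫ x in Ioo 0 ℓ, p.2 x = 0} :=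
    isClosed_eq ((continuous_integral_L2 ℓ).comp continuous_snd) continuous_const
  have hs : testGraph ℓ ⊆ {p : L2 ℓ × L2 ℓ | ∫ x in Ioo 0 ℓ, p.2 x = 0} := by
    rintro p ⟨φ, hφ, -, h2⟩
    rw [Set.mem_ofPred_eq, integral_congr_ae h2]
    rcases le_or_gt ℓ 0 with h | h
    · simp [Ioo_eq_empty_of_le h]
    have hv : ∀ x, x ∉ Ioo 0 ℓ → φ x = 0 := fun x hx => by
      by_contra h0
      exact hx (hφ.subset (subset_tsupport _ h0))
    rw [← integral_Ioc_eq_integral_Ioo, ← intervalIntegral.integral_of_le h.le,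
      intervalIntegral.integral_deriv_eq_sub
        (fun t _ => hφ.smooth.differentiable (by simp) t)
        ((hφ.deriv.smooth.continuous).intervalIntegrable _ _),
      hv ℓ (by simp), hv 0 (by simp), sub_zero]
  have hm : (u, dx u) ∈ {p : L2 ℓ × L2 ℓ | ∫ x in Ioo 0 ℓ, p.2 x = 0} :=
    closure_minimal hs hc hu.2
  exact hm

lemma IsTest.primitive {ℓ : ℝ} {h : ℝ → ℝ} (ht : IsTest (Ioo 0 ℓ) h)
    (h0 : ∫ x in Ioo 0 ℓ, h x = 0) : ∃ φ, IsTest (Ioo 0 ℓ) φ ∧ _root_.deriv φ = h := by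
  have hcont := ht.smooth.continuous
  have hd : ∀ x, HasDerivAt (fun x => ∫ t in (0 : ℝ)..x, h t) (h x) x := fun x =>
    intervalIntegral.integral_hasDerivAt_right (hcont.intervalIntegrable _ _)
      (hcont.stronglyMeasurableAtFilter _ _) hcont.continuousAt
  have hd' : _root_.deriv (fun x => ∫ t in (0 : ℝ)..x, h t) = h := funext fun x => (hd x).deriv
  rcases (tsupport h).eq_empty_or_nonempty with he | hne
  · rw [tsupport_eq_empty_iff] at he
    subst he
    exact ⟨0, ⟨contDiff_const, HasCompactSupport.zero, by simp [tsupport]⟩, by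
      ext x; simp⟩
  have hK : IsCompact (tsupport h) := ht.compact
  obtain ⟨a, ha, ha'⟩ := hK.exists_isLeast hne
  obtain ⟨b, hb, hb'⟩ := hK.exists_isGreatest hne
  have ha0 := ht.subset ha
  have hb0 := ht.subset hb
  have hz : ∀ t, t ∉ Icc a b → h t = 0 := fun t htt => by
    by_contra hh
    have := subset_tsupport _ hh
    exact htt ⟨ha' this, hb' this⟩
  have hfull : ∫ t in (0 : ℝ)..ℓ, h t = 0 := by
    rw [intervalIntegral.integral_of_le (ha0.1.trans ha0.2).le, integral_Ioc_eq_integral_Ioo, h0]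
  have hsupp : Function.support (fun x => ∫ t in (0 : ℝ)..x, h t) ⊆ Icc a b := by
    intro x hx
    by_contra hxx
    refine hx ?_
    rw [mem_Icc, not_and_or, not_le, not_le] at hxx
    rcases hxx with hxa | hxb
    · refine (intervalIntegral.integral_congr (g := fun _ => (0 : ℝ)) fun t htt => ?_).trans (by simp)
      refine hz t fun hc => ?_
      have := htt.2
      have := hc.1
      have := ha0.1
      rcases le_max_iff.1 htt.2 with h | h <;> linarith
    · change ∫ t in (0 : ℝ)..x, h t = 0
      rw [← intervalIntegral.integral_add_adjacent_intervals (b := ℓ)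
        (hcont.intervalIntegrable _ _) (hcont.intervalIntegrable _ _), hfull, zero_add]
      refine (intervalIntegral.integral_congr (g := fun _ => (0 : ℝ)) fun t htt => ?_).trans (by simp)
      refine hz t fun hc => ?_
      have := hc.2
      have := hb0.2
      rcases min_le_iff.1 htt.1 with h | h <;> linarith
  have hts : tsupport (fun x => ∫ t in (0 : ℝ)..x, h t) ⊆ Icc a b :=
    closure_minimal hsupp isClosed_Icc
  refine ⟨_, ⟨?_, ?_, ?_⟩, hd'⟩
  · rw [contDiff_infty_iff_deriv]
    exact ⟨fun x => (hd x).differentiableAt, by rw [hd']; exact ht.smooth⟩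
  · exact isCompact_Icc.of_isClosed_subset (isClosed_tsupport _) hts
  · exact hts.trans fun x hx => ⟨ha0.1.trans_le hx.1, hx.2.trans_lt hb0.2⟩

lemma IsTest.lin {U : Set ℝ} {φ χ : ℝ → ℝ} (h : IsTest U φ) (h' : IsTest U χ) (c : ℝ) :
    IsTest U (fun x => φ x - c * χ x) where
  smooth := h.smooth.sub (contDiff_const.mul h'.smooth)
  compact := h.compact.sub h'.compact.mul_left
  subset := by
    refine (closure_minimal ?_ ((isClosed_tsupport φ).union (isClosed_tsupport χ))).trans
      (union_subset h.subset h'.subset)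
    intro x hx
    by_contra hh
    rw [mem_union, not_or] at hh
    refine hx ?_
    simp [image_eq_zero_of_notMem_tsupport hh.1, image_eq_zero_of_notMem_tsupport hh.2]

lemma exists_test_integral_one {ℓ : ℝ} (hℓ : 0 < ℓ) :
    ∃ w, IsTest (Ioo 0 ℓ) w ∧ ∫ x in Ioo 0 ℓ, w x = 1 := by
  let f : ContDiffBump (ℓ / 2) := ⟨ℓ / 8, ℓ / 4, by positivity, by linarith⟩
  have hs : tsupport (f.normed volume) ⊆ Ioo 0 ℓ := by
    rw [f.tsupport_normed_eq]
    intro x hx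
    rw [Metric.mem_closedBall, Real.dist_eq, abs_le] at hx
    change -(ℓ / 4) ≤ _ ∧ _ ≤ ℓ / 4 at hx
    constructor <;> linarith [hx.1, hx.2]
  refine ⟨f.normed volume, ⟨f.contDiff_normed, f.hasCompactSupport_normed, hs⟩, ?_⟩
  rw [setIntegral_eq_integral_of_forall_compl_eq_zero, f.integral_normed]
  intro x hx
  by_contra h
  exact hx (hs (subset_tsupport _ h))

/-- The gradient norm is definite on `H¹_*(0, ℓ)`. -/
lemma eq_zero_of_dx_eq_zero {ℓ : ℝ} (hℓ : 0 < ℓ) {u : L2 ℓ} (hu : u ∈ H1s ℓ) (h : dx u = 0) :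
    u = 0 := by
  obtain ⟨w, hw, hw1⟩ := exists_test_integral_one hℓ
  have hg := graph_dx hu.1
  rw [h] at hg
  have hz : ∀ φ, IsTest (Ioo 0 ℓ) φ → ∫ x in Ioo 0 ℓ, deriv φ x • u x = 0 := by
    intro φ hφ
    rw [hg φ hφ, neg_eq_zero]
    refine integral_eq_zero_of_ae ?_
    filter_upwards [Lp.coeFn_zero ℝ 2 (volume.restrict (Ioo 0 ℓ))] with x hx
    change _ • (0 : L2 ℓ) x = 0
    rw [hx]; simp
  set c := ∫ x in Ioo 0 ℓ, w x • u x with hc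
  have ig : ∀ {g : ℝ → ℝ}, IsTest (Ioo 0 ℓ) g → IntegrableOn g (Ioo 0 ℓ) := fun hg =>
    (hg.smooth.continuous.integrable_of_hasCompactSupport hg.compact).integrableOn
  have key : ∀ᵐ x, x ∈ Ioo 0 ℓ → (u x - c) = 0 := by
    refine isOpen_Ioo.ae_eq_zero_of_integral_contDiff_smul_eq_zero
      (u.integrable.sub (integrable_const c)).locallyIntegrableOn ?_
    intro g h1 h2 h3
    have hgt : IsTest (Ioo 0 ℓ) g := ⟨h1, h2, h3⟩
    set m := ∫ x in Ioo 0 ℓ, g x with hm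
    have ht := hgt.lin hw m
    obtain ⟨φ, hφ, hd⟩ := ht.primitive (by
      rw [integral_sub (ig hgt) ((ig hw).const_mul m), integral_const_mul, hw1, mul_one, sub_self])
    have e := hz φ hφ
    rw [hd] at e
    have e2 : ∫ x in Ioo 0 ℓ, (g x - m * w x) • u x = ∫ x in Ioo 0 ℓ, (g x • u x - m * (w x • u x)) := by
      congr 1; ext x; simp only [smul_eq_mul]; ring
    rw [e2, integral_sub (hgt.integrableOn_smul u.locallyIntegrableOn)
      ((hw.integrableOn_smul u.locallyIntegrableOn).const_mul m), integral_const_mul, ← hc] at e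
    rw [← setIntegral_eq_integral_of_forall_compl_eq_zero (s := Ioo 0 ℓ)]
    · have e3 : ∫ x in Ioo 0 ℓ, g x • (u x - c) = ∫ x in Ioo 0 ℓ, (g x • u x - g x * c) := by
        congr 1; ext x; simp only [smul_eq_mul]; ring
      rw [e3, integral_sub (hgt.integrableOn_smul u.locallyIntegrableOn) ((ig hgt).mul_const c),
        integral_mul_const, ← hm, e]
    · intro x hx
      have : g x = 0 := by
        by_contra hh
        exact hx (h3 (subset_tsupport _ hh))
      simp [this]
  rw [← ae_restrict_iff' measurableSet_Ioo] at key
  have hu0 : ∫ x in Ioo 0 ℓ, u x = 0 := hu.2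
  have hce : ∫ x in Ioo 0 ℓ, u x = ∫ x in Ioo 0 ℓ, c :=
    integral_congr_ae (by filter_upwards [key] with x hx; linarith)
  rw [hu0, setIntegral_const, smul_eq_mul, eq_comm, mul_eq_zero] at hce
  have hc0 : c = 0 := by
    rcases hce with h | h
    · rw [Real.volume_real_Ioo_of_le hℓ.le] at h
      linarith
    · exact h
  refine (Lp.eq_zero_iff_ae_eq_zero).2 ?_
  filter_upwards [key] with x hx
  simpa [hc0] using hx

/-! ### The memory kernel and the memory space -/

/-- A memory kernel: `g` is a summable function on `[0, ∞)` of total mass `1`, and `μ = -g'`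
satisfies the conditions

* `μ` is nonnegative, nonincreasing and absolutely continuous, with `μ(0) = μ(0⁺) ∈ (0, ∞)`;
* there is `ν > 0` such that `μ' + ν μ ≤ 0` almost everywhere.

(Boundedness and convexity of `g` follow; only the values of `g` and `μ` on `[0, ∞)` matter.) -/
structure MemoryKernel where
  g : ℝ → ℝ
  μ : ℝ → ℝ
  g_continuousOn : ContinuousOn g (Ici 0)
  g_integrableOn : IntegrableOn g (Ioi 0)
  g_mass : ∫ s in Ioi 0, g s = 1
  g_hasDerivAt : ∀ s, 0 < s → HasDerivAt g (-(μ s)) s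
  μ_nonneg : ∀ s, 0 ≤ s → 0 ≤ μ s
  μ_antitoneOn : AntitoneOn μ (Ici 0)
  μ_absolutelyContinuous : ∀ R, 0 < R → AbsolutelyContinuousOnInterval μ 0 R
  μ_zero_pos : 0 < μ 0
  μ_decay : ∃ ν, 0 < ν ∧ ∀ᵐ s ∂(volume.restrict (Ioi 0)), deriv μ s + ν * μ s ≤ 0

namespace MemoryKernel

variable (k : MemoryKernel)

/-- The measure `μ(s) ds` on `ℝ⁺ = (0, ∞)`. -/
def measure : Measure ℝ := (volume.restrict (Ioi 0)).withDensity (fun s => ENNReal.ofReal (k.μ s))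

/-- The set of those `s > 0` with `μ(s) > 0`, on which the classes of functions modulo `μ(s) ds`
live. It is an open interval `(0, s_∞)` with `0 < s_∞ ≤ ∞`, and it is all of `ℝ⁺` if `μ` has no
zero. -/
def supp : Set ℝ := {s | 0 < s ∧ 0 < k.μ s}

lemma μ_continuousOn : ContinuousOn k.μ (Ici 0) := by
  intro s hs
  have hs0 : (0 : ℝ) ≤ s := hs
  have h := (k.μ_absolutelyContinuous (s + 1) (by linarith)).uniformContinuousOn.continuousOn
  rw [uIcc_of_le (by linarith)] at h
  refine (h s ⟨hs0, by linarith⟩).mono_of_mem_nhdsWithin ?_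
  have : Iio (s + 1) ∈ 𝓝 s := Iio_mem_nhds (by linarith)
  filter_upwards [self_mem_nhdsWithin, mem_nhdsWithin_of_mem_nhds this] with t ht ht'
  exact ⟨ht, le_of_lt ht'⟩

lemma isOpen_supp : IsOpen k.supp := by
  have : k.supp = Ioi 0 ∩ k.μ ⁻¹' Ioi 0 := rfl
  rw [this]
  exact (k.μ_continuousOn.mono Ioi_subset_Ici_self).isOpen_inter_preimage isOpen_Ioi isOpen_Ioi

lemma supp_subset : k.supp ⊆ Ioi 0 := fun _ h => h.1

lemma aemeasurable_μ : AEMeasurable k.μ (volume.restrict (Ioi 0)) :=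
  (k.μ_continuousOn.mono Ioi_subset_Ici_self).aemeasurable measurableSet_Ioi

lemma measure_null_iff (N : Set ℝ) : k.measure N = 0 ↔ volume.restrict k.supp N = 0 := by
  rw [measure, withDensity_apply_eq_zero' k.aemeasurable_μ.ennreal_ofReal,
    Measure.restrict_apply' measurableSet_Ioi, Measure.restrict_apply' k.isOpen_supp.measurableSet]
  congr! 2
  ext s
  simp only [supp, mem_inter_iff, Set.mem_ofPred_eq, mem_Ioi, ne_eq, ENNReal.ofReal_eq_zero, not_le]
  tauto

lemma restrict_ac : volume.restrict k.supp ≪ k.measure := fun N h => (k.measure_null_iff N).1 h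

lemma ac_restrict : k.measure ≪ volume.restrict k.supp := fun N h => (k.measure_null_iff N).2 h

lemma μ_integrableOn : IntegrableOn k.μ (Ioi 0) := by
  have hanti : AntitoneOn k.g (Ici 0) := by
    refine antitoneOn_of_deriv_nonpos (convex_Ici 0) k.g_continuousOn ?_ ?_
    · rw [interior_Ici]
      exact fun s hs => (k.g_hasDerivAt s hs).differentiableAt.differentiableWithinAt
    · rw [interior_Ici]
      intro s hs
      rw [(k.g_hasDerivAt s hs).deriv]
      have := k.μ_nonneg s (le_of_lt hs)
      linarith
  have hnn : ∀ s, 0 ≤ s → 0 ≤ k.g s := by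
    intro s hs
    by_contra! hneg
    have h1 : IntegrableOn k.g (Ioi s) := k.g_integrableOn.mono_set (Ioi_subset_Ioi hs)
    have h2 : IntegrableOn (fun _ : ℝ => k.g s) (Ioi s) := by
      refine Integrable.mono h1 aestronglyMeasurable_const ?_
      filter_upwards [ae_restrict_mem measurableSet_Ioi] with t ht
      have := hanti hs (hs.trans (le_of_lt ht) : (0 : ℝ) ≤ t) (le_of_lt ht)
      rw [Real.norm_of_nonpos hneg.le, Real.norm_of_nonpos (this.trans hneg.le)]
      linarith
    rw [integrableOn_const_iff] at h2
    rcases h2 with h | h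
    · exact hneg.ne (by simpa using h)
    · simp at h
  have hG : Antitone fun s => k.g (max s 0) := fun s t hst =>
    hanti (le_max_right s 0 : (0 : ℝ) ≤ _) (le_max_right t 0 : (0 : ℝ) ≤ _)
      (max_le_max_right 0 hst)
  have hlim := tendsto_atTop_ciInf hG ⟨0, by rintro _ ⟨s, rfl⟩; exact hnn _ (le_max_right _ _)⟩
  have hlim' := hlim.congr' (f₂ := k.g) (by
    filter_upwards [eventually_ge_atTop 0] with s hs
    rw [max_eq_left hs])
  have := integrableOn_Ioi_deriv_of_nonpos (k.g_continuousOn 0 (by simp)) k.g_hasDerivAt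
    (fun s hs => by have := k.μ_nonneg s (le_of_lt hs); linarith) hlim'
  simpa using this.neg

instance : IsFiniteMeasure k.measure :=
  isFiniteMeasure_withDensity_ofReal k.μ_integrableOn.2

end MemoryKernel

/-- The memory space `L²(ℝ⁺; H¹₀(0, ℓ))` with respect to the measure `μ(s) ds`; its inner product is
`∫₀^∞ μ(s) ⟨η_x(s), ξ_x(s)⟩ ds`. -/
abbrev Memory (k : MemoryKernel) (ℓ : ℝ) : Type := Lp (H10Space ℓ) 2 k.measure

lemma Memory.integrable {k : MemoryKernel} {ℓ : ℝ} (η : Memory k ℓ) : Integrable η k.measure :=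
  (Lp.memLp η).integrable (by norm_num)

lemma Memory.locallyIntegrableOn {k : MemoryKernel} {ℓ : ℝ} (η : Memory k ℓ) :
    LocallyIntegrableOn η k.supp := by
  refine (locallyIntegrableOn_iff k.isOpen_supp.isLocallyClosed).2 fun K hKs hK => ?_
  have h1 := (integrable_withDensity_iff_integrable_smul₀' (μ := volume.restrict (Ioi 0))
    k.aemeasurable_μ.ennreal_ofReal (by simp)).1 η.integrable
  have h2 : IntegrableOn (fun s => k.μ s • η s) K := by
    have h3 : IntegrableOn (fun s => (ENNReal.ofReal (k.μ s)).toReal • η s) K :=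
      IntegrableOn.mono_set (t := Ioi 0) h1 (hKs.trans k.supp_subset)
    refine h3.congr_fun (fun s hs => ?_) hK.measurableSet
    simp only [ENNReal.toReal_ofReal (hKs hs).2.le]
  have hc : ContinuousOn (fun s => (k.μ s)⁻¹) K :=
    (k.μ_continuousOn.mono (fun s hs => le_of_lt (hKs hs).1)).inv₀ fun s hs => (hKs hs).2.ne'
  refine (h2.continuousOn_smul hc hK).congr_fun (fun s hs => ?_) hK.measurableSet
  simp only [smul_smul, inv_mul_cancel₀ (hKs hs).2.ne', one_smul]

/-- The weak derivative `D` with respect to `s`, with its maximal domain in the memory space. -/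
def Memory.D (k : MemoryKernel) (ℓ : ℝ) : Memory k ℓ →ₗ.[ℝ] Memory k ℓ :=
  weakD k.measure k.supp k.restrict_ac Memory.locallyIntegrableOn

lemma Memory.graph_D (k : MemoryKernel) (ℓ : ℝ) {η ξ : Memory k ℓ} :
    (η, ξ) ∈ (Memory.D k ℓ).graph ↔ IsWeakDeriv k.supp η ξ := by
  have h : (Memory.D k ℓ).graph = _ := Submodule.toLinearPMap_graph_eq _
    (weakGraph_single k.restrict_ac Memory.locallyIntegrableOn k.isOpen_supp k.ac_restrict)
  rw [h]
  rfl

/-- The domain of `T`: those `η` in the memory space whose weak derivative `Dη` is in the memory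
space, and with `‖η_x(s)‖ → 0` as `s → 0` (for a representative of the class `η`). -/
def Memory.domT (k : MemoryKernel) (ℓ : ℝ) : Submodule ℝ (Memory k ℓ) where
  carrier := {η | η ∈ (Memory.D k ℓ).domain ∧ ∃ w : ℝ → H10Space ℓ, w =ᵐ[k.measure] η ∧
    Tendsto (fun s => ‖w s‖) (𝓝[>] 0) (𝓝 0)}
  zero_mem' := ⟨Submodule.zero_mem _, fun _ => 0, (Lp.coeFn_zero _ _ _).symm, by simp⟩
  add_mem' := by
    rintro η ξ ⟨h1, w, h2, h3⟩ ⟨h1', w', h2', h3'⟩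
    refine ⟨Submodule.add_mem _ h1 h1', w + w', ?_, ?_⟩
    · exact (h2.add h2').trans (Lp.coeFn_add η ξ).symm
    · rw [← tendsto_zero_iff_norm_tendsto_zero] at *
      have h := h3.add h3'
      rw [add_zero] at h
      exact h
  smul_mem' := by
    rintro c η ⟨h1, w, h2, h3⟩
    refine ⟨Submodule.smul_mem _ c h1, c • w, ?_, ?_⟩
    · exact (h2.const_smul c).trans (Lp.coeFn_smul c η).symm
    · rw [← tendsto_zero_iff_norm_tendsto_zero] at *
      have h := h3.const_smul c
      rw [smul_zero] at h
      exact h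

/-- The operator `T η = -D η`. -/
def Memory.T (k : MemoryKernel) (ℓ : ℝ) : Memory k ℓ →ₗ.[ℝ] Memory k ℓ where
  domain := Memory.domT k ℓ
  toFun :=
    { toFun := fun η => -(Memory.D k ℓ ⟨η, η.2.1⟩)
      map_add' := fun η ξ => by
        rw [← neg_add, ← LinearPMap.map_add]
        rfl
      map_smul' := fun c η => by
        rw [RingHom.id_apply, smul_neg, ← LinearPMap.map_smul]
        rfl }

/-! ### The phase space -/

/-- The structural data of the thermoelastic beam on `[0, ℓ]`. -/
structure BeamData where
  ℓ : ℝ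
  ρ₁ : ℝ
  ρ₂ : ℝ
  ρ₃ : ℝ
  κ : ℝ
  b : ℝ
  δ : ℝ
  β : ℝ
  kernel : MemoryKernel
  ℓ_pos : 0 < ℓ
  ρ₁_pos : 0 < ρ₁
  ρ₂_pos : 0 < ρ₂
  ρ₃_pos : 0 < ρ₃
  κ_pos : 0 < κ
  b_pos : 0 < b
  δ_pos : 0 < δ
  β_pos : 0 < β

namespace BeamData

/-- The phase space `H¹₀ × L² × H¹_* × L²_* × L² × M` of the vectors `(φ, φ̃, ψ, ψ̃, θ, η)`. -/
def PhaseSpace (P : BeamData) : Type :=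
  H10Space P.ℓ × L2 P.ℓ × H1s P.ℓ × L2s P.ℓ × L2 P.ℓ × Memory P.kernel P.ℓ

variable {P : BeamData}

instance : AddCommGroup P.PhaseSpace := inferInstanceAs
  (AddCommGroup (H10Space P.ℓ × L2 P.ℓ × H1s P.ℓ × L2s P.ℓ × L2 P.ℓ × Memory P.kernel P.ℓ))

instance : Module ℝ P.PhaseSpace := inferInstanceAs
  (Module ℝ (H10Space P.ℓ × L2 P.ℓ × H1s P.ℓ × L2s P.ℓ × L2 P.ℓ × Memory P.kernel P.ℓ))

namespace PhaseSpace

/-- The component `φ`. -/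
def phi (z : P.PhaseSpace) : H10Space P.ℓ := z.1
/-- The component `φ̃`. -/
def phiT (z : P.PhaseSpace) : L2 P.ℓ := z.2.1
/-- The component `ψ`. -/
def psi (z : P.PhaseSpace) : H1s P.ℓ := z.2.2.1
/-- The component `ψ̃`. -/
def psiT (z : P.PhaseSpace) : L2s P.ℓ := z.2.2.2.1
/-- The component `θ`. -/
def theta (z : P.PhaseSpace) : L2 P.ℓ := z.2.2.2.2.1
/-- The component `η`. -/
def eta (z : P.PhaseSpace) : Memory P.kernel P.ℓ := z.2.2.2.2.2

/-- The derivative `φ_x`. -/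
def phiX (z : P.PhaseSpace) : L2 P.ℓ := dx z.phi.val
/-- The derivative `ψ_x`. -/
def psiX (z : P.PhaseSpace) : L2 P.ℓ := dx (z.psi : L2 P.ℓ)
/-- The shear `φ_x + ψ`. -/
def shear (z : P.PhaseSpace) : L2 P.ℓ := z.phiX + (z.psi : L2 P.ℓ)

section linearity

variable (z w : P.PhaseSpace) (c : ℝ)

@[simp] lemma phi_add : (z + w).phi = z.phi + w.phi := rfl
@[simp] lemma phiT_add : (z + w).phiT = z.phiT + w.phiT := rfl
@[simp] lemma psi_add : (z + w).psi = z.psi + w.psi := rfl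
@[simp] lemma psiT_add : (z + w).psiT = z.psiT + w.psiT := rfl
@[simp] lemma theta_add : (z + w).theta = z.theta + w.theta := rfl
@[simp] lemma eta_add : (z + w).eta = z.eta + w.eta := rfl
@[simp] lemma phi_smul : (c • z).phi = c • z.phi := rfl
@[simp] lemma phiT_smul : (c • z).phiT = c • z.phiT := rfl
@[simp] lemma psi_smul : (c • z).psi = c • z.psi := rfl
@[simp] lemma psiT_smul : (c • z).psiT = c • z.psiT := rfl
@[simp] lemma theta_smul : (c • z).theta = c • z.theta := rfl
@[simp] lemma eta_smul : (c • z).eta = c • z.eta := rfl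

@[simp] lemma phiX_add : (z + w).phiX = z.phiX + w.phiX := map_add H10Space.D z.phi w.phi
@[simp] lemma phiX_smul : (c • z).phiX = c • z.phiX := map_smul H10Space.D c z.phi
@[simp] lemma psiX_add : (z + w).psiX = z.psiX + w.psiX := dx_add z.psi.2.1 w.psi.2.1
@[simp] lemma psiX_smul : (c • z).psiX = c • z.psiX := dx_smul c z.psi.2.1
@[simp] lemma shear_add : (z + w).shear = z.shear + w.shear := by
  simp only [shear, phiX_add, psi_add, Submodule.coe_add]
  abel
@[simp] lemma shear_smul : (c • z).shear = c • z.shear := by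
  simp only [shear, phiX_smul, psi_smul, Submodule.coe_smul, smul_add]

end linearity

/-- The inner product whose norm is
`‖z‖² = κ‖φ_x + ψ‖² + ρ₁‖φ̃‖² + b‖ψ_x‖² + ρ₂‖ψ̃‖² + ρ₃‖θ‖² + (1/β)‖η‖²_M`. -/
@[reducible] def core (P : BeamData) : InnerProductSpace.Core ℝ P.PhaseSpace where
  inner z w := P.κ * ⟪z.shear, w.shear⟫ + P.ρ₁ * ⟪z.phiT, w.phiT⟫ + P.b * ⟪z.psiX, w.psiX⟫
    + P.ρ₂ * ⟪(z.psiT : L2 P.ℓ), (w.psiT : L2 P.ℓ)⟫ + P.ρ₃ * ⟪z.theta, w.theta⟫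
    + (1 / P.β) * ⟪z.eta, w.eta⟫
  conj_inner_symm z w := by
    simp only [conj_trivial, real_inner_comm]
  re_inner_nonneg z := by
    have := P.κ_pos; have := P.ρ₁_pos; have := P.b_pos; have := P.ρ₂_pos
    have := P.ρ₃_pos; have := P.β_pos
    simp only [real_inner_self_eq_norm_sq, RCLike.re_to_real]
    positivity
  add_left z w v := by
    simp only [shear_add, phiT_add, psiX_add, psiT_add, theta_add, eta_add, Submodule.coe_add,
      inner_add_left]
    ring
  smul_left z w c := by
    simp only [shear_smul, phiT_smul, psiX_smul, psiT_smul, theta_smul, eta_smul,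
      Submodule.coe_smul, inner_smul_left, conj_trivial]
    ring
  definite z hz := by
    have hκ := P.κ_pos; have hρ₁ := P.ρ₁_pos; have hb := P.b_pos; have hρ₂ := P.ρ₂_pos
    have hρ₃ := P.ρ₃_pos; have hβ := P.β_pos
    simp only [real_inner_self_eq_norm_sq] at hz
    have p1 : 0 ≤ P.κ * ‖z.shear‖ ^ 2 := by positivity
    have p2 : 0 ≤ P.ρ₁ * ‖z.phiT‖ ^ 2 := by positivity
    have p3 : 0 ≤ P.b * ‖z.psiX‖ ^ 2 := by positivity
    have p4 : 0 ≤ P.ρ₂ * ‖(z.psiT : L2 P.ℓ)‖ ^ 2 := by positivity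
    have p5 : 0 ≤ P.ρ₃ * ‖z.theta‖ ^ 2 := by positivity
    have p6 : 0 ≤ (1 / P.β) * ‖z.eta‖ ^ 2 := by positivity
    have e1 : P.κ * ‖z.shear‖ ^ 2 = 0 := by linarith
    have e2 : P.ρ₁ * ‖z.phiT‖ ^ 2 = 0 := by linarith
    have e3 : P.b * ‖z.psiX‖ ^ 2 = 0 := by linarith
    have e4 : P.ρ₂ * ‖(z.psiT : L2 P.ℓ)‖ ^ 2 = 0 := by linarith
    have e5 : P.ρ₃ * ‖z.theta‖ ^ 2 = 0 := by linarith
    have e6 : (1 / P.β) * ‖z.eta‖ ^ 2 = 0 := by linarith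
    simp only [mul_eq_zero, hκ.ne', hρ₁.ne', hb.ne', hρ₂.ne', hρ₃.ne', one_div, inv_eq_zero,
      hβ.ne', false_or, pow_eq_zero_iff two_ne_zero, norm_eq_zero] at e1 e2 e3 e4 e5 e6
    have hpsi : (z.psi : L2 P.ℓ) = 0 := eq_zero_of_dx_eq_zero P.ℓ_pos z.psi.2 e3
    rw [shear, hpsi, add_zero] at e1
    have hphi : z.phi = 0 := H10Space.eq_zero e1
    exact Prod.ext hphi (Prod.ext e2 (Prod.ext (Subtype.ext hpsi)
      (Prod.ext (Subtype.ext e4) (Prod.ext e5 e6))))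

instance : NormedAddCommGroup P.PhaseSpace := (core P).toNormedAddCommGroup

instance : InnerProductSpace ℝ P.PhaseSpace := InnerProductSpace.ofCore (core P).toCore

lemma norm_sq (z : P.PhaseSpace) : ‖z‖ ^ 2 =
    P.κ * ‖dx z.phi.val + z.psi‖ ^ 2 + P.ρ₁ * ‖z.phiT‖ ^ 2 + P.b * ‖dx (z.psi : L2 P.ℓ)‖ ^ 2
      + P.ρ₂ * ‖z.psiT‖ ^ 2 + P.ρ₃ * ‖z.theta‖ ^ 2 + (1 / P.β) * ‖z.eta‖ ^ 2 := by
  rw [← real_inner_self_eq_norm_sq z]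
  change P.κ * ⟪z.shear, z.shear⟫ + P.ρ₁ * ⟪z.phiT, z.phiT⟫ + P.b * ⟪z.psiX, z.psiX⟫
    + P.ρ₂ * ⟪(z.psiT : L2 P.ℓ), (z.psiT : L2 P.ℓ)⟫ + P.ρ₃ * ⟪z.theta, z.theta⟫
    + (1 / P.β) * ⟪z.eta, z.eta⟫ = _
  simp only [real_inner_self_eq_norm_sq]
  rfl

/-- The element `∫₀^∞ μ(s) η(s) ds` of `H¹₀(0, ℓ)`. -/
def etaMean (z : P.PhaseSpace) : H10Space P.ℓ := ∫ s, z.eta s ∂P.kernel.measure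

lemma etaMean_add (z w : P.PhaseSpace) : (z + w).etaMean = z.etaMean + w.etaMean := by
  rw [etaMean, etaMean, etaMean, ← integral_add z.eta.integrable w.eta.integrable]
  exact integral_congr_ae (Lp.coeFn_add z.eta w.eta)

lemma etaMean_smul (c : ℝ) (z : P.PhaseSpace) : (c • z).etaMean = c • z.etaMean := by
  rw [etaMean, etaMean, ← integral_smul]
  exact integral_congr_ae (Lp.coeFn_smul c z.eta)

/-- The conditions that define the domain of the operator `A`. -/
structure InDomain (z : P.PhaseSpace) : Prop where
  phi_mem : z.phi.val ∈ H2 P.ℓ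
  phiT_mem : z.phiT ∈ H10 P.ℓ
  psiX_mem : dx (z.psi : L2 P.ℓ) ∈ H10 P.ℓ
  psiT_mem : (z.psiT : L2 P.ℓ) ∈ H1s P.ℓ
  theta_mem : z.theta ∈ H10 P.ℓ
  eta_mem : z.eta ∈ Memory.domT P.kernel P.ℓ
  etaMean_mem : z.etaMean.val ∈ H2 P.ℓ

lemma InDomain.shear_mem {z : P.PhaseSpace} (h : z.InDomain) :
    dx z.phi.val + (z.psi : L2 P.ℓ) ∈ H1 P.ℓ :=
  (H1 P.ℓ).add_mem h.phi_mem.2 z.psi.2.1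

/-- The vector with the given components. -/
def ofComponents (φ : H10Space P.ℓ) (φ' : L2 P.ℓ) (ψ : H1s P.ℓ) (ψ' : L2s P.ℓ) (θ : L2 P.ℓ)
    (η : Memory P.kernel P.ℓ) : P.PhaseSpace := (φ, φ', ψ, ψ', θ, η)

lemma ofComponents_add (φ₁ φ₂ : H10Space P.ℓ) (φ₁' φ₂' : L2 P.ℓ) (ψ₁ ψ₂ : H1s P.ℓ) (ψ₁' ψ₂' : L2s P.ℓ)
    (θ₁ θ₂ : L2 P.ℓ) (η₁ η₂ : Memory P.kernel P.ℓ) :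
    ofComponents φ₁ φ₁' ψ₁ ψ₁' θ₁ η₁ + ofComponents φ₂ φ₂' ψ₂ ψ₂' θ₂ η₂ =
      ofComponents (φ₁ + φ₂) (φ₁' + φ₂') (ψ₁ + ψ₂) (ψ₁' + ψ₂') (θ₁ + θ₂) (η₁ + η₂) := rfl

lemma ofComponents_smul (c : ℝ) (φ : H10Space P.ℓ) (φ' : L2 P.ℓ) (ψ : H1s P.ℓ) (ψ' : L2s P.ℓ) (θ : L2 P.ℓ)
    (η : Memory P.kernel P.ℓ) :
    c • ofComponents φ φ' ψ ψ' θ η =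
      ofComponents (c • φ) (c • φ') (c • ψ) (c • ψ') (c • θ) (c • η) := rfl

/-- The first component of `A z`: `φ̃`. -/
def A1 (z : P.PhaseSpace) (h : z.InDomain) : H10Space P.ℓ := H10Space.mk z.phiT h.phiT_mem

/-- The second component of `A z`: `(κ/ρ₁) (φ_x + ψ)_x`. -/
def A2 (z : P.PhaseSpace) : L2 P.ℓ := (P.κ / P.ρ₁) • dx (dx z.phi.val + (z.psi : L2 P.ℓ))

/-- The third component of `A z`: `ψ̃`. -/
def A3 (z : P.PhaseSpace) (h : z.InDomain) : H1s P.ℓ := ⟨z.psiT, h.psiT_mem⟩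

/-- The fourth component of `A z`: `(b/ρ₂) ψ_xx - (κ/ρ₂) (φ_x + ψ) - (δ/ρ₂) θ_x`, which is an
element of `L²_*(0, ℓ)`. -/
def A4 (z : P.PhaseSpace) (h : z.InDomain) : L2s P.ℓ :=
  ⟨(P.b / P.ρ₂) • dx (dx (z.psi : L2 P.ℓ)) - (P.κ / P.ρ₂) • (dx z.phi.val + (z.psi : L2 P.ℓ))
      - (P.δ / P.ρ₂) • dx z.theta,
    (L2s P.ℓ).sub_mem ((L2s P.ℓ).sub_mem ((L2s P.ℓ).smul_mem _ (dx_mem_L2s h.psiX_mem))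
      ((L2s P.ℓ).smul_mem _ ((L2s P.ℓ).add_mem (dx_mem_L2s z.phi.val_mem) z.psi.2.2)))
      ((L2s P.ℓ).smul_mem _ (dx_mem_L2s h.theta_mem))⟩

/-- The fifth component of `A z`: `(1/(βρ₃)) ∫₀^∞ μ(s) η_xx(s) ds - (δ/ρ₃) ψ̃_x`, where the integral
means `(∫₀^∞ μ(s) η(s) ds)_xx`. -/
def A5 (z : P.PhaseSpace) : L2 P.ℓ :=
  (1 / (P.β * P.ρ₃)) • dx (dx z.etaMean.val) - (P.δ / P.ρ₃) • dx (z.psiT : L2 P.ℓ)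

/-- The sixth component of `A z`: `T η + θ`, where `θ` is constant in `s`. -/
def A6 (z : P.PhaseSpace) (h : z.InDomain) : Memory P.kernel P.ℓ :=
  Memory.T P.kernel P.ℓ ⟨z.eta, h.eta_mem⟩
    + Lp.const 2 P.kernel.measure (H10Space.mk z.theta h.theta_mem)

lemma A1_add {z w : P.PhaseSpace} (hz : z.InDomain) (hw : w.InDomain) (h : (z + w).InDomain) :
    A1 (z + w) h = A1 z hz + A1 w hw := rfl

lemma A1_smul {z : P.PhaseSpace} (c : ℝ) (hz : z.InDomain) (h : (c • z).InDomain) :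
    A1 (c • z) h = c • A1 z hz := rfl

lemma A2_eq (z : P.PhaseSpace) : A2 z = (P.κ / P.ρ₁) • dx z.shear := rfl

lemma A2_add {z w : P.PhaseSpace} (hz : z.InDomain) (hw : w.InDomain) :
    A2 (z + w) = A2 z + A2 w := by
  rw [A2_eq, A2_eq, A2_eq, shear_add, dx_add (u := z.shear) (v := w.shear) hz.shear_mem hw.shear_mem, smul_add]

lemma A2_smul {z : P.PhaseSpace} (c : ℝ) (hz : z.InDomain) :
    A2 (c • z) = c • A2 z := by
  rw [A2_eq, A2_eq, shear_smul, dx_smul (u := z.shear) c hz.shear_mem, smul_comm]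

lemma A3_add {z w : P.PhaseSpace} (hz : z.InDomain) (hw : w.InDomain) (h : (z + w).InDomain) :
    A3 (z + w) h = A3 z hz + A3 w hw := rfl

lemma A3_smul {z : P.PhaseSpace} (c : ℝ) (hz : z.InDomain) (h : (c • z).InDomain) :
    A3 (c • z) h = c • A3 z hz := rfl

lemma coe_A4 (z : P.PhaseSpace) (h : z.InDomain) : (A4 z h : L2 P.ℓ) =
    (P.b / P.ρ₂) • dx z.psiX - (P.κ / P.ρ₂) • z.shear - (P.δ / P.ρ₂) • dx z.theta := rfl

lemma A4_add {z w : P.PhaseSpace} (hz : z.InDomain) (hw : w.InDomain) (h : (z + w).InDomain) :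
    A4 (z + w) h = A4 z hz + A4 w hw := by
  apply Subtype.ext
  rw [Submodule.coe_add, coe_A4, coe_A4, coe_A4, psiX_add, shear_add, theta_add,
    dx_add hz.theta_mem.1 hw.theta_mem.1,
    dx_add (u := z.psiX) (v := w.psiX) hz.psiX_mem.1 hw.psiX_mem.1]
  module

lemma A4_smul {z : P.PhaseSpace} (c : ℝ) (hz : z.InDomain) (h : (c • z).InDomain) :
    A4 (c • z) h = c • A4 z hz := by
  apply Subtype.ext
  rw [Submodule.coe_smul, coe_A4, coe_A4, psiX_smul, shear_smul, theta_smul,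
    dx_smul c hz.theta_mem.1, dx_smul (u := z.psiX) c hz.psiX_mem.1]
  module

lemma A5_add {z w : P.PhaseSpace} (hz : z.InDomain) (hw : w.InDomain) :
    A5 (z + w) = A5 z + A5 w := by
  rw [A5, A5, A5, psiT_add, Submodule.coe_add, etaMean_add, _root_.map_add,
    dx_add hz.etaMean_mem.1 hw.etaMean_mem.1, dx_add hz.etaMean_mem.2 hw.etaMean_mem.2,
    dx_add hz.psiT_mem.1 hw.psiT_mem.1]
  module

lemma A5_smul {z : P.PhaseSpace} (c : ℝ) (hz : z.InDomain) : A5 (c • z) = c • A5 z := by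
  rw [A5, A5, psiT_smul, Submodule.coe_smul, etaMean_smul, _root_.map_smul,
    dx_smul c hz.etaMean_mem.1, dx_smul c hz.etaMean_mem.2, dx_smul c hz.psiT_mem.1]
  module

lemma A6_add {z w : P.PhaseSpace} (hz : z.InDomain) (hw : w.InDomain) (h : (z + w).InDomain) :
    A6 (z + w) h = A6 z hz + A6 w hw := by
  have e1 : (⟨(z + w).eta, h.eta_mem⟩ : (Memory.T P.kernel P.ℓ).domain) =
      ⟨z.eta, hz.eta_mem⟩ + ⟨w.eta, hw.eta_mem⟩ := rfl
  have e2 : H10Space.mk (z + w).theta h.theta_mem =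
      H10Space.mk z.theta hz.theta_mem + H10Space.mk w.theta hw.theta_mem := rfl
  rw [A6, A6, A6, e1, e2, LinearPMap.map_add, _root_.map_add]
  abel

lemma A6_smul {z : P.PhaseSpace} (c : ℝ) (hz : z.InDomain) (h : (c • z).InDomain) :
    A6 (c • z) h = c • A6 z hz := by
  have e1 : (⟨(c • z).eta, h.eta_mem⟩ : (Memory.T P.kernel P.ℓ).domain) =
      c • ⟨z.eta, hz.eta_mem⟩ := rfl
  have e2 : H10Space.mk (c • z).theta h.theta_mem = c • H10Space.mk z.theta hz.theta_mem := rfl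
  have e3 : Lp.const 2 P.kernel.measure (c • H10Space.mk z.theta hz.theta_mem) =
      c • Lp.const 2 P.kernel.measure (H10Space.mk z.theta hz.theta_mem) :=
    map_smul (Lp.constₗ 2 P.kernel.measure ℝ) c _
  rw [A6, A6, e1, e2, e3, LinearPMap.map_smul, smul_add]

end PhaseSpace

open PhaseSpace in
/-- The domain of the operator `A`. -/
def domA (P : BeamData) : Submodule ℝ P.PhaseSpace where
  carrier := {z | z.InDomain}
  zero_mem' := by
    have h0 : dx (0 : L2 P.ℓ) = 0 := by simpa using dx_smul (0 : ℝ) (H1 P.ℓ).zero_mem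
    refine ⟨Submodule.zero_mem _, Submodule.zero_mem _, ?_, Submodule.zero_mem _,
      Submodule.zero_mem _, Submodule.zero_mem _, ?_⟩
    · change dx (0 : L2 P.ℓ) ∈ _
      rw [h0]
      exact Submodule.zero_mem _
    · have : (0 : P.PhaseSpace).etaMean = 0 := by simpa using etaMean_smul 0 (0 : P.PhaseSpace)
      rw [this, map_zero]
      exact Submodule.zero_mem _
  add_mem' := by
    intro z w hz hw
    refine ⟨(H2 P.ℓ).add_mem hz.phi_mem hw.phi_mem, (H10 P.ℓ).add_mem hz.phiT_mem hw.phiT_mem, ?_,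
      (H1s P.ℓ).add_mem hz.psiT_mem hw.psiT_mem, (H10 P.ℓ).add_mem hz.theta_mem hw.theta_mem,
      (Memory.domT P.kernel P.ℓ).add_mem hz.eta_mem hw.eta_mem, ?_⟩
    · have := psiX_add z w
      rw [psiX] at this
      rw [this]
      exact (H10 P.ℓ).add_mem hz.psiX_mem hw.psiX_mem
    · rw [etaMean_add, map_add]
      exact (H2 P.ℓ).add_mem hz.etaMean_mem hw.etaMean_mem
  smul_mem' := by
    intro c z hz
    refine ⟨(H2 P.ℓ).smul_mem c hz.phi_mem, (H10 P.ℓ).smul_mem c hz.phiT_mem, ?_,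
      (H1s P.ℓ).smul_mem c hz.psiT_mem, (H10 P.ℓ).smul_mem c hz.theta_mem,
      (Memory.domT P.kernel P.ℓ).smul_mem c hz.eta_mem, ?_⟩
    · have := psiX_smul z c
      rw [psiX] at this
      rw [this]
      exact (H10 P.ℓ).smul_mem c hz.psiX_mem
    · rw [etaMean_smul, map_smul]
      exact (H2 P.ℓ).smul_mem c hz.etaMean_mem

open PhaseSpace in
/-- The operator `A`. For `z = (φ, φ̃, ψ, ψ̃, θ, η)` in its domain, `A z` has the components
* `φ̃`,
* `(κ/ρ₁) (φ_x + ψ)_x`,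
* `ψ̃`,
* `(b/ρ₂) ψ_xx - (κ/ρ₂) (φ_x + ψ) - (δ/ρ₂) θ_x`,
* `(1/(βρ₃)) (∫₀^∞ μ(s) η(s) ds)_xx - (δ/ρ₃) ψ̃_x`,
* `T η + θ` (where `θ` is constant in `s`). -/
def A (P : BeamData) : P.PhaseSpace →ₗ.[ℝ] P.PhaseSpace where
  domain := P.domA
  toFun :=
    { toFun := fun z =>
        ofComponents (A1 z.1 z.2) (A2 z.1) (A3 z.1 z.2) (A4 z.1 z.2) (A5 z.1) (A6 z.1 z.2)
      map_add' := fun z w => by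
        have h : (z.1 + w.1).InDomain := P.domA.add_mem z.2 w.2
        rw [ofComponents_add, ← A1_add z.2 w.2 h, ← A2_add z.2 w.2, ← A3_add z.2 w.2 h,
          ← A4_add z.2 w.2 h, ← A5_add z.2 w.2, ← A6_add z.2 w.2 h]
        simp only [Submodule.coe_add]
      map_smul' := fun c z => by
        have h : (c • z.1).InDomain := P.domA.smul_mem c z.2
        rw [RingHom.id_apply, ofComponents_smul, ← A1_smul c z.2 h, ← A2_smul c z.2,
          ← A3_smul c z.2 h, ← A4_smul c z.2 h, ← A5_smul c z.2, ← A6_smul c z.2 h]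
        simp only [Submodule.coe_smul] }

end BeamData

/-! ### Contraction semigroups and their generators -/

/-- A strongly continuous semigroup of linear contractions on a normed space `X`. -/
@[ext] structure ContractionSemigroup (X : Type*) [NormedAddCommGroup X] [NormedSpace ℝ X] where
  S : ℝ≥0 → X →L[ℝ] X
  map_zero : S 0 = ContinuousLinearMap.id ℝ X
  map_add : ∀ s t, S (s + t) = (S s).comp (S t)
  strongly_continuous : ∀ x, Continuous fun t => S t x
  contraction : ∀ t, ‖S t‖ ≤ 1

namespace ContractionSemigroup

variable {X : Type*} [NormedAddCommGroup X] [NormedSpace ℝ X]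

/-- The graph of the infinitesimal generator: the pairs `(x, y)` with
`(S(t)x - x)/t → y` as `t → 0⁺`. -/
def generatorGraph (S : ContractionSemigroup X) : Submodule ℝ (X × X) where
  carrier := {p | Tendsto (fun t : ℝ≥0 => (t : ℝ)⁻¹ • (S.S t p.1 - p.1)) (𝓝[>] 0) (𝓝 p.2)}
  zero_mem' := by simp
  add_mem' := by
    intro p q hp hq
    refine (Tendsto.add hp hq).congr fun t => ?_
    rw [← smul_add, Prod.fst_add, _root_.map_add]
    congr 1
    abel
  smul_mem' := by
    intro c p hp
    refine (Tendsto.const_smul hp c).congr fun t => ?_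
    rw [smul_comm, Prod.smul_fst, map_smul, smul_sub]

/-- The infinitesimal generator of the semigroup: `x` is in its domain if `(S(t)x - x)/t` has a
limit in `X` as `t → 0⁺`, and then this limit is its value at `x`. -/
def generator (S : ContractionSemigroup X) : X →ₗ.[ℝ] X := S.generatorGraph.toLinearPMap

lemma mem_generator_graph (S : ContractionSemigroup X) {x y : X} :
    (x, y) ∈ S.generator.graph ↔
      Tendsto (fun t : ℝ≥0 => (t : ℝ)⁻¹ • (S.S t x - x)) (𝓝[>] 0) (𝓝 y) := by
  rw [generator, Submodule.toLinearPMap_graph_eq]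
  · rfl
  · rintro ⟨u, v⟩ h (rfl : u = 0)
    have h' : Tendsto (fun t : ℝ≥0 => (t : ℝ)⁻¹ • (S.S t 0 - 0)) (𝓝[>] 0) (𝓝 v) := h
    simp only [_root_.map_zero, sub_self, smul_zero] at h'
    exact tendsto_nhds_unique h' tendsto_const_nhds

end ContractionSemigroup

end TimoGP

end

/-! By the Lumer–Phillips theorem in a Hilbert space, it suffices that A is dissipative and that 1 −
A is onto. Density of the domain need not be checked: in a Hilbert space it follows from these two
facts (`dense_domain`). The theorem is proved here through Yosida approximations. Surjectivity of 1
− A spreads to c − A along a sequence c → ∞ by a fixed point argument. The resolvents give commuting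
bounded dissipative operators, and their exponentials converge strongly to the semigroup. Generators
of contraction semigroups are dissipative, so a generator that contains A cannot be larger than A. A
densely defined generator determines its semigroup by an energy estimate for the difference of two
orbits.

Dissipativity of A is the energy identity ⟨Az, z⟩ = (1/β)⟨Tη, η⟩: after integration by parts all
other terms cancel in pairs. The sign of ⟨Tη, η⟩ comes from η(0) = 0 and from the monotonicity of μ:
on (0, S) one integrates μ (‖η‖²)' by parts, and both the boundary term at S and −∫ μ' ‖η‖² are
nonnegative (`integral_mul_inner_primitive_nonneg`). To use this, the weak derivative in s is first
turned into a primitive (`IsWeakDeriv.exists_ae_eq_add_primitive`, `Memory.ae_eq_primitive`).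

For surjectivity, the equation z − Az = f is reduced to its components φ, ψ, θ. The velocities are
φ̃ = φ − f₁ and ψ̃ = ψ − f₃. The memory component is (1 − T)⁻¹f₆ + (1 − T)⁻¹θ, where 1 − T is
inverted explicitly (`Memory.exists_sub_T_eq`) and (1 − T)⁻¹θ = (1 − e^{−s})θ contributes a positive
multiple of θ to the mean of η. What remains is an elliptic system that is solved weakly by
Lax–Milgram (`exists_weak_solution`). The weak equations then yield the regularity and the boundary
conditions required in the domain of A. -/

noncomputable section

namespace TimoGP

/-! ### Dissipative relations and their resolvents. -/

section LumerPhillips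

variable {X : Type*} [NormedAddCommGroup X] [InnerProductSpace ℝ X]

/-- The linear relation `G` is dissipative: `⟨y, x⟩ ≤ 0` for all `(x, y) ∈ G`. -/
def IsDissipative (G : Submodule ℝ (X × X)) : Prop := ∀ x y : X, (x, y) ∈ G → ⟪y, x⟫ ≤ 0

/-- The range of `c - G` is the whole space. -/
def HasFullRange (G : Submodule ℝ (X × X)) (c : ℝ) : Prop :=
  ∀ f : X, ∃ x y : X, (x, y) ∈ G ∧ c • x - y = f

namespace IsDissipative

variable {G : Submodule ℝ (X × X)}

/-- Pairing c x − y with x leaves c‖x‖² − ⟨y, x⟩ ≥ c‖x‖²; Cauchy–Schwarz and division by ‖x‖ do the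
rest. -/
lemma norm_le (hG : IsDissipative G) {c : ℝ} {x y : X} (h : (x, y) ∈ G) :
    c * ‖x‖ ≤ ‖c • x - y‖ := by
  rcases eq_or_ne x 0 with rfl | hx
  · simp
  have h1 : c * ‖x‖ ^ 2 ≤ ⟪c • x - y, x⟫ := by
    rw [inner_sub_left, real_inner_smul_left, real_inner_self_eq_norm_sq]
    linarith [hG x y h]
  have h2 := real_inner_le_norm (c • x - y) x
  have h3 : 0 < ‖x‖ := norm_pos_iff.2 hx
  nlinarith

/-- Apply `norm_le` to the difference of the two pairs. Besides uniqueness for the resolvent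
equation, this gives maximality: a dissipative relation cannot properly extend one for which c − G
is already onto. -/
lemma eq_of_smul_sub_eq (hG : IsDissipative G) {c : ℝ} (hc : 0 < c) {x y x' y' : X}
    (h : (x, y) ∈ G) (h' : (x', y') ∈ G) (he : c • x - y = c • x' - y') : x = x' ∧ y = y' := by
  have h0 := hG.norm_le (c := c) (G.sub_mem h h')
  have e : c • (x - x') - (y - y') = 0 := by
    rw [smul_sub, sub_sub_sub_comm, he, sub_self]
  change c * ‖x - x'‖ ≤ ‖c • (x - x') - (y - y')‖ at h0
  rw [e, norm_zero] at h0
  have hx : ‖x - x'‖ = 0 := le_antisymm (by nlinarith [norm_nonneg (x - x')]) (norm_nonneg _)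
  have hx' : x = x' := sub_eq_zero.1 (norm_eq_zero.1 hx)
  subst hx'
  exact ⟨rfl, sub_right_injective he⟩

/-- The resolvent scaled to a contraction, `J = c (c - G)⁻¹`. -/
lemma exists_resolvent (hG : IsDissipative G) {c : ℝ} (hc : 0 < c) (hr : HasFullRange G c) :
    ∃ J : X →L[ℝ] X, ‖J‖ ≤ 1 ∧ (∀ x, (J x, c • (J x - x)) ∈ G) ∧
      ∀ x y, (x, y) ∈ G → J y = c • (J x - x) := by
  choose R Y hm he using hr
  -- Uniqueness of the solution is what makes the chosen solution map `R` linear.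
  have key : ∀ x f, (x, c • x - f) ∈ G → R f = x := fun x f h =>
    (hG.eq_of_smul_sub_eq hc (hm f) h (by rw [he]; abel)).1
  have hm' : ∀ f, (R f, c • R f - f) ∈ G := fun f => by
    have e : c • R f - f = Y f := by
      nth_rw 2 [← he f]
      abel
    rw [e]
    exact hm f
  let L : X →ₗ[ℝ] X :=
    { toFun := R
      map_add' := fun f g => key _ _ (by
        convert! G.add_mem (hm' f) (hm' g) using 1
        simp only [Prod.mk_add_mk, smul_add, Prod.mk.injEq, true_and]; abel)
      map_smul' := fun a f => key _ _ (by
        convert! G.smul_mem a (hm' f) using 1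
        simp only [Prod.smul_mk, RingHom.id_apply, Prod.mk.injEq, true_and, smul_sub]
        rw [smul_comm]) }
  let J : X →L[ℝ] X := (c • L).mkContinuous 1 (fun f => by
    have := hG.norm_le (c := c) (hm' f)
    rw [sub_sub_cancel] at this
    rw [one_mul, LinearMap.smul_apply, norm_smul, Real.norm_of_nonneg hc.le]
    exact this)
  have hJ : ∀ f, J f = c • R f := fun f => rfl
  refine ⟨J, LinearMap.mkContinuous_norm_le _ zero_le_one _, fun f => ?_, fun x y h => ?_⟩
  · convert! G.smul_mem c (hm' f) using 1
  · have h1 : J (c • x - y) = c • x := by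
      rw [hJ, key x (c • x - y) (by rwa [sub_sub_cancel])]
    rw [_root_.map_sub, _root_.map_smul] at h1
    rw [smul_sub, ← h1, sub_sub_cancel]

/-- The equation (3c/2)z − y = f reads cz − y = f − (c/2)z, that is, z = c⁻¹J(f − (c/2)z), and the
right-hand side contracts in z with constant 1/2. Any factor strictly between 1 and 2 would serve;
its powers then carry full range to arbitrarily large c. -/
lemma hasFullRange_mul [CompleteSpace X] (hG : IsDissipative G) {c : ℝ} (hc : 0 < c)
    (hr : HasFullRange G c) : HasFullRange G (3 / 2 * c) := by
  obtain ⟨J, hJ, hJG, -⟩ := hG.exists_resolvent hc hr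
  intro f
  let F : X → X := fun z => c⁻¹ • J (f - (c / 2) • z)
  have hF : ContractingWith (1 / 2) F := by
    refine ⟨by norm_num, LipschitzWith.of_dist_le_mul fun z w => ?_⟩
    have e : F z - F w = (-(1 / 2) : ℝ) • J (z - w) := by
      simp only [F, _root_.map_sub, _root_.map_smul, ← smul_sub]
      rw [sub_sub_sub_cancel_left, ← smul_sub, smul_smul, ← neg_sub (J z), smul_neg, neg_smul]
      congr 2
      field_simp
    rw [dist_eq_norm, dist_eq_norm, e, norm_smul]
    have := J.le_of_opNorm_le hJ (z - w)
    rw [one_mul] at this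
    rw [Real.norm_eq_abs, abs_neg, abs_of_pos (by norm_num)]
    push_cast
    linarith
  have hfix : F _ = _ := hF.fixedPoint_isFixedPt
  set z := ContractingWith.fixedPoint F hF
  refine ⟨z, (3 / 2 * c) • z - f, ?_, ?_⟩
  · convert! G.smul_mem c⁻¹ (hJG (f - (c / 2) • z)) using 1
    refine Prod.ext hfix.symm ?_
    rw [Prod.smul_snd, smul_smul, inv_mul_cancel₀ hc.ne', one_smul]
    have : J (f - (c / 2) • z) = c • z := by
      conv_rhs => rw [← hfix]
      simp only [F, smul_smul, mul_inv_cancel₀ hc.ne', one_smul]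
    rw [this]
    module
  · abel

lemma exists_forall_hasFullRange [CompleteSpace X] (hG : IsDissipative G)
    (hr : HasFullRange G 1) : ∃ c : ℕ → ℝ, (∀ n, 0 < c n) ∧ Tendsto c atTop atTop ∧
      ∀ n, HasFullRange G (c n) := by
  refine ⟨fun n => (3 / 2 : ℝ) ^ n, fun n => by positivity,
    tendsto_pow_atTop_atTop_of_one_lt (by norm_num), fun n => ?_⟩
  induction n with
  | zero => simpa using hr
  | succ n ih =>
    simp only [pow_succ']
    exact hG.hasFullRange_mul (by positivity) ih

/-- Write a vector orthogonal to the domain as x − y with (x, y) ∈ G. Then 0 = ⟨x, x − y⟩ ≥ ‖x‖² by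
dissipativity, so x = 0, and y = 0 because G is single-valued. -/
lemma dense_domain [CompleteSpace X] (hG : IsDissipative G) (hs : ∀ y, (0, y) ∈ G → y = 0)
    (hr : HasFullRange G 1) : Dense {x : X | ∃ y, (x, y) ∈ G} := by
  have e : {x : X | ∃ y, (x, y) ∈ G} = (G.map (LinearMap.fst ℝ X X) : Set X) := by
    ext x
    simp
  rw [e, Submodule.dense_iff_topologicalClosure_eq_top, Submodule.topologicalClosure_eq_top_iff,
    Submodule.eq_bot_iff]
  intro z hz
  obtain ⟨x, y, hxy, rfl⟩ := hr z
  have h0 : ⟪x, (1 : ℝ) • x - y⟫ = 0 :=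
    (Submodule.mem_orthogonal _ _).1 hz x ⟨(x, y), hxy, rfl⟩
  rw [one_smul, inner_sub_right, real_inner_self_eq_norm_sq, real_inner_comm] at h0
  have h1 := hG x y hxy
  have hx : x = 0 := by
    rw [← norm_eq_zero, ← sq_eq_zero_iff]
    exact le_antisymm (by linarith) (sq_nonneg _)
  subst hx
  simp [hs y hxy]

end IsDissipative

/-! ### Exponentials of the bounded operators c(J − 1), with estimates uniform in c. -/

section Yosida

variable [CompleteSpace X] {J K : X →L[ℝ] X} {c d t s : ℝ}

/-- The semigroup generated by the bounded operator `c (J - 1)`. -/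
def yosidaExp (J : X →L[ℝ] X) (c t : ℝ) : X →L[ℝ] X :=
  NormedSpace.exp (t • (c • (J - ContinuousLinearMap.id ℝ X)))

omit [CompleteSpace X] in
lemma yosidaExp_zero : yosidaExp J c 0 = ContinuousLinearMap.id ℝ X := by
  rw [yosidaExp, zero_smul, NormedSpace.exp_zero]
  rfl

lemma yosidaExp_add : yosidaExp J c (s + t) = (yosidaExp J c s).comp (yosidaExp J c t) := by
  let _ : NormedAlgebra ℚ (X →L[ℝ] X) := NormedAlgebra.restrictScalars ℚ ℝ _
  rw [yosidaExp, add_smul, NormedSpace.exp_add_of_commute]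
  · rfl
  · exact ((Commute.refl _).smul_left _).smul_right _

lemma hasDerivAt_yosidaExp_apply (x : X) :
    HasDerivAt (fun t => yosidaExp J c t x)
      (c • (J (yosidaExp J c t x) - yosidaExp J c t x)) t := by
  have h := hasDerivAt_exp_smul_const' (𝕂 := ℝ) (c • (J - ContinuousLinearMap.id ℝ X)) t
  exact (ContinuousLinearMap.apply ℝ X x).hasFDerivAt.comp_hasDerivAt t h

/-- Along the orbit u the derivative of ‖u‖² is 2c(⟨u, Ju⟩ − ‖u‖²), which is nonpositive because J
is a contraction. -/
lemma norm_yosidaExp_apply_le (hJ : ‖J‖ ≤ 1) (hc : 0 ≤ c) (ht : 0 ≤ t) (x : X) :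
    ‖yosidaExp J c t x‖ ≤ ‖x‖ := by
  have hd : ∀ t, HasDerivAt (fun t => ‖yosidaExp J c t x‖ ^ 2)
      (2 * ⟪yosidaExp J c t x, c • (J (yosidaExp J c t x) - yosidaExp J c t x)⟫) t := fun t =>
    (hasDerivAt_yosidaExp_apply x).norm_sq
  have hanti : Antitone (fun t => ‖yosidaExp J c t x‖ ^ 2) := by
    refine antitone_of_deriv_nonpos (fun t => (hd t).differentiableAt) fun t => ?_
    rw [(hd t).deriv, real_inner_smul_right, inner_sub_right, real_inner_self_eq_norm_sq]
    set u := yosidaExp J c t x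
    have h1 := real_inner_le_norm u (J u)
    have h2 := J.le_of_opNorm_le hJ u
    have h3 : ⟪u, J u⟫ ≤ ‖u‖ ^ 2 := by nlinarith [norm_nonneg u]
    have : c * (⟪u, J u⟫ - ‖u‖ ^ 2) ≤ 0 := mul_nonpos_of_nonneg_of_nonpos hc (by linarith)
    linarith
  have := hanti ht
  simp only [yosidaExp_zero, ContinuousLinearMap.id_apply] at this
  exact le_of_sq_le_sq this (norm_nonneg _)

omit [CompleteSpace X] in
lemma commute_yosidaExp (h : Commute J K) : Commute J (yosidaExp K c t) :=
  ((((h.sub_right (Commute.one_right _)).smul_right c).smul_right t)).exp_right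

omit [CompleteSpace X] in
lemma yosidaExp_apply_comm (h : Commute J K) (x : X) :
    J (yosidaExp K c t x) = yosidaExp K c t (J x) :=
  congrArg (fun f : X →L[ℝ] X => f x) (commute_yosidaExp h).eq

/-- Comparison of the semigroups generated by two commuting Yosida approximations. -/
lemma norm_yosidaExp_sub_le (hJ : ‖J‖ ≤ 1) (hK : ‖K‖ ≤ 1) (hJK : Commute J K) (hc : 0 ≤ c)
    (hd : 0 ≤ d) (ht : 0 ≤ t) (x : X) :
    ‖yosidaExp J c t x - yosidaExp K d t x‖ ≤ t * ‖c • (J x - x) - d • (K x - x)‖ := by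
  -- This curve joins the K-orbit at s = 0 to the J-orbit at s = t. Since everything commutes, its
  -- derivative is a product of contractions applied to the fixed vector c(Jx − x) − d(Kx − x).
  set G : ℝ → X := fun s => yosidaExp K d (t - s) (yosidaExp J c s x) with hG
  have hder : ∀ s, HasDerivAt G
      (yosidaExp K d (t - s) (yosidaExp J c s (c • (J x - x) - d • (K x - x)))) s := by
    intro s
    have h1 : HasDerivAt (fun s => yosidaExp K d s)
        (d • (K - ContinuousLinearMap.id ℝ X) * yosidaExp K d (t - s)) (t - s) :=
      hasDerivAt_exp_smul_const' (𝕂 := ℝ) (d • (K - ContinuousLinearMap.id ℝ X)) (t - s)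
    have h2 : HasDerivAt (fun s => yosidaExp K d (t - s))
        (-(d • (K - ContinuousLinearMap.id ℝ X) * yosidaExp K d (t - s))) s :=
      h1.comp_const_sub t s
    have h3 := h2.clm_apply (hasDerivAt_yosidaExp_apply (J := J) (c := c) (t := s) x)
    convert! h3 using 1
    rw [yosidaExp_apply_comm (Commute.refl J)]
    change _ = -(d • (K (yosidaExp K d (t - s) (yosidaExp J c s x))
      - yosidaExp K d (t - s) (yosidaExp J c s x))) + _
    rw [yosidaExp_apply_comm (Commute.refl K), yosidaExp_apply_comm hJK.symm]
    simp only [_root_.map_sub, _root_.map_smul]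
    abel
  have hb := norm_image_sub_le_of_norm_deriv_le_segment' (f := G) (a := 0) (b := t)
    (C := ‖c • (J x - x) - d • (K x - x)‖) (fun s _ => (hder s).hasDerivWithinAt)
    (fun s hs => (norm_yosidaExp_apply_le hK hd (by linarith [hs.2]) _).trans
      (norm_yosidaExp_apply_le hJ hc hs.1 _)) t ⟨ht, le_rfl⟩
  simp only [hG, sub_self, sub_zero, yosidaExp_zero, ContinuousLinearMap.id_apply] at hb
  linarith

lemma norm_yosidaExp_sub_self_le (hJ : ‖J‖ ≤ 1) (hc : 0 ≤ c) (ht : 0 ≤ t) (x : X) :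
    ‖yosidaExp J c t x - x‖ ≤ t * ‖c • (J x - x)‖ := by
  have hb := norm_image_sub_le_of_norm_deriv_le_segment' (f := fun t => yosidaExp J c t x)
    (a := 0) (b := t) (C := ‖c • (J x - x)‖)
    (fun s _ => (hasDerivAt_yosidaExp_apply x).hasDerivWithinAt) (fun s hs => ?_) t ⟨ht, le_rfl⟩
  · simp only [sub_zero, yosidaExp_zero, ContinuousLinearMap.id_apply] at hb
    linarith
  · rw [yosidaExp_apply_comm (Commute.refl J), ← _root_.map_sub, ← _root_.map_smul]
    exact norm_yosidaExp_apply_le hJ hc hs.1 _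

/-- The remainder has derivative e^{sc(J−1)}z − z with z = c(Jx − x), and c‖Jz − z‖ need not stay
bounded as c → ∞. Replacing z by a free vector y costs 2‖z − y‖; in the application y lies in the
domain, where c‖Jy − y‖ is bounded in c. -/
lemma norm_yosidaExp_sub_sub_le (hJ : ‖J‖ ≤ 1) (hc : 0 ≤ c) (ht : 0 ≤ t) (x y : X) :
    ‖yosidaExp J c t x - x - t • (c • (J x - x))‖ ≤
      t * (2 * ‖c • (J x - x) - y‖ + t * ‖c • (J y - y)‖) := by
  set z := c • (J x - x) with hz
  have hb := norm_image_sub_le_of_norm_deriv_le_segment' (f := fun t => yosidaExp J c t x - t • z)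
    (a := 0) (b := t) (C := 2 * ‖z - y‖ + t * ‖c • (J y - y)‖)
    (fun s _ => ((hasDerivAt_yosidaExp_apply x).sub
      ((hasDerivAt_id s).smul_const z)).hasDerivWithinAt) (fun s hs => ?_) t ⟨ht, le_rfl⟩
  · simp only [sub_zero, yosidaExp_zero, ContinuousLinearMap.id_apply, zero_smul] at hb
    rw [sub_right_comm]
    linarith
  · rw [yosidaExp_apply_comm (Commute.refl J), ← _root_.map_sub, ← _root_.map_smul, one_smul]
    have e : yosidaExp J c s z - z =
        yosidaExp J c s (z - y) + (yosidaExp J c s y - y) - (z - y) := by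
      rw [_root_.map_sub]; abel
    have h1 := norm_yosidaExp_apply_le hJ hc hs.1 (z - y)
    have h2 := norm_yosidaExp_sub_self_le hJ hc hs.1 y
    have h3 : s * ‖c • (J y - y)‖ ≤ t * ‖c • (J y - y)‖ := by gcongr; exact hs.2.le
    rw [← hz, e]
    refine (norm_sub_le _ _).trans ?_
    have := norm_add_le (yosidaExp J c s (z - y)) (yosidaExp J c s y - y)
    linarith

end Yosida

/-! ### Passage to the limit in the Yosida approximations. -/

lemma tendsto_zero_of_dense {ι : Type*} {l : Filter ι} {T : ι → X →L[ℝ] X} {C : ℝ} (hC : 0 < C)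
    (hT : ∀ i x, ‖T i x‖ ≤ C * ‖x‖) {D : Set X} (hD : Dense D)
    (h : ∀ x ∈ D, Tendsto (fun i => T i x) l (𝓝 0)) (x : X) :
    Tendsto (fun i => T i x) l (𝓝 0) := by
  rw [Metric.tendsto_nhds]
  intro ε hε
  obtain ⟨y, hy, hxy⟩ := hD.exists_dist_lt x (ε := ε / (2 * C)) (by positivity)
  filter_upwards [Metric.tendsto_nhds.1 (h y hy) (ε / 2) (by positivity)] with i hi
  rw [dist_zero_right] at hi ⊢
  have h1 := hT i (x - y)
  rw [dist_eq_norm] at hxy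
  have h2 : C * ‖x - y‖ < C * (ε / (2 * C)) := by gcongr
  have h3 : C * (ε / (2 * C)) = ε / 2 := by field_simp
  have h4 : T i x = T i (x - y) + T i y := by rw [_root_.map_sub]; abel
  rw [h4]
  exact (norm_add_le _ _).trans_lt (by linarith)

variable {G : Submodule ℝ (X × X)}

/-- From (Jx, c(Jx − x)) ∈ G one gets (KJx, Kc(Jx − x)) ∈ G. Applying J to the second entry gives
c(JKJx − JKx) by linearity and c(JKJx − KJx) by the resolvent property. -/
lemma resolvent_commute {J K : X →L[ℝ] X} {c d : ℝ} (hc : 0 < c)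
    (hJ : ∀ x, (J x, c • (J x - x)) ∈ G) (hJ' : ∀ x y, (x, y) ∈ G → J y = c • (J x - x))
    (hK : ∀ x, (K x, d • (K x - x)) ∈ G) (hK' : ∀ x y, (x, y) ∈ G → K y = d • (K x - x)) :
    Commute J K := by
  refine ContinuousLinearMap.ext fun x => ?_
  have h1 := hK' _ _ (hJ x)
  have hm := hK (J x)
  rw [← h1] at hm
  have h2 := hJ' _ _ hm
  rw [_root_.map_smul, _root_.map_smul, _root_.map_sub, _root_.map_sub] at h2
  have h3 := smul_right_injective X hc.ne' h2
  exact sub_right_injective h3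

namespace IsDissipative

/-- The **Lumer–Phillips theorem**, existence: a densely defined dissipative operator `G` such that
`1 - G` is onto is contained in the generator of a contraction semigroup. -/
theorem exists_contractionSemigroup [CompleteSpace X] (hG : IsDissipative G)
    (hs : ∀ y, (0, y) ∈ G → y = 0) (hr : HasFullRange G 1) :
    ∃ S : ContractionSemigroup X, G ≤ S.generatorGraph := by
  obtain ⟨c, hc, hct, hcr⟩ := hG.exists_forall_hasFullRange hr
  choose J hJ1 hJG hJ using fun n => hG.exists_resolvent (hc n) (hcr n)
  have hD := hG.dense_domain hs hr
  have hcomm : ∀ m n, Commute (J m) (J n) := fun m n =>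
    resolvent_commute (hc m) (hJG m) (hJ m) (hJG n) (hJ n)
  have hJle : ∀ n x, ‖J n x‖ ≤ ‖x‖ := fun n x => by
    simpa using (J n).le_of_opNorm_le (hJ1 n) x
  have hJlim : ∀ x, Tendsto (fun n => J n x - x) atTop (𝓝 0) := by
    refine tendsto_zero_of_dense (T := fun n => J n - ContinuousLinearMap.id ℝ X) two_pos
      (fun n x => ?_) hD ?_
    · have := hJle n x
      have := norm_sub_le (J n x) x
      change ‖J n x - x‖ ≤ _
      linarith
    · rintro x ⟨y, hxy⟩
      have hb : ∀ n, ‖J n x - x‖ ≤ (c n)⁻¹ * ‖y‖ := fun n => by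
        have := hJle n y
        rw [hJ n x y hxy, norm_smul, Real.norm_of_nonneg (hc n).le] at this
        rwa [← div_eq_inv_mul, le_div_iff₀' (hc n)]
      refine squeeze_zero_norm hb ?_
      simpa using hct.inv_tendsto_atTop.mul_const ‖y‖
  -- On the graph the Yosida approximation equals Jₙy, so this limit is the convergence of Jₙ to the
  -- identity.
  have hYlim : ∀ x y, (x, y) ∈ G → Tendsto (fun n => c n • (J n x - x)) atTop (𝓝 y) := by
    intro x y hxy
    simp only [← hJ _ x y hxy]
    simpa using (hJlim y).add_const y
  let E : ℕ → ℝ≥0 → X →L[ℝ] X := fun n t => yosidaExp (J n) (c n) t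
  have hE : ∀ n t x, ‖E n t x‖ ≤ ‖x‖ := fun n t x =>
    norm_yosidaExp_apply_le (hJ1 n) (hc n).le t.2 x
  have hcau : ∀ t x, CauchySeq fun n => E n t x := by
    intro t x
    rw [cauchySeq_iff_tendsto_dist_atTop_0]
    have := tendsto_zero_of_dense (l := (atTop : Filter (ℕ × ℕ)))
      (T := fun p => E p.1 t - E p.2 t) two_pos (fun p x => ?_) hD ?_ x
    · simpa [dist_eq_norm] using this.norm
    · have := hE p.1 t x
      have := hE p.2 t x
      change ‖E p.1 t x - E p.2 t x‖ ≤ _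
      exact (norm_sub_le _ _).trans (by linarith)
    · rintro x ⟨y, hxy⟩
      refine squeeze_zero_norm (fun p => norm_yosidaExp_sub_le (hJ1 p.1) (hJ1 p.2)
        (hcomm p.1 p.2) (hc p.1).le (hc p.2).le t.2 x) ?_
      rw [← prod_atTop_atTop_eq]
      have h1 := (hYlim x y hxy).comp (tendsto_fst (f := atTop (α := ℕ)) (g := atTop (α := ℕ)))
      have h2 := (hYlim x y hxy).comp (tendsto_snd (f := atTop (α := ℕ)) (g := atTop (α := ℕ)))
      simpa using (h1.sub h2).norm.const_mul (t : ℝ)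
  choose F hF using fun t x => cauchySeq_tendsto_of_complete (hcau t x)
  let S : ℝ≥0 → X →L[ℝ] X := fun t => continuousLinearMapOfTendsto (fun n => E n t)
    (tendsto_pi_nhds.2 (hF t))
  have hS : ∀ t x, Tendsto (fun n => E n t x) atTop (𝓝 (S t x)) := hF
  have hSle : ∀ t x, ‖S t x‖ ≤ ‖x‖ := fun t x =>
    le_of_tendsto (hS t x).norm (Eventually.of_forall fun n => hE n t x)
  have hadd : ∀ s t x, S (s + t) x = S s (S t x) := by
    intro s t x
    refine tendsto_nhds_unique (hS (s + t) x) ?_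
    have e : ∀ n, E n (s + t) x = E n s (E n t x - S t x) + E n s (S t x) := fun n => by
      rw [_root_.map_sub, sub_add_cancel]
      exact congrArg (fun f : X →L[ℝ] X => f x) (yosidaExp_add (s := s) (t := t))
    simp only [e]
    have h0 : Tendsto (fun n => E n s (E n t x - S t x)) atTop (𝓝 0) := by
      refine squeeze_zero_norm (fun n => hE n s _) ?_
      simpa using ((hS t x).sub_const (S t x)).norm
    simpa using h0.add (hS s (S t x))
  have hzero : S 0 = ContinuousLinearMap.id ℝ X := by
    ext x
    refine tendsto_nhds_unique (hS 0 x) ?_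
    have : ∀ n, E n 0 x = x := fun n => by
      simp only [E, NNReal.coe_zero, yosidaExp_zero, ContinuousLinearMap.id_apply]
    simp only [this]
    exact tendsto_const_nhds
  have hself : ∀ x y, (x, y) ∈ G → ∀ t, ‖S t x - x‖ ≤ t * ‖y‖ := by
    intro x y hxy t
    refine le_of_tendsto_of_tendsto' ((hS t x).sub_const x).norm
      ((hYlim x y hxy).norm.const_mul (t : ℝ)) fun n => ?_
    exact norm_yosidaExp_sub_self_le (hJ1 n) (hc n).le t.2 x
  have hlip : ∀ x y, (x, y) ∈ G → ∀ s t, ‖S t x - S s x‖ ≤ dist t s * ‖y‖ := by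
    intro x y hxy s t
    wlog hst : s ≤ t generalizing s t
    · rw [norm_sub_rev, dist_comm]
      exact this t s (le_of_not_ge hst)
    obtain ⟨r, rfl⟩ := exists_add_of_le hst
    rw [hadd, ← _root_.map_sub]
    refine (hSle _ _).trans ((hself x y hxy r).trans_eq ?_)
    rw [NNReal.dist_eq, NNReal.coe_add, add_sub_cancel_left, abs_of_nonneg r.coe_nonneg]
  have hcont : ∀ x, Continuous fun t => S t x := by
    intro x
    rw [continuous_iff_continuousAt]
    intro s
    have := tendsto_zero_of_dense (l := 𝓝 s) (T := fun t => S t - S s) two_pos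
      (fun t x => ?_) hD ?_ x
    · have h := this.add_const (S s x)
      simpa [ContinuousAt] using h
    · have := hSle t x
      have := hSle s x
      change ‖S t x - S s x‖ ≤ _
      exact (norm_sub_le _ _).trans (by linarith)
    · rintro x ⟨y, hxy⟩
      refine squeeze_zero_norm (fun t => hlip x y hxy s t) ?_
      have : Tendsto (fun t => dist t s) (𝓝 s) (𝓝 (dist s s)) :=
        (continuous_id.dist continuous_const).tendsto s
      rw [dist_self] at this
      simpa using this.mul_const ‖y‖
  refine ⟨⟨S, hzero, fun s t => ContinuousLinearMap.ext (hadd s t), hcont, fun t =>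
    ContinuousLinearMap.opNorm_le_bound _ zero_le_one fun x => by simpa using hSle t x⟩, ?_⟩
  rintro ⟨x, y⟩ hxy
  -- The uniform first-order estimate survives the limit n → ∞; the pair (u, v) is free because y
  -- itself need not lie in the domain.
  have hest : ∀ u v, (u, v) ∈ G → ∀ t : ℝ≥0,
      ‖S t x - x - (t : ℝ) • y‖ ≤ t * (2 * ‖y - u‖ + t * ‖v‖) := by
    intro u v huv t
    refine le_of_tendsto_of_tendsto'
      (((hS t x).sub_const x).sub ((hYlim x y hxy).const_smul (t : ℝ))).norm
      ((((hYlim x y hxy).sub_const u).norm.const_mul 2).add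
        ((hYlim u v huv).norm.const_mul (t : ℝ)) |>.const_mul (t : ℝ)) fun n => ?_
    exact norm_yosidaExp_sub_sub_le (hJ1 n) (hc n).le t.2 x u
  change Tendsto (fun t : ℝ≥0 => (t : ℝ)⁻¹ • (S t x - x)) (𝓝[>] 0) (𝓝 y)
  rw [Metric.tendsto_nhds]
  intro ε hε
  -- With u within ε/4 of y, the term 2‖y − u‖ is below ε/2; then t is taken so small that t‖v‖ <
  -- ε/2.
  obtain ⟨u, ⟨v, huv⟩, hu⟩ := hD.exists_dist_lt y (ε := ε / 4) (by positivity)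
  rw [dist_eq_norm] at hu
  have hsmall : ∀ᶠ t : ℝ≥0 in 𝓝[>] 0, (t : ℝ) * ‖v‖ < ε / 2 := by
    have : Tendsto (fun t : ℝ≥0 => (t : ℝ) * ‖v‖) (𝓝[>] 0) (𝓝 (((0 : ℝ≥0) : ℝ) * ‖v‖)) :=
      ((NNReal.continuous_coe.mul continuous_const).tendsto 0).mono_left nhdsWithin_le_nhds
    exact this.eventually_lt_const (by simpa using by positivity)
  filter_upwards [hsmall, self_mem_nhdsWithin] with t ht ht0
  have ht0' : (0 : ℝ) < t := ht0
  have e : (t : ℝ)⁻¹ • (S t x - x) - y = (t : ℝ)⁻¹ • (S t x - x - (t : ℝ) • y) := by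
    rw [smul_sub _ _ ((t : ℝ) • y), smul_smul, inv_mul_cancel₀ ht0'.ne', one_smul]
  rw [dist_eq_norm, e, norm_smul, norm_inv, Real.norm_of_nonneg ht0'.le, inv_mul_lt_iff₀ ht0']
  refine (hest u v huv t).trans_lt ?_
  gcongr
  linarith

end IsDissipative

/-! ### Orbits of a contraction semigroup, and uniqueness. -/

namespace ContractionSemigroup

lemma norm_apply_le (S : ContractionSemigroup X) (t : ℝ≥0) (x : X) : ‖S.S t x‖ ≤ ‖x‖ := by
  simpa using (S.S t).le_of_opNorm_le (S.contraction t) x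

/-- The difference quotients already satisfy the inequality, since ⟨S(t)x, x⟩ ≤ ‖x‖². -/
lemma isDissipative_generatorGraph (S : ContractionSemigroup X) :
    IsDissipative S.generatorGraph := by
  intro x y (h : Tendsto (fun t : ℝ≥0 => (t : ℝ)⁻¹ • (S.S t x - x)) (𝓝[>] 0) (𝓝 y))
  refine le_of_tendsto (h.inner (tendsto_const_nhds (x := x))) (Eventually.of_forall fun t => ?_)
  rw [real_inner_smul_left, inner_sub_left, real_inner_self_eq_norm_sq]
  have h1 := real_inner_le_norm (S.S t x) x
  have h2 := S.norm_apply_le t x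
  refine mul_nonpos_of_nonneg_of_nonpos (by positivity) ?_
  nlinarith [norm_nonneg x]

lemma apply_mem_generatorGraph (S : ContractionSemigroup X) {x y : X}
    (h : (x, y) ∈ S.generatorGraph) (t : ℝ≥0) : (S.S t x, S.S t y) ∈ S.generatorGraph := by
  refine (((S.S t).continuous.tendsto y).comp h).congr fun s => ?_
  have e : S.S t (S.S s x) = S.S s (S.S t x) := by
    change ((S.S t).comp (S.S s)) x = ((S.S s).comp (S.S t)) x
    rw [← S.map_add, ← S.map_add, add_comm]
  simp only [Function.comp_apply, _root_.map_smul, _root_.map_sub, e]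

/-- The semigroup law moves the derivative at 0 to time t. Only the right derivative is obtained,
which suffices for the comparison argument in `eq_of_generatorGraph_eq`. -/
lemma hasDerivWithinAt_orbit (S : ContractionSemigroup X) {x y : X}
    (h : (x, y) ∈ S.generatorGraph) {t : ℝ} (ht : 0 ≤ t) :
    HasDerivWithinAt (fun s : ℝ => S.S s.toNNReal x) (S.S t.toNNReal y) (Ici t) t := by
  rw [← hasDerivWithinAt_Ioi_iff_Ici, hasDerivWithinAt_iff_tendsto_slope' self_notMem_Ioi]
  have h1 : Tendsto (fun u : ℝ => (u - t).toNNReal) (𝓝[>] t) (𝓝[>] 0) := by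
    refine tendsto_nhdsWithin_iff.2 ⟨?_, ?_⟩
    · have : Continuous fun u : ℝ => (u - t).toNNReal := by fun_prop
      have h2 := this.tendsto t
      rw [sub_self, Real.toNNReal_zero] at h2
      exact h2.mono_left nhdsWithin_le_nhds
    · filter_upwards [self_mem_nhdsWithin] with u hu
      exact Real.toNNReal_pos.2 (sub_pos.2 hu)
  refine (Tendsto.comp (S.apply_mem_generatorGraph h t.toNNReal) h1).congr' ?_
  filter_upwards [self_mem_nhdsWithin] with u hu
  have hu' : t < u := hu
  have e : u.toNNReal = (u - t).toNNReal + t.toNNReal := by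
    rw [← Real.toNNReal_add (by linarith) ht, sub_add_cancel]
  simp only [Function.comp_apply, slope, vsub_eq_sub, e, S.map_add]
  rw [Real.coe_toNNReal _ (by linarith)]
  rfl

lemma continuous_orbit (S : ContractionSemigroup X) (x : X) :
    Continuous fun s : ℝ => S.S s.toNNReal x :=
  (S.strongly_continuous x).comp continuous_real_toNNReal

/-- A contraction semigroup is determined by its generator, if this is densely defined. -/
lemma eq_of_generatorGraph_eq {S R : ContractionSemigroup X}
    (h : S.generatorGraph = R.generatorGraph)
    (hD : Dense {x : X | ∃ y, (x, y) ∈ S.generatorGraph}) : S = R := by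
  have key : ∀ x y, (x, y) ∈ S.generatorGraph → ∀ t, S.S t x = R.S t x := by
    intro x y hxy t
    have hR : (x, y) ∈ R.generatorGraph := h ▸ hxy
    -- The squared distance of the two orbits starts at 0, and its right derivative is nonpositive
    -- because the common generator is dissipative.
    have hb := image_le_of_deriv_right_le_deriv_boundary (a := 0) (b := t)
      (f := fun s => ‖S.S s.toNNReal x - R.S s.toNNReal x‖ ^ 2)
      (f' := fun s => 2 * ⟪S.S s.toNNReal x - R.S s.toNNReal x,
        S.S s.toNNReal y - R.S s.toNNReal y⟫) (B := fun _ => 0) (B' := fun _ => 0)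
      (((S.continuous_orbit x).sub (R.continuous_orbit x)).norm.pow 2).continuousOn
      (fun s hs => ((S.hasDerivWithinAt_orbit hxy hs.1).sub
        (R.hasDerivWithinAt_orbit hR hs.1)).norm_sq)
      (by simp [S.map_zero, R.map_zero]) continuousOn_const
      (fun s _ => hasDerivWithinAt_const _ _ _) (fun s _ => ?_) ⟨t.coe_nonneg, le_rfl⟩
    · change ‖S.S (t : ℝ).toNNReal x - R.S (t : ℝ).toNNReal x‖ ^ 2 ≤ 0 at hb
      rw [Real.toNNReal_coe] at hb
      have := norm_eq_zero.1 (sq_eq_zero_iff.1 (le_antisymm hb (sq_nonneg _)))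
      exact sub_eq_zero.1 this
    · have h1 := S.apply_mem_generatorGraph hxy s.toNNReal
      have h2 := R.apply_mem_generatorGraph hR s.toNNReal
      rw [← h] at h2
      have := S.isDissipative_generatorGraph _ _ (S.generatorGraph.sub_mem h1 h2)
      rw [real_inner_comm] at this
      linarith
  ext t x
  exact congrFun ((S.S t).continuous.ext_on hD (R.S t).continuous
    fun x ⟨y, hxy⟩ => key x y hxy t) x

end ContractionSemigroup

/-- The **Lumer–Phillips theorem**: a dissipative operator `A` in a Hilbert space such that `1 - A`
is onto generates a unique contraction semigroup. -/
theorem existsUnique_contractionSemigroup [CompleteSpace X] (A : X →ₗ.[ℝ] X)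
    (hA : IsDissipative A.graph) (hr : HasFullRange A.graph 1) :
    ∃! S : ContractionSemigroup X, S.generator = A := by
  have hs : ∀ y, ((0 : X), y) ∈ A.graph → y = 0 := fun y hy =>
    A.graph_fst_eq_zero_snd hy rfl
  have hgr : ∀ S : ContractionSemigroup X, S.generator.graph = S.generatorGraph := fun S => by
    ext ⟨x, y⟩
    exact S.mem_generator_graph
  obtain ⟨S, hS⟩ := hA.exists_contractionSemigroup hs hr
  have hSA : S.generatorGraph = A.graph := by
    refine le_antisymm ?_ hS
    rintro ⟨x, y⟩ hxy
    -- Maximality: a pair of the generator and a pair of A with the same difference x − y coincide,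
    -- as both lie in the dissipative generator.
    obtain ⟨u, v, huv, he⟩ := hr ((1 : ℝ) • x - y)
    obtain ⟨rfl, rfl⟩ :=
      S.isDissipative_generatorGraph.eq_of_smul_sub_eq one_pos (hS huv) hxy he
    exact huv
  refine ⟨S, LinearPMap.eq_of_eq_graph (by rw [hgr, hSA]), fun R hR => ?_⟩
  have hRA : R.generatorGraph = A.graph := by rw [← hgr, hR]
  refine ContractionSemigroup.eq_of_generatorGraph_eq (by rw [hRA, hSA]) ?_
  rw [hRA]
  exact hA.dense_domain hs hr

end LumerPhillips

/-! ### Absolute continuity and weak derivatives for functions with values in a Banach space. -/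

section AbsolutelyContinuous

variable {E : Type*} [NormedAddCommGroup E] [NormedSpace ℝ E]

lemma _root_.AbsolutelyContinuousOnInterval.of_dist_le {Y Z : Type*} [PseudoMetricSpace Y]
    [PseudoMetricSpace Z] {f : ℝ → Y} {g : ℝ → Z} {a b : ℝ}
    (hg : AbsolutelyContinuousOnInterval g a b)
    (h : ∀ x ∈ uIcc a b, ∀ y ∈ uIcc a b, dist (f x) (f y) ≤ dist (g x) (g y)) :
    AbsolutelyContinuousOnInterval f a b := by
  rw [absolutelyContinuousOnInterval_iff] at hg ⊢
  intro ε hε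
  obtain ⟨δ, hδ, hh⟩ := hg ε hε
  exact ⟨δ, hδ, fun I hI hIδ => (Finset.sum_le_sum fun i hi =>
    h _ (hI.1 i hi).1 _ (hI.1 i hi).2).trans_lt (hh I hI hIδ)⟩

/-- The increments are dominated by those of the scalar primitive of ‖g‖. -/
lemma absolutelyContinuousOnInterval_primitive {g : ℝ → E} {a b : ℝ}
    (hg : IntervalIntegrable g volume a b) :
    AbsolutelyContinuousOnInterval (fun x => ∫ t in a..x, g t) a b := by
  refine AbsolutelyContinuousOnInterval.of_dist_le
    (hg.norm.absolutelyContinuousOnInterval_intervalIntegral left_mem_uIcc) fun x hx y hy => ?_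
  have hi : ∀ z ∈ uIcc a b, IntervalIntegrable g volume a z := fun z hz =>
    hg.mono_set (uIcc_subset_uIcc_left hz)
  rw [dist_eq_norm, Real.dist_eq, intervalIntegral.integral_interval_sub_left (hi x hx) (hi y hy),
    intervalIntegral.integral_interval_sub_left (hi x hx).norm (hi y hy).norm]
  exact intervalIntegral.norm_integral_le_abs_integral_norm

variable [CompleteSpace E]

/-- The fundamental theorem of calculus for absolutely continuous functions with values in a Banach
space. -/
lemma _root_.AbsolutelyContinuousOnInterval.sub_eq_integral {f g : ℝ → E} {a b : ℝ}
    (hf : AbsolutelyContinuousOnInterval f a b) (hg : IntervalIntegrable g volume a b)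
    (hd : ∀ᵐ x, x ∈ uIcc a b → HasDerivAt f (g x) x) {x : ℝ} (hx : x ∈ uIcc a b) :
    f x - f a = ∫ t in a..x, g t := by
  have h1 := hf.sub (absolutelyContinuousOnInterval_primitive hg)
  obtain ⟨C, hC⟩ := h1.const_of_ae_hasDerivAt_zero (by
    filter_upwards [hd, hg.ae_hasDerivAt_integral] with x h1 h2 hx
    simpa using (h1 hx).sub (h2 hx a left_mem_uIcc))
  have e1 := hC a left_mem_uIcc
  have e2 := hC x hx
  simp only [Pi.sub_apply, intervalIntegral.integral_same, sub_zero] at e1 e2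
  rw [← e1] at e2
  rw [← e2]
  abel

/-- An absolutely continuous function with an integrable derivative has it as weak derivative. -/
lemma isWeakDeriv_of_absolutelyContinuous {f g : ℝ → E} {S : ℝ} (hS : 0 ≤ S)
    (hf : AbsolutelyContinuousOnInterval f 0 S) (hg : IntervalIntegrable g volume 0 S)
    (hd : ∀ᵐ x, x ∈ uIcc 0 S → HasDerivAt f (g x) x) : IsWeakDeriv (Ioo 0 S) f g := by
  intro φ hφ
  have hv : ∀ x, x ∉ Ioo 0 S → φ x = 0 := fun x hx => by
    by_contra h0
    exact hx (hφ.subset (subset_tsupport _ h0))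
  have hdφ := hφ.smooth.differentiable (by simp)
  have hφac : AbsolutelyContinuousOnInterval φ 0 S :=
    (hφ.smooth.of_le (by simp)).contDiffOn.absolutelyContinuousOnInterval
  have i1 : IntervalIntegrable (fun t => φ t • g t) volume 0 S :=
    hg.continuousOn_smul hφ.smooth.continuous.continuousOn
  have i2 : IntervalIntegrable (fun t => deriv φ t • f t) volume 0 S :=
    (hφ.deriv.smooth.continuous.continuousOn.smul hf.continuousOn).intervalIntegrable
  -- The product of φ and f is absolutely continuous and vanishes at both ends, so its derivative
  -- integrates to zero.
  have h1 := AbsolutelyContinuousOnInterval.sub_eq_integral (hφac.smul hf) (i1.add i2) (by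
    filter_upwards [hd] with x h hx
    exact ((hdφ x).hasDerivAt.smul (h hx))) right_mem_uIcc
  simp only [Pi.smul_apply', hv 0 (by simp), hv S (by simp), zero_smul, sub_self] at h1
  rw [intervalIntegral.integral_add i1 i2, intervalIntegral.integral_of_le hS,
    intervalIntegral.integral_of_le hS, integral_Ioc_eq_integral_Ioo,
    integral_Ioc_eq_integral_Ioo] at h1
  exact eq_neg_of_add_eq_zero_right h1.symm

/-- Fix a test function w of integral one. For any test function g, the function g − (∫g)w has zero
mean and is therefore the derivative of a test function. Hence ∫ g u = (∫g)c with c = ∫ w u, so u −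
c is annihilated by all test functions. -/
lemma ae_eq_const_of_isWeakDeriv_zero {S : ℝ} (hS : 0 < S) {u : ℝ → E}
    (hu : IntegrableOn u (Ioo 0 S)) (h : IsWeakDeriv (Ioo 0 S) u 0) :
    ∃ c : E, ∀ᵐ x ∂(volume.restrict (Ioo 0 S)), u x = c := by
  obtain ⟨w, hw, hw1⟩ := exists_test_integral_one hS
  set c := ∫ x in Ioo 0 S, w x • u x with hc
  refine ⟨c, ?_⟩
  have hul : LocallyIntegrableOn u (Ioo 0 S) := hu.locallyIntegrableOn
  have ig : ∀ {g : ℝ → ℝ}, IsTest (Ioo 0 S) g → IntegrableOn g (Ioo 0 S) := fun hg =>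
    (hg.smooth.continuous.integrable_of_hasCompactSupport hg.compact).integrableOn
  have key : ∀ᵐ x, x ∈ Ioo 0 S → (u x - c) = 0 := by
    refine isOpen_Ioo.ae_eq_zero_of_integral_contDiff_smul_eq_zero
      (hu.sub (integrable_const c)).locallyIntegrableOn ?_
    intro g h1 h2 h3
    have hgt : IsTest (Ioo 0 S) g := ⟨h1, h2, h3⟩
    set m := ∫ x in Ioo 0 S, g x with hm
    have ht := hgt.lin hw m
    obtain ⟨φ, hφ, hd⟩ := ht.primitive (by
      rw [integral_sub (ig hgt) ((ig hw).const_mul m), integral_const_mul, hw1, mul_one, sub_self])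
    have e := h φ hφ
    simp only [Pi.zero_apply, smul_zero, integral_zero, neg_zero, hd] at e
    simp only [sub_smul, mul_smul] at e
    have i2 : IntegrableOn (fun x => m • w x • u x) (Ioo 0 S) :=
      (hw.integrableOn_smul hul).smul m
    rw [integral_sub (hgt.integrableOn_smul hul) i2, integral_smul, ← hc] at e
    rw [← setIntegral_eq_integral_of_forall_compl_eq_zero (s := Ioo 0 S)]
    · simp only [smul_sub]
      rw [integral_sub (hgt.integrableOn_smul hul) ((ig hgt).smul_const c),
        integral_smul_const, ← hm, e]
    · intro x hx
      have : g x = 0 := by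
        by_contra hh
        exact hx (h3 (subset_tsupport _ hh))
      simp [this]
  rw [← ae_restrict_iff' measurableSet_Ioo] at key
  filter_upwards [key] with x hx using sub_eq_zero.1 hx

/-- A function with an integrable weak derivative is a primitive of it, up to a constant. -/
lemma IsWeakDeriv.exists_ae_eq_add_primitive {S : ℝ} (hS : 0 < S) {u g : ℝ → E}
    (hu : IntegrableOn u (Ioo 0 S)) (hg : IntegrableOn g (Ioo 0 S))
    (h : IsWeakDeriv (Ioo 0 S) u g) :
    ∃ c : E, ∀ᵐ x ∂(volume.restrict (Ioo 0 S)), u x = c + ∫ t in (0 : ℝ)..x, g t := by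
  have hgi : IntervalIntegrable g volume 0 S := (intervalIntegrable_iff_integrableOn_Ioo_of_le hS.le).2 hg
  have hac := absolutelyContinuousOnInterval_primitive hgi
  have hw := isWeakDeriv_of_absolutelyContinuous hS.le hac hgi (by
    filter_upwards [hgi.ae_hasDerivAt_integral] with x h hx using h hx 0 left_mem_uIcc)
  set v : ℝ → E := fun x => ∫ t in (0 : ℝ)..x, g t with hv
  have hvi : IntegrableOn v (Ioo 0 S) :=
    (intervalIntegrable_iff_integrableOn_Ioo_of_le hS.le).1 hac.continuousOn.intervalIntegrable
  obtain ⟨c, hc⟩ := ae_eq_const_of_isWeakDeriv_zero hS (hu.sub hvi) (fun φ hφ => by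
    simp only [Pi.zero_apply, smul_zero, integral_zero, neg_zero, Pi.sub_apply, smul_sub]
    rw [integral_sub (hφ.deriv.integrableOn_smul hu.locallyIntegrableOn)
      (hφ.deriv.integrableOn_smul hvi.locallyIntegrableOn), h φ hφ, hw φ hφ, sub_self])
  refine ⟨c, ?_⟩
  filter_upwards [hc] with x hx
  rw [← hx, Pi.sub_apply, sub_add_cancel]

end AbsolutelyContinuous

/-! ### The weighted energy inequality. -/

section Energy

variable {E : Type*} [NormedAddCommGroup E] [InnerProductSpace ℝ E] [CompleteSpace E]

/-- For a nonincreasing weight `m ≥ 0`, the weighted energy production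
`∫ m ⟨w', w⟩` of a function with `w(0) = 0` is nonnegative. -/
lemma integral_mul_inner_primitive_nonneg {m : ℝ → ℝ} {S : ℝ} (hS : 0 ≤ S)
    (hm : AbsolutelyContinuousOnInterval m 0 S) (hanti : AntitoneOn m (Icc 0 S)) (hmS : 0 ≤ m S)
    {g : ℝ → E} (hg : IntervalIntegrable g volume 0 S) :
    0 ≤ ∫ s in (0 : ℝ)..S, m s * ⟪g s, ∫ t in (0 : ℝ)..s, g t⟫ := by
  set w : ℝ → E := fun s => ∫ t in (0 : ℝ)..s, g t with hw
  have hwac : AbsolutelyContinuousOnInterval w 0 S := absolutelyContinuousOnInterval_primitive hg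
  have hnac : AbsolutelyContinuousOnInterval (fun s => ‖w s‖) 0 S :=
    AbsolutelyContinuousOnInterval.of_dist_le hwac fun x _ y _ => by
      rw [Real.dist_eq, dist_eq_norm]
      exact abs_norm_sub_norm_le _ _
  have hsac : AbsolutelyContinuousOnInterval (fun s => ‖w s‖ ^ 2) 0 S := by
    simpa only [pow_two] using hnac.fun_mul hnac
  have hd := hg.ae_hasDerivAt_integral
  -- Twice the integral in question is ∫ m (‖w‖²)'. By parts it equals m(S)‖w(S)‖² − ∫ m'‖w‖², and
  -- both contributions are nonnegative.
  have hibp := hm.integral_mul_deriv_eq_deriv_mul hsac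
  have e0 : w 0 = 0 := by simp [hw]
  have e1 : ∫ s in (0 : ℝ)..S, m s * deriv (fun s => ‖w s‖ ^ 2) s =
      2 * ∫ s in (0 : ℝ)..S, m s * ⟪g s, w s⟫ := by
    rw [← intervalIntegral.integral_const_mul]
    refine intervalIntegral.integral_congr_ae ?_
    filter_upwards [hd] with s h hs
    rw [(h (uIoc_subset_uIcc hs) 0 left_mem_uIcc).norm_sq.deriv, real_inner_comm]
    ring
  have e2 : ∫ s in (0 : ℝ)..S, deriv m s * ‖w s‖ ^ 2 ≤ 0 := by
    rw [intervalIntegral.integral_of_le hS, integral_Ioc_eq_integral_Ioo]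
    refine setIntegral_nonpos measurableSet_Ioo fun s hs => ?_
    refine mul_nonpos_of_nonpos_of_nonneg ?_ (sq_nonneg _)
    rw [← derivWithin_of_mem_nhds (Icc_mem_nhds hs.1 hs.2)]
    exact hanti.derivWithin_nonpos
  have e3 : 0 ≤ m S * ‖w S‖ ^ 2 := by positivity
  rw [e1, e0, norm_zero, zero_pow two_ne_zero, mul_zero, sub_zero] at hibp
  linarith

end Energy

/-! ### The positivity set of μ and integration against μ(s) ds. -/

namespace MemoryKernel

variable (k : MemoryKernel)

lemma mem_supp_of_le {s t : ℝ} (hs : s ∈ k.supp) (ht : 0 < t) (hts : t ≤ s) : t ∈ k.supp :=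
  ⟨ht, hs.2.trans_le (k.μ_antitoneOn ht.le hs.1.le hts)⟩

lemma Ioc_subset_supp {s : ℝ} (hs : s ∈ k.supp) : Ioc 0 s ⊆ k.supp := fun _ ht =>
  k.mem_supp_of_le hs ht.1 ht.2

lemma Ioo_subset_supp {s : ℝ} (hs : s ∈ k.supp) : Ioo 0 s ⊆ k.supp :=
  Ioo_subset_Ioc_self.trans (k.Ioc_subset_supp hs)

lemma nonempty_supp : k.supp.Nonempty := by
  have h0 := k.μ_continuousOn 0 self_mem_Ici
  have h1 : ∀ᶠ s in 𝓝[>] 0, 0 < k.μ s :=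
    (h0.mono Ioi_subset_Ici_self).eventually_const_lt k.μ_zero_pos
  obtain ⟨s, hs, hs'⟩ := (h1.and self_mem_nhdsWithin).exists
  exact ⟨s, hs', hs⟩

lemma exists_gt_mem_supp {s : ℝ} (hs : s ∈ k.supp) : ∃ t ∈ k.supp, s < t := by
  have h1 : ∀ᶠ t in 𝓝[>] s, t ∈ k.supp :=
    mem_nhdsWithin_of_mem_nhds (k.isOpen_supp.mem_nhds hs)
  obtain ⟨t, ht, ht'⟩ := (h1.and self_mem_nhdsWithin).exists
  exact ⟨t, ht, ht'⟩

/-- An exhaustion of the support of the kernel by intervals `(0, S n)`. -/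
lemma exists_aecover : ∃ S : ℕ → ℝ, (∀ n, S n ∈ k.supp) ∧
    AECover k.measure atTop fun n => Ioo 0 (S n) := by
  -- The endpoints are the running maxima of an enumeration of the rational points of `supp`. They
  -- exhaust it whether its right end is finite or infinite.
  have hne : (k.supp ∩ range ((↑) : ℚ → ℝ)).Nonempty := by
    obtain ⟨x, hx, q, hq⟩ :=
      Rat.denseRange_cast (𝕜 := ℝ) |>.inter_open_nonempty _ k.isOpen_supp k.nonempty_supp
    exact ⟨x, hx, q, hq⟩
  obtain ⟨e, he⟩ := ((countable_range ((↑) : ℚ → ℝ)).mono inter_subset_right).exists_eq_range hne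
  have hem : ∀ n, e n ∈ k.supp := fun n => (he ▸ mem_range_self n : e n ∈ k.supp ∩ _).1
  refine ⟨fun n => partialSups e n, fun n => ?_, ⟨?_, fun n => measurableSet_Ioo⟩⟩
  · induction n with
    | zero => simpa using hem 0
    | succ n ih =>
      simp only [partialSups_add_one]
      rcases max_choice (partialSups e n) (e (n + 1)) with h | h
      · rw [h]; exact ih
      · rw [h]; exact hem _
  · have hsupp : ∀ᵐ s ∂k.measure, s ∈ k.supp :=
      k.ac_restrict (ae_restrict_mem k.isOpen_supp.measurableSet)
    filter_upwards [hsupp] with s hs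
    obtain ⟨t, ht, hst⟩ := k.exists_gt_mem_supp hs
    obtain ⟨q, hq1, hq2⟩ := exists_rat_btwn hst
    have hq : (q : ℝ) ∈ k.supp ∩ range ((↑) : ℚ → ℝ) :=
      ⟨k.mem_supp_of_le ht (hs.1.trans hq1) hq2.le, q, rfl⟩
    rw [he] at hq
    obtain ⟨n, hn⟩ := hq
    filter_upwards [eventually_ge_atTop n] with m hm
    exact ⟨hs.1, (hq1.trans_le hn.ge).trans_le (le_partialSups_of_le e hm)⟩

/-- On [0, s] the weight is continuous and at least μ(s) > 0, so it can be divided out. This gives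
Lebesgue integrability up to the endpoint 0, hence primitives that start at 0. -/
lemma integrableOn_of_integrable {E : Type*} [NormedAddCommGroup E] [NormedSpace ℝ E] {f : ℝ → E}
    (hf : Integrable f k.measure) {s : ℝ} (hs : s ∈ k.supp) : IntervalIntegrable f volume 0 s := by
  rw [intervalIntegrable_iff_integrableOn_Ioc_of_le hs.1.le]
  have h1 := (integrable_withDensity_iff_integrable_smul₀' (μ := volume.restrict (Ioi 0))
    k.aemeasurable_μ.ennreal_ofReal (by simp)).1 hf
  have h2 : IntegrableOn (fun s => k.μ s • f s) (Ioc 0 s) := by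
    have h3 : IntegrableOn (fun s => (ENNReal.ofReal (k.μ s)).toReal • f s) (Ioc 0 s) :=
      IntegrableOn.mono_set (t := Ioi 0) h1 Ioc_subset_Ioi_self
    refine h3.congr_fun (fun t ht => ?_) measurableSet_Ioc
    simp only [ENNReal.toReal_ofReal (k.μ_nonneg t ht.1.le)]
  rw [← integrableOn_Icc_iff_integrableOn_Ioc] at h2 ⊢
  have hpos : ∀ t ∈ Icc 0 s, 0 < k.μ t := fun t ht =>
    hs.2.trans_le (k.μ_antitoneOn ht.1 hs.1.le ht.2)
  have hc : ContinuousOn (fun s => (k.μ s)⁻¹) (Icc 0 s) :=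
    (k.μ_continuousOn.mono Icc_subset_Ici_self).inv₀ fun t ht => (hpos t ht).ne'
  refine (h2.continuousOn_smul hc isCompact_Icc).congr_fun (fun t ht => ?_) measurableSet_Icc
  simp only [smul_smul, inv_mul_cancel₀ (hpos t ht).ne', one_smul]

lemma setIntegral_Ioo (f : ℝ → ℝ) {s : ℝ} (hs : 0 ≤ s) :
    ∫ t in Ioo 0 s, f t ∂k.measure = ∫ t in (0 : ℝ)..s, k.μ t * f t := by
  rw [measure, setIntegral_withDensity_eq_setIntegral_toReal_smul₀' _
    (k.aemeasurable_μ.ennreal_ofReal.restrict) (by simp),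
    Measure.restrict_restrict measurableSet_Ioo, inter_eq_left.2 Ioo_subset_Ioi_self,
    intervalIntegral.integral_of_le hs, integral_Ioc_eq_integral_Ioo]
  refine setIntegral_congr_fun measurableSet_Ioo fun t ht => ?_
  simp only [ENNReal.toReal_ofReal (k.μ_nonneg t ht.1.le), smul_eq_mul]

lemma measure_ne_zero : k.measure ≠ 0 := by
  intro h
  obtain ⟨s, hs⟩ := k.nonempty_supp
  have h1 := (k.measure_null_iff univ).1 (by rw [h]; rfl)
  rw [Measure.restrict_apply_univ] at h1
  exact (k.isOpen_supp.measure_pos volume ⟨s, hs⟩).ne' h1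

lemma energy_nonneg {E : Type*} [NormedAddCommGroup E] [InnerProductSpace ℝ E] [CompleteSpace E]
    {g : ℝ → E} {s : ℝ} (hs : s ∈ k.supp) (hg : IntervalIntegrable g volume 0 s) :
    0 ≤ ∫ t in Ioo 0 s, ⟪g t, ∫ r in (0 : ℝ)..t, g r⟫ ∂k.measure := by
  rw [k.setIntegral_Ioo _ hs.1.le]
  exact integral_mul_inner_primitive_nonneg hs.1.le (k.μ_absolutelyContinuous s hs.1)
    (k.μ_antitoneOn.mono Icc_subset_Ici_self) hs.2.le hg

/-- A compact subset of the support is contained in an interval `(0, s)` with `s` in the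
support. -/
lemma exists_subset_Ioo {K : Set ℝ} (hK : IsCompact K) (h : K ⊆ k.supp) :
    ∃ s ∈ k.supp, K ⊆ Ioo 0 s := by
  rcases K.eq_empty_or_nonempty with rfl | hne
  · obtain ⟨s, hs⟩ := k.nonempty_supp
    exact ⟨s, hs, empty_subset _⟩
  obtain ⟨m, hm, hm'⟩ := hK.exists_isGreatest hne
  obtain ⟨s, hs, hms⟩ := k.exists_gt_mem_supp (h hm)
  exact ⟨s, hs, fun t ht => ⟨(h ht).1, (hm' ht).trans_lt hms⟩⟩

end MemoryKernel

lemma IsTest.mono {U V : Set ℝ} {φ : ℝ → ℝ} (h : IsTest U φ) (hUV : U ⊆ V) : IsTest V φ :=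
  ⟨h.smooth, h.compact, h.subset.trans hUV⟩

lemma IsTest.setIntegral_smul_eq {E : Type*} [NormedAddCommGroup E] [NormedSpace ℝ E]
    {U V : Set ℝ} {φ : ℝ → ℝ} (h : IsTest U φ) (hUV : U ⊆ V) (hV : MeasurableSet V) (f : ℝ → E) :
    ∫ x in V, φ x • f x = ∫ x in U, φ x • f x := by
  refine (setIntegral_eq_of_subset_of_forall_sdiff_eq_zero hV hUV fun x hx => ?_)
  have : φ x = 0 := by
    by_contra h0
    exact hx.2 (h.subset (subset_tsupport _ h0))
  rw [this, zero_smul]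

lemma IsWeakDeriv.mono {E : Type*} [NormedAddCommGroup E] [NormedSpace ℝ E]
    {U V : Set ℝ} {u v : ℝ → E} (h : IsWeakDeriv V u v) (hUV : U ⊆ V) (hV : MeasurableSet V) :
    IsWeakDeriv U u v := fun φ hφ => by
  rw [← hφ.setIntegral_smul_eq hUV hV, ← hφ.deriv.setIntegral_smul_eq hUV hV]
  exact h φ (hφ.mono hUV)

/-! ### The operator T: boundary value at s = 0 and dissipativity. -/

namespace Memory

variable {k : MemoryKernel} {ℓ : ℝ}

lemma intervalIntegrable (η : Memory k ℓ) {s : ℝ} (hs : s ∈ k.supp) :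
    IntervalIntegrable η volume 0 s :=
  k.integrableOn_of_integrable η.integrable hs

lemma ae_restrict_Ioo {p : ℝ → Prop} (h : ∀ᵐ t ∂k.measure, p t) {s : ℝ} (hs : s ∈ k.supp) :
    ∀ᵐ t ∂(volume.restrict (Ioo 0 s)), p t :=
  ae_restrict_of_ae_restrict_of_subset (k.Ioo_subset_supp hs) (k.restrict_ac h)

/-- Elements of the domain of `T` are primitives of their weak derivatives. -/
lemma ae_eq_primitive {η ζ : Memory k ℓ} (h : IsWeakDeriv k.supp η ζ) (hη : η ∈ domT k ℓ) {s : ℝ}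
    (hs : s ∈ k.supp) :
    ∀ᵐ t ∂(volume.restrict (Ioo 0 s)), η t = ∫ r in (0 : ℝ)..t, ζ r := by
  obtain ⟨-, w, hw, hw0⟩ := hη
  have hζ := intervalIntegrable ζ hs
  obtain ⟨c, hc⟩ := (h.mono (k.Ioo_subset_supp hs)
    k.isOpen_supp.measurableSet).exists_ae_eq_add_primitive hs.1
    ((intervalIntegrable_iff_integrableOn_Ioo_of_le hs.1.le).1 (intervalIntegrable η hs))
    ((intervalIntegrable_iff_integrableOn_Ioo_of_le hs.1.le).1 hζ)
  -- A weak derivative determines η up to a constant; the constant vanishes because both η and the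
  -- primitive tend to 0 as s → 0.
  suffices hc0 : c = 0 by simpa only [hc0, zero_add] using hc
  have hcont := (absolutelyContinuousOnInterval_primitive hζ).continuousOn
  have hlim : Tendsto (fun t => ∫ r in (0 : ℝ)..t, ζ r) (𝓝[>] 0) (𝓝 0) := by
    have h1 := hcont 0 left_mem_uIcc
    rw [uIcc_of_le hs.1.le, ContinuousWithinAt, intervalIntegral.integral_same] at h1
    exact h1.mono_left (nhdsWithin_le_of_mem (Icc_mem_nhdsGT hs.1))
  have hlim' : Tendsto (fun t => w t - ∫ r in (0 : ℝ)..t, ζ r) (𝓝[>] 0) (𝓝 0) := by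
    simpa using (tendsto_zero_iff_norm_tendsto_zero.2 hw0).sub hlim
  by_contra hne
  have hev : ∀ᶠ t in 𝓝[>] (0 : ℝ), w t - ∫ r in (0 : ℝ)..t, ζ r ≠ c :=
    hlim'.eventually_ne (Ne.symm hne)
  obtain ⟨δ, hδ, hδ'⟩ := mem_nhdsGT_iff_exists_Ioo_subset.1 hev
  have hsub : Ioo 0 (min δ s) ⊆ Ioo 0 s := Ioo_subset_Ioo_right (min_le_right _ _)
  -- The identities hold only almost everywhere, so the contradiction is taken at a point of a short
  -- interval of positive measure.
  have : (ae (volume.restrict (Ioo 0 (min δ s)))).NeBot := by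
    rw [ae_restrict_neBot, Real.volume_Ioo, sub_zero, Ne, ENNReal.ofReal_eq_zero, not_le]
    exact lt_min hδ hs.1
  obtain ⟨t, ht1, ht2, ht3⟩ := ((ae_restrict_of_ae_restrict_of_subset hsub hc).and
    ((ae_restrict_of_ae_restrict_of_subset hsub (ae_restrict_Ioo hw hs)).and
      (ae_restrict_mem measurableSet_Ioo))).exists
  refine hδ' ⟨ht3.1, ht3.2.trans_le (min_le_left _ _)⟩ ?_
  rw [ht2, ht1, add_sub_cancel_right]

/-- On each interval of the exhaustion η is the primitive of ζ from 0, so `energy_nonneg` applies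
there; the truncated integrals converge to the inner product. -/
lemma inner_nonneg_of_isWeakDeriv {η ζ : Memory k ℓ} (h : IsWeakDeriv k.supp η ζ)
    (hη : η ∈ domT k ℓ) : 0 ≤ ⟪ζ, η⟫ := by
  obtain ⟨S, hS, hcov⟩ := k.exists_aecover
  rw [L2.inner_def]
  refine ge_of_tendsto' (hcov.integral_tendsto_of_countably_generated
    (L2.integrable_inner (𝕜 := ℝ) ζ η)) fun n => ?_
  refine (k.energy_nonneg (hS n) (intervalIntegrable ζ (hS n))).trans_eq ?_
  rw [k.setIntegral_Ioo _ (hS n).1.le, k.setIntegral_Ioo _ (hS n).1.le,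
    intervalIntegral.integral_of_le (hS n).1.le, intervalIntegral.integral_of_le (hS n).1.le,
    integral_Ioc_eq_integral_Ioo, integral_Ioc_eq_integral_Ioo]
  refine integral_congr_ae ?_
  filter_upwards [ae_eq_primitive h hη (hS n)] with t ht
  rw [ht]

lemma T_apply {η ζ : Memory k ℓ} (hη : η ∈ domT k ℓ) (h : IsWeakDeriv k.supp η ζ) :
    T k ℓ ⟨η, hη⟩ = -ζ := by
  have h1 := (graph_D k ℓ).2 h
  rw [LinearPMap.mem_graph_iff] at h1
  obtain ⟨y, hy, rfl⟩ := h1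
  change -(D k ℓ ⟨η, hη.1⟩) = _
  congr 2
  exact Subtype.ext hy.symm

lemma inner_T_nonpos {η : Memory k ℓ} (hη : η ∈ domT k ℓ) : ⟪T k ℓ ⟨η, hη⟩, η⟫ ≤ 0 := by
  have h1 : IsWeakDeriv k.supp η (D k ℓ ⟨η, hη.1⟩) :=
    (graph_D k ℓ).1 (LinearPMap.mem_graph _ ⟨η, hη.1⟩)
  rw [T_apply hη h1, inner_neg_left, neg_nonpos]
  exact inner_nonneg_of_isWeakDeriv h1 hη

/-- Locally absolutely continuous functions that vanish at `0` and are in the memory space together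
with their derivative belong to the domain of `T`. -/
lemma mem_domT_of_absolutelyContinuous {f g : ℝ → H10Space ℓ} {η ζ : Memory k ℓ}
    (hf : ∀ s ∈ k.supp, AbsolutelyContinuousOnInterval f 0 s)
    (hg : ∀ s ∈ k.supp, IntervalIntegrable g volume 0 s)
    (hd : ∀ s ∈ k.supp, ∀ᵐ t, t ∈ uIcc 0 s → HasDerivAt f (g t) t) (h0 : f 0 = 0)
    (hη : η =ᵐ[k.measure] f) (hζ : ζ =ᵐ[k.measure] g) :
    ∃ h : η ∈ domT k ℓ, T k ℓ ⟨η, h⟩ = -ζ := by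
  have hw : IsWeakDeriv k.supp η ζ := by
    intro φ hφ
    -- Only local integrability inside `supp` is available, so one works on an interval (0, s) that
    -- contains the support of the test function.
    obtain ⟨s, hs, hφs⟩ := k.exists_subset_Ioo hφ.compact hφ.subset
    have hφ' : IsTest (Ioo 0 s) φ := ⟨hφ.smooth, hφ.compact, hφs⟩
    rw [hφ'.setIntegral_smul_eq (k.Ioo_subset_supp hs) k.isOpen_supp.measurableSet,
      hφ'.deriv.setIntegral_smul_eq (k.Ioo_subset_supp hs) k.isOpen_supp.measurableSet]
    have := isWeakDeriv_of_absolutelyContinuous hs.1.le (hf s hs) (hg s hs) (hd s hs) φ hφ'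
    convert! this using 1
    · refine integral_congr_ae ?_
      filter_upwards [ae_restrict_Ioo hη hs] with t ht
      rw [ht]
    · congr 1
      refine integral_congr_ae ?_
      filter_upwards [ae_restrict_Ioo hζ hs] with t ht
      rw [ht]
  have hmem : η ∈ domT k ℓ := by
    refine ⟨?_, f, hη.symm, ?_⟩
    · exact LinearPMap.mem_domain_of_mem_graph ((graph_D k ℓ).2 hw)
    · obtain ⟨s, hs⟩ := k.nonempty_supp
      have h1 := (hf s hs).continuousOn 0 left_mem_uIcc
      rw [uIcc_of_le hs.1.le, ContinuousWithinAt, h0] at h1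
      simpa using (h1.mono_left (nhdsWithin_le_of_mem (Icc_mem_nhdsGT hs.1))).norm
  exact ⟨hmem, T_apply hmem hw⟩

end Memory

/-! ### Inversion of 1 − T. -/

namespace Memory

variable {k : MemoryKernel} {ℓ : ℝ}

lemma hasDerivAt_exp_neg (t : ℝ) : HasDerivAt (fun t => Real.exp (-t)) (-Real.exp (-t)) t := by
  simpa using (hasDerivAt_neg t).exp

lemma absolutelyContinuousOnInterval_exp_neg (a b : ℝ) :
    AbsolutelyContinuousOnInterval (fun t => Real.exp (-t)) a b :=
  ((Real.contDiff_exp.comp contDiff_neg).contDiffOn).absolutelyContinuousOnInterval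

/-- The solution `e^{-s} ∫₀^s e^r ξ(r) dr` of `η + η' = ξ`, `η(0) = 0`. -/
def resolventFun (ξ : Memory k ℓ) (s : ℝ) : H10Space ℓ :=
  Real.exp (-s) • ∫ r in (0 : ℝ)..s, Real.exp r • ξ r

lemma resolventFun_zero (ξ : Memory k ℓ) : resolventFun ξ 0 = 0 := by
  simp [resolventFun]

lemma intervalIntegrable_exp_smul (ξ : Memory k ℓ) {s : ℝ} (hs : s ∈ k.supp) :
    IntervalIntegrable (fun r => Real.exp r • ξ r) volume 0 s :=
  (intervalIntegrable ξ hs).continuousOn_smul Real.continuous_exp.continuousOn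

lemma resolventFun_ac (ξ : Memory k ℓ) {s : ℝ} (hs : s ∈ k.supp) :
    AbsolutelyContinuousOnInterval (resolventFun ξ) 0 s :=
  (absolutelyContinuousOnInterval_exp_neg 0 s).smul
    (absolutelyContinuousOnInterval_primitive (intervalIntegrable_exp_smul ξ hs))

lemma resolventFun_hasDerivAt (ξ : Memory k ℓ) {s : ℝ} (hs : s ∈ k.supp) :
    ∀ᵐ t, t ∈ uIcc 0 s → HasDerivAt (resolventFun ξ) (ξ t - resolventFun ξ t) t := by
  filter_upwards [(intervalIntegrable_exp_smul ξ hs).ae_hasDerivAt_integral] with t h ht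
  refine ((hasDerivAt_exp_neg t).smul (h ht 0 left_mem_uIcc)).congr_deriv ?_
  rw [smul_smul, ← Real.exp_add, neg_add_cancel, Real.exp_zero, one_smul, neg_smul,
    ← sub_eq_add_neg]
  rfl

lemma resolventFun_eq (ξ : Memory k ℓ) {s : ℝ} (hs : s ∈ k.supp) {t : ℝ} (ht : t ∈ uIcc 0 s) :
    resolventFun ξ t = ∫ r in (0 : ℝ)..t, (ξ r - resolventFun ξ r) := by
  rw [← (resolventFun_ac ξ hs).sub_eq_integral
    ((intervalIntegrable ξ hs).sub (resolventFun_ac ξ hs).continuousOn.intervalIntegrable)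
    (resolventFun_hasDerivAt ξ hs) ht, resolventFun_zero, sub_zero]

lemma continuousOn_resolventFun (ξ : Memory k ℓ) : ContinuousOn (resolventFun ξ) k.supp := by
  intro s hs
  obtain ⟨t, ht, hst⟩ := k.exists_gt_mem_supp hs
  have h1 := (resolventFun_ac ξ ht).continuousOn
  rw [uIcc_of_le ht.1.le] at h1
  exact (h1.continuousAt (Icc_mem_nhds hs.1 hst)).continuousWithinAt

/-- Let η be the resolvent function, so that η' = ξ − η. The energy inequality gives 0 ≤ ∫ μ⟨ξ − η,
η⟩ ≤ ½ ∫ μ(‖ξ‖² − ‖η‖²) on (0, S), so ∫ μ‖η‖² there is bounded by the squared norm of ξ, uniformly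
in S. -/
lemma memLp_resolventFun (ξ : Memory k ℓ) : MemLp (resolventFun ξ) 2 k.measure := by
  have hm : AEStronglyMeasurable (resolventFun ξ) k.measure :=
    ((continuousOn_resolventFun ξ).aestronglyMeasurable k.isOpen_supp.measurableSet).mono_ac
      k.ac_restrict
  obtain ⟨S, hS, hcov⟩ := k.exists_aecover
  rw [memLp_two_iff_integrable_sq_norm hm]
  have hξ : Integrable (fun s => ‖ξ s‖ ^ 2) k.measure :=
    (memLp_two_iff_integrable_sq_norm (Lp.aestronglyMeasurable ξ)).1 (Lp.memLp ξ)
  -- Absorbing ‖η‖² in the estimate needs the truncated integrals to be finite beforehand;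
  -- boundedness on each interval provides this.
  have hb : ∀ n, ∃ C, ∀ t ∈ Ioo 0 (S n), ‖resolventFun ξ t‖ ≤ C := fun n => by
    obtain ⟨C, hC⟩ := (resolventFun_ac ξ (hS n)).exists_bound
    rw [uIcc_of_le (hS n).1.le] at hC
    exact ⟨C, fun t ht => hC t (Ioo_subset_Icc_self ht)⟩
  have hloc : ∀ n, MemLp (resolventFun ξ) 2 (k.measure.restrict (Ioo 0 (S n))) := fun n => by
    obtain ⟨C, hC⟩ := hb n
    refine MemLp.of_bound hm.restrict C ?_
    filter_upwards [ae_restrict_mem measurableSet_Ioo] with t ht using hC t ht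
  have hi : ∀ n, IntegrableOn (fun s => ‖resolventFun ξ s‖ ^ 2) (Ioo 0 (S n)) k.measure :=
    fun n => (memLp_two_iff_integrable_sq_norm hm.restrict).1 (hloc n)
  refine hcov.integrable_of_integral_norm_bounded (∫ s, ‖ξ s‖ ^ 2 ∂k.measure) hi
    (Eventually.of_forall fun n => ?_)
  simp only [norm_pow, norm_norm]
  have hξn : IntegrableOn (fun s => ‖ξ s‖ ^ 2) (Ioo 0 (S n)) k.measure := hξ.integrableOn
  have h1 : ∫ s in Ioo 0 (S n), ‖ξ s‖ ^ 2 ∂k.measure ≤ ∫ s, ‖ξ s‖ ^ 2 ∂k.measure :=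
    setIntegral_le_integral hξ (Eventually.of_forall fun s => by positivity)
  refine le_trans ?_ h1
  have hen := k.energy_nonneg (hS n) ((intervalIntegrable ξ (hS n)).sub
    (resolventFun_ac ξ (hS n)).continuousOn.intervalIntegrable)
  have h2 : ∫ t in Ioo 0 (S n), ⟪ξ t - resolventFun ξ t,
      ∫ r in (0 : ℝ)..t, (ξ r - resolventFun ξ r)⟫ ∂k.measure ≤
      ∫ t in Ioo 0 (S n), (1 / 2) * (‖ξ t‖ ^ 2 - ‖resolventFun ξ t‖ ^ 2) ∂k.measure := by
    have e : ∀ᵐ t ∂(k.measure.restrict (Ioo 0 (S n))), ⟪ξ t - resolventFun ξ t,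
        ∫ r in (0 : ℝ)..t, (ξ r - resolventFun ξ r)⟫ =
        ⟪ξ t - resolventFun ξ t, resolventFun ξ t⟫ := by
      filter_upwards [ae_restrict_mem measurableSet_Ioo] with t ht
      rw [← resolventFun_eq ξ (hS n) (by
        rw [uIcc_of_le (hS n).1.le]; exact Ioo_subset_Icc_self ht)]
    rw [integral_congr_ae e]
    have hpt : ∀ t, |⟪ξ t, resolventFun ξ t⟫| ≤
        (1 / 2) * (‖ξ t‖ ^ 2 + ‖resolventFun ξ t‖ ^ 2) := fun t => by
      have := abs_real_inner_le_norm (ξ t) (resolventFun ξ t)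
      nlinarith [sq_nonneg (‖ξ t‖ - ‖resolventFun ξ t‖)]
    refine integral_mono ?_ ((hξn.sub (hi n)).const_mul _) fun t => ?_
    · refine Integrable.mono' ((hξn.add (hi n)).const_mul (3 / 2))
        (((Lp.aestronglyMeasurable ξ).sub hm).inner hm).restrict (Eventually.of_forall fun t => ?_)
      rw [Real.norm_eq_abs, inner_sub_left, real_inner_self_eq_norm_sq, abs_le]
      have := abs_le.1 (hpt t)
      simp only [Pi.add_apply]
      constructor <;> nlinarith [sq_nonneg ‖ξ t‖, sq_nonneg ‖resolventFun ξ t‖]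
    · simp only [inner_sub_left, real_inner_self_eq_norm_sq]
      have := (abs_le.1 (hpt t)).2
      linarith
  rw [integral_const_mul, integral_sub hξn (hi n)] at h2
  have := hen.trans h2
  linarith

/-- The range of `1 - T` is the whole memory space. -/
lemma exists_sub_T_eq (ξ : Memory k ℓ) :
    ∃ (η : Memory k ℓ) (h : η ∈ domT k ℓ), η - T k ℓ ⟨η, h⟩ = ξ := by
  set η : Memory k ℓ := (memLp_resolventFun ξ).toLp _
  have hη : η =ᵐ[k.measure] resolventFun ξ := (memLp_resolventFun ξ).coeFn_toLp
  obtain ⟨h, hT⟩ := mem_domT_of_absolutelyContinuous (η := η) (ζ := ξ - η)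
    (fun s hs => resolventFun_ac ξ hs)
    (fun s hs => (intervalIntegrable ξ hs).sub
      (resolventFun_ac ξ hs).continuousOn.intervalIntegrable)
    (fun s hs => resolventFun_hasDerivAt ξ hs) (resolventFun_zero ξ) hη (by
      filter_upwards [Lp.coeFn_sub ξ η, hη] with t h1 h2
      rw [h1, Pi.sub_apply, h2])
  exact ⟨η, h, by rw [hT]; abel⟩

/-- The mass `∫ μ(s) (1 - e^{-s}) ds`. -/
def resolventMass (k : MemoryKernel) : ℝ := ∫ s, (1 - Real.exp (-s)) ∂k.measure

lemma ae_pos (k : MemoryKernel) : ∀ᵐ s ∂k.measure, 0 < s :=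
  k.ac_restrict (by
    filter_upwards [ae_restrict_mem k.isOpen_supp.measurableSet] with s hs using hs.1)

lemma integrable_one_sub_exp (k : MemoryKernel) :
    Integrable (fun s => 1 - Real.exp (-s)) k.measure := by
  refine Integrable.of_bound (C := 1) (by fun_prop) ?_
  filter_upwards [ae_pos k] with s hs
  have h1 := Real.exp_pos (-s)
  have h2 : Real.exp (-s) ≤ 1 := Real.exp_le_one_iff.2 (by linarith)
  rw [Real.norm_of_nonneg (by linarith)]
  linarith

lemma resolventMass_pos (k : MemoryKernel) : 0 < resolventMass k := by
  have hpos : ∀ᵐ s ∂k.measure, 0 < 1 - Real.exp (-s) := by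
    filter_upwards [ae_pos k] with s hs
    have : Real.exp (-s) < 1 := Real.exp_lt_one_iff.2 (by linarith)
    linarith
  rw [resolventMass, integral_pos_iff_support_of_nonneg_ae (hpos.mono fun s hs => hs.le)
    (integrable_one_sub_exp k)]
  have : k.measure (Function.support fun s => 1 - Real.exp (-s)) = k.measure univ := by
    refine measure_congr ?_
    filter_upwards [hpos] with s hs
    exact propext ⟨fun _ => trivial, fun _ => hs.ne'⟩
  rw [this]
  exact Measure.measure_univ_pos.2 k.measure_ne_zero

/-- The action of `(1 - T)⁻¹` on functions that are constant in `s`. -/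
lemma exists_sub_T_eq_const (θ : H10Space ℓ) :
    ∃ (η : Memory k ℓ) (h : η ∈ domT k ℓ), η - T k ℓ ⟨η, h⟩ = Lp.const 2 k.measure θ ∧
      ∫ s, η s ∂k.measure = resolventMass k • θ := by
  -- The problem η + η' = θ, η(0) = 0 has the solution (1 − e^{−s})θ, whose mean is a scalar
  -- multiple of θ.
  have hm : MemLp (fun s => (1 - Real.exp (-s)) • θ) 2 k.measure := by
    refine MemLp.of_bound (by fun_prop) ‖θ‖ ?_
    filter_upwards [ae_pos k] with s hs
    have h1 := Real.exp_pos (-s)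
    have h2 : Real.exp (-s) ≤ 1 := Real.exp_le_one_iff.2 (by linarith)
    rw [norm_smul, Real.norm_of_nonneg (by linarith)]
    nlinarith [norm_nonneg θ]
  set η : Memory k ℓ := hm.toLp _
  have hη : η =ᵐ[k.measure] fun s => (1 - Real.exp (-s)) • θ := hm.coeFn_toLp
  have hd : ∀ t, HasDerivAt (fun s => (1 - Real.exp (-s)) • θ) (Real.exp (-t) • θ) t := fun t => by
    simpa using ((hasDerivAt_exp_neg t).const_sub 1).smul_const θ
  obtain ⟨h, hT⟩ := mem_domT_of_absolutelyContinuous (f := fun s => (1 - Real.exp (-s)) • θ)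
    (g := fun s => Real.exp (-s) • θ) (η := η) (ζ := Lp.const 2 k.measure θ - η)
    (fun s hs => by
      refine ContDiffOn.absolutelyContinuousOnInterval (ContDiff.contDiffOn ?_)
      exact (contDiff_const.sub (Real.contDiff_exp.comp contDiff_neg)).smul contDiff_const)
    (fun s hs => Continuous.intervalIntegrable (by fun_prop) _ _)
    (fun s hs => Eventually.of_forall fun t _ => hd t) (by simp) hη (by
      filter_upwards [Lp.coeFn_sub (Lp.const 2 k.measure θ) η, hη,
        Lp.coeFn_const (p := 2) (μ := k.measure) θ] with t h1 h2 h3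
      rw [h1, Pi.sub_apply, h2, h3, Function.const_apply, sub_smul, one_smul, sub_sub_cancel])
  refine ⟨η, h, by rw [hT]; abel, ?_⟩
  rw [integral_congr_ae hη, integral_smul_const]
  rfl

lemma inner_const (θ : H10Space ℓ) (η : Memory k ℓ) :
    ⟪(Lp.const 2 k.measure θ : Memory k ℓ), η⟫ = ⟪θ, ∫ s, η s ∂k.measure⟫ := by
  rw [L2.inner_def, ← integral_inner η.integrable]
  refine integral_congr_ae ?_
  filter_upwards [Lp.coeFn_const (p := 2) (μ := k.measure) θ] with t h
  rw [h, Function.const_apply]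

end Memory

/-! ### Integration by parts and primitives on (0, ℓ). -/

variable {ℓ : ℝ}

lemma inner_L2 (u v : L2 ℓ) : ⟪u, v⟫ = ∫ x in Ioo 0 ℓ, v x * u x := by
  rw [L2.inner_def]
  rfl

lemma inner_eq_integral_of_ae_eq {u v : L2 ℓ} {φ : ℝ → ℝ}
    (hv : v =ᵐ[volume.restrict (Ioo 0 ℓ)] φ) : ⟪u, v⟫ = ∫ x in Ioo 0 ℓ, φ x • u x := by
  rw [inner_L2]
  refine integral_congr_ae ?_
  filter_upwards [hv] with x hx
  rw [hx, smul_eq_mul]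

/-- Integration by parts. -/
lemma inner_dx_eq {u v : L2 ℓ} (hu : u ∈ H1 ℓ) (hv : v ∈ H10 ℓ) :
    ⟪dx u, v⟫ = -⟪u, dx v⟫ := by
  -- The identity is a closed condition on (v, v_x), and for test functions it is the definition of
  -- the weak derivative of u.
  have hc : IsClosed {p : L2 ℓ × L2 ℓ | ⟪dx u, p.1⟫ = -⟪u, p.2⟫} :=
    isClosed_eq (by fun_prop) (by fun_prop)
  refine closure_minimal (s := testGraph ℓ) ?_ hc hv.2
  rintro p ⟨φ, hφ, h1, h2⟩
  rw [Set.mem_ofPred_eq, inner_eq_integral_of_ae_eq h1, inner_eq_integral_of_ae_eq h2,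
    eq_comm, neg_eq_iff_eq_neg]
  exact graph_dx hu φ hφ

lemma mem_gradGraph_of_contDiff (hℓ : 0 < ℓ) {f : ℝ → ℝ} (hf : ContDiff ℝ 1 f) {u v : L2 ℓ}
    (hu : u =ᵐ[volume.restrict (Ioo 0 ℓ)] f) (hv : v =ᵐ[volume.restrict (Ioo 0 ℓ)] deriv f) :
    (u, v) ∈ gradGraph ℓ := by
  have h := isWeakDeriv_of_absolutelyContinuous hℓ.le
    hf.contDiffOn.absolutelyContinuousOnInterval
    ((hf.continuous_deriv le_rfl).intervalIntegrable 0 ℓ)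
    (Eventually.of_forall fun x _ => (hf.differentiable (by simp) x).hasDerivAt)
  intro φ hφ
  convert! h φ hφ using 1
  · refine integral_congr_ae ?_
    filter_upwards [hu] with x hx
    rw [hx]
  · congr 1
    refine integral_congr_ae ?_
    filter_upwards [hv] with x hx
    rw [hx]

lemma IsTest.exists_mem_H10 (hℓ : 0 < ℓ) {φ : ℝ → ℝ} (h : IsTest (Ioo 0 ℓ) φ) :
    ∃ v ∈ H10 ℓ, v =ᵐ[volume.restrict (Ioo 0 ℓ)] φ ∧
      dx v =ᵐ[volume.restrict (Ioo 0 ℓ)] _root_.deriv φ := by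
  have h1 : h.memLp.toLp φ =ᵐ[volume.restrict (Ioo 0 ℓ)] φ := h.memLp.coeFn_toLp
  have h2 : h.deriv.memLp.toLp _ =ᵐ[volume.restrict (Ioo 0 ℓ)] _root_.deriv φ :=
    h.deriv.memLp.coeFn_toLp
  obtain ⟨hm, hd⟩ := mem_gradGraph_iff.1
    (mem_gradGraph_of_contDiff hℓ (h.smooth.of_le (by simp)) h1 h2)
  rw [← hd] at h2
  exact ⟨_, ⟨hm, subset_closure ⟨φ, h, h1, h2⟩⟩, h1, h2⟩

/-- `u` has the derivative `h` if this is so in the weak sense, tested with `H¹₀`. -/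
lemma mem_H1_of_forall_inner (hℓ : 0 < ℓ) {u h : L2 ℓ}
    (hu : ∀ v ∈ H10 ℓ, ⟪u, dx v⟫ = -⟪h, v⟫) : u ∈ H1 ℓ ∧ dx u = h := by
  refine mem_gradGraph_iff.1 fun φ hφ => ?_
  obtain ⟨v, hv, h1, h2⟩ := hφ.exists_mem_H10 hℓ
  change ∫ x in Ioo 0 ℓ, deriv φ x • u x = -∫ x in Ioo 0 ℓ, φ x • h x
  rw [← inner_eq_integral_of_ae_eq h1, ← inner_eq_integral_of_ae_eq h2, hu v hv]

/-- The constant function `1`. -/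
def one (ℓ : ℝ) : L2 ℓ := Lp.const 2 (volume.restrict (Ioo 0 ℓ)) (1 : ℝ)

lemma coeFn_one : one ℓ =ᵐ[volume.restrict (Ioo 0 ℓ)] fun _ => (1 : ℝ) :=
  Lp.coeFn_const (p := 2) (μ := volume.restrict (Ioo 0 ℓ)) (1 : ℝ)

lemma inner_one (u : L2 ℓ) : ⟪u, one ℓ⟫ = ∫ x in Ioo 0 ℓ, u x := by
  rw [inner_eq_integral_of_ae_eq coeFn_one]
  simp

lemma mem_L2s_iff {u : L2 ℓ} : u ∈ L2s ℓ ↔ ⟪u, one ℓ⟫ = 0 := by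
  rw [inner_one]
  rfl

lemma inner_one_one (hℓ : 0 < ℓ) : ⟪one ℓ, one ℓ⟫ = ℓ := by
  rw [inner_one, integral_congr_ae coeFn_one]
  simp [hℓ.le]

lemma one_mem_H1 (hℓ : 0 < ℓ) : one ℓ ∈ H1 ℓ ∧ dx (one ℓ) = 0 :=
  mem_gradGraph_iff.1 (mem_gradGraph_of_contDiff hℓ (f := fun _ => 1) contDiff_const coeFn_one (by
    filter_upwards [Lp.coeFn_zero ℝ 2 (volume.restrict (Ioo 0 ℓ))] with x hx
    rw [deriv_const]
    exact hx))

lemma exists_dx_eq_one (hℓ : 0 < ℓ) : ∃ u ∈ H1 ℓ, dx u = one ℓ := by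
  have hm : MemLp (fun x : ℝ => x) 2 (volume.restrict (Ioo 0 ℓ)) := by
    refine MemLp.of_bound (by fun_prop) ℓ ?_
    filter_upwards [ae_restrict_mem measurableSet_Ioo] with x hx
    rw [Real.norm_of_nonneg hx.1.le]
    exact hx.2.le
  refine ⟨hm.toLp _, mem_gradGraph_iff.1 (mem_gradGraph_of_contDiff hℓ contDiff_id
    hm.coeFn_toLp ?_)⟩
  filter_upwards [coeFn_one (ℓ := ℓ)] with x hx
  simp [hx]

/-- Subtracting the mean. -/
lemma sub_mean_mem_L2s (hℓ : 0 < ℓ) (u : L2 ℓ) : u - (⟪u, one ℓ⟫ / ℓ) • one ℓ ∈ L2s ℓ := by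
  rw [mem_L2s_iff, inner_sub_left, real_inner_smul_left, inner_one_one hℓ,
    div_mul_cancel₀ _ hℓ.ne', sub_self]

lemma eq_smul_one_of_dx_eq_zero (hℓ : 0 < ℓ) {u : L2 ℓ} (hu : u ∈ H1 ℓ) (h : dx u = 0) :
    u = (⟪u, one ℓ⟫ / ℓ) • one ℓ := by
  obtain ⟨h1, h2⟩ := one_mem_H1 hℓ
  have hs : (-(⟪u, one ℓ⟫ / ℓ)) • one ℓ ∈ H1 ℓ := (H1 ℓ).smul_mem _ h1
  refine sub_eq_zero.1 (eq_zero_of_dx_eq_zero hℓ ⟨?_, sub_mean_mem_L2s hℓ u⟩ ?_)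
  · exact (H1 ℓ).sub_mem hu ((H1 ℓ).smul_mem _ h1)
  · rw [sub_eq_add_neg, ← neg_smul, dx_add hu hs, dx_smul _ h1, h, h2, smul_zero, add_zero]

/-- The derivative `H¹₀ → L²` as an isometry. -/
def H10Space.dxIsometry (ℓ : ℝ) : H10Space ℓ →ₗᵢ[ℝ] L2 ℓ :=
  ⟨H10Space.D, fun u => (H10Space.norm_eq u).symm⟩

/-- The derivative maps `H¹₀` onto `L²_*`. -/
lemma exists_mem_H10_dx_eq (hℓ : 0 < ℓ) {h : L2 ℓ} (hh : h ∈ L2s ℓ) : ∃ u ∈ H10 ℓ, dx u = h := by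
  set R := LinearMap.range (H10Space.dxIsometry ℓ).toLinearMap with hR
  have hRc : IsClosed (R : Set (L2 ℓ)) := by
    have := (H10Space.dxIsometry ℓ).isometry.isClosedEmbedding.isClosed_range
    rw [hR, LinearMap.coe_range]
    exact this
  have : CompleteSpace R := hRc.completeSpace_coe
  -- The range is closed, being the image of a complete space under an isometry. A vector orthogonal
  -- to it has zero weak derivative, so it is constant and orthogonal to every function of zero
  -- mean.
  have hmem : h ∈ R := by
    rw [← R.orthogonal_orthogonal]
    refine (Submodule.mem_orthogonal _ _).2 fun v hv => ?_
    obtain ⟨hv1, hv2⟩ := mem_H1_of_forall_inner hℓ (u := v) (h := 0) fun u hu => by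
      rw [inner_zero_left, neg_zero, real_inner_comm]
      exact (Submodule.mem_orthogonal _ _).1 hv _ ⟨H10Space.mk u hu, rfl⟩
    rw [eq_smul_one_of_dx_eq_zero hℓ hv1 hv2, real_inner_smul_left, real_inner_comm h,
      mem_L2s_iff.1 hh, mul_zero]
  obtain ⟨u, hu⟩ := hmem
  exact ⟨u.val, u.val_mem, hu⟩

/-- The derivative maps `H¹_*` onto `L²`. -/
lemma exists_mem_H1s_dx_eq (hℓ : 0 < ℓ) (g : L2 ℓ) : ∃ u ∈ H1s ℓ, dx u = g := by
  -- The mean of g is integrated separately as a multiple of x, the rest by an element of H¹₀;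
  -- subtracting a constant finally restores zero mean.
  obtain ⟨u, hu, hdu⟩ := exists_mem_H10_dx_eq hℓ (sub_mean_mem_L2s hℓ g)
  obtain ⟨x, hx, hdx⟩ := exists_dx_eq_one hℓ
  obtain ⟨h1, h2⟩ := one_mem_H1 hℓ
  set c := ⟪g, one ℓ⟫ / ℓ
  set w := u + c • x with hw
  have hcx : c • x ∈ H1 ℓ := (H1 ℓ).smul_mem c hx
  have hwm : w ∈ H1 ℓ := (H1 ℓ).add_mem hu.1 hcx
  have hs : (-(⟪w, one ℓ⟫ / ℓ)) • one ℓ ∈ H1 ℓ := (H1 ℓ).smul_mem _ h1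
  refine ⟨w - (⟪w, one ℓ⟫ / ℓ) • one ℓ,
    ⟨(H1 ℓ).sub_mem hwm ((H1 ℓ).smul_mem _ h1), sub_mean_mem_L2s hℓ w⟩, ?_⟩
  rw [sub_eq_add_neg, ← neg_smul, dx_add hwm hs, dx_smul _ h1, h2, smul_zero, add_zero, hw,
    dx_add hu.1 hcx, dx_smul c hx, hdx, hdu, sub_add_cancel]

lemma eq_of_dx_eq (hℓ : 0 < ℓ) {u v : L2 ℓ} (hu : u ∈ H1s ℓ) (hv : v ∈ H1s ℓ)
    (h : dx u = dx v) : u = v := by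
  have hn : (-1 : ℝ) • v ∈ H1 ℓ := (H1 ℓ).smul_mem _ hv.1
  refine sub_eq_zero.1 (eq_zero_of_dx_eq_zero hℓ ((H1s ℓ).sub_mem hu hv) ?_)
  rw [sub_eq_add_neg, ← neg_one_smul ℝ v, dx_add hu.1 hn, dx_smul _ hv.1, h]
  simp

/-- The bounded inverse of the derivative `H¹_* → L²`. -/
lemma exists_meanZeroPrimitive (hℓ : 0 < ℓ) : ∃ J : L2 ℓ →L[ℝ] L2 ℓ,
    (∀ g, J g ∈ H1s ℓ) ∧ (∀ g, dx (J g) = g) ∧ ∀ u ∈ H1s ℓ, J (dx u) = u := by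
  choose J hJ hdJ using exists_mem_H1s_dx_eq hℓ
  let L : L2 ℓ →ₗ[ℝ] L2 ℓ :=
    { toFun := J
      map_add' := fun f g => eq_of_dx_eq hℓ (hJ _) ((H1s ℓ).add_mem (hJ f) (hJ g)) (by
        rw [dx_add (hJ f).1 (hJ g).1, hdJ, hdJ, hdJ])
      map_smul' := fun c f => eq_of_dx_eq hℓ (hJ _) ((H1s ℓ).smul_mem c (hJ f)) (by
        rw [RingHom.id_apply, dx_smul c (hJ f).1, hdJ, hdJ]) }
  -- Boundedness comes from the closed graph theorem: the graph is cut out by the closed relation "u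
  -- has weak derivative g" and the closed condition of zero mean.
  have hgr : IsClosed (L.graph : Set (L2 ℓ × L2 ℓ)) := by
    have e : (L.graph : Set (L2 ℓ × L2 ℓ)) =
        {p | (p.2, p.1) ∈ gradGraph ℓ} ∩ {p | ⟪p.2, one ℓ⟫ = 0} := by
      ext ⟨g, u⟩
      rw [SetLike.mem_coe, LinearMap.mem_graph_iff]
      constructor
      · rintro (rfl : u = J g)
        exact ⟨mem_gradGraph_iff.2 ⟨(hJ g).1, hdJ g⟩, mem_L2s_iff.1 (hJ g).2⟩
      · rintro ⟨h1, h2⟩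
        obtain ⟨h3, h4⟩ := mem_gradGraph_iff.1 h1
        exact eq_of_dx_eq hℓ ⟨h3, mem_L2s_iff.2 h2⟩ (hJ g) (h4.trans (hdJ g).symm)
    rw [e]
    exact ((isClosed_gradGraph ℓ).preimage continuous_swap).inter
      (isClosed_eq (by fun_prop) (by fun_prop))
  refine ⟨⟨L, L.continuous_of_isClosed_graph hgr⟩, hJ, hdJ, fun u hu =>
    eq_of_dx_eq hℓ (hJ _) hu (hdJ _)⟩

/-- Weak solutions of `-p_x = h` with natural boundary conditions. -/
lemma mem_H10_of_forall_inner (hℓ : 0 < ℓ) {p h : L2 ℓ} (hh : h ∈ L2s ℓ)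
    (H : ∀ v ∈ H1s ℓ, ⟪p, dx v⟫ = ⟪h, v⟫) : p ∈ H10 ℓ ∧ dx p = -h := by
  -- With h = u_x and u ∈ H¹₀, the right-hand side is −⟨u, v_x⟩. Since v_x runs through all of L²,
  -- this forces p = −u, which includes the boundary condition.
  obtain ⟨u, hu, rfl⟩ := exists_mem_H10_dx_eq hℓ hh
  have hn : (-1 : ℝ) • u ∈ H10 ℓ := (H10 ℓ).smul_mem _ hu
  suffices hp : p = (-1 : ℝ) • u by
    subst hp
    exact ⟨hn, by rw [dx_smul _ hu.1, neg_one_smul]⟩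
  refine ext_inner_right ℝ fun g => ?_
  obtain ⟨v, hv, rfl⟩ := exists_mem_H1s_dx_eq hℓ g
  rw [H v hv, real_inner_smul_left, real_inner_comm (dx v) u, inner_dx_eq hv.1 hu,
    real_inner_comm]
  ring

/-- The inclusion `H¹₀ → L²` is bounded. -/
lemma exists_valL (ℓ : ℝ) : ∃ ι : H10Space ℓ →L[ℝ] L2 ℓ, ∀ u, ι u = u.val := by
  obtain ⟨C, -, hC⟩ := poincare ℓ
  exact ⟨H10Space.val.mkContinuous C fun u => by
    rw [H10Space.norm_eq]; exact hC _ u.val_mem, fun u => rfl⟩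

instance (ℓ : ℝ) : CompleteSpace (L2s ℓ) := by
  have : IsClosed (L2s ℓ : Set (L2 ℓ)) := isClosed_eq (continuous_integral_L2 ℓ) continuous_const
  exact this.completeSpace_coe

/-! ### The stationary problem by Lax–Milgram. -/

section LaxMilgram

variable {V W : Type*} [NormedAddCommGroup V] [InnerProductSpace ℝ V]
  [NormedAddCommGroup W] [InnerProductSpace ℝ W]

/-- The **Lax–Milgram theorem** for bounded functionals. -/
lemma exists_forall_bilin_eq [CompleteSpace V] {B : V →L[ℝ] V →L[ℝ] ℝ} (hB : IsCoercive B)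
    (F : V →L[ℝ] ℝ) : ∃ u, ∀ v, B u v = F v := by
  refine ⟨hB.continuousLinearEquivOfBilin.symm ((InnerProductSpace.toDual ℝ V).symm F),
    fun v => ?_⟩
  rw [← hB.continuousLinearEquivOfBilin_apply, ContinuousLinearEquiv.apply_symm_apply,
    InnerProductSpace.toDual_symm_apply]

/-- The bilinear form `(u, v) ↦ ⟨f u, g v⟩`. -/
def pullbackInner (f g : V →L[ℝ] W) : V →L[ℝ] V →L[ℝ] ℝ := (innerSL ℝ).bilinearComp f g

end LaxMilgram

/-- Solvability of the weak form of the stationary problem. -/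
lemma exists_weak_solution {ℓ : ℝ} (hℓ : 0 < ℓ) {κ r₁ r₂ r₃ b a : ℝ} (hκ : 0 < κ) (hr₁ : 0 < r₁)
    (hr₂ : 0 < r₂) (hr₃ : 0 < r₃) (hb : 0 < b) (ha : 0 < a) (δ : ℝ) (F₁ F₂ F₃ Q : L2 ℓ) :
    ∃ φ ψ θ : L2 ℓ, φ ∈ H10 ℓ ∧ ψ ∈ H1s ℓ ∧ θ ∈ H10 ℓ ∧
      (∀ u ∈ H10 ℓ, r₁ * ⟪φ, u⟫ + κ * ⟪dx φ + ψ, dx u⟫ = ⟪F₁, u⟫) ∧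
      (∀ v ∈ H1s ℓ, κ * ⟪dx φ + ψ, v⟫ + r₂ * ⟪ψ, v⟫ + b * ⟪dx ψ, dx v⟫ + δ * ⟪dx θ, v⟫ =
        ⟪F₂, v⟫) ∧
      ∀ w ∈ H10 ℓ, r₃ * ⟪θ, w⟫ + a * ⟪dx θ, dx w⟫ + δ * ⟪dx ψ, w⟫ = ⟪F₃, w⟫ + ⟪Q, dx w⟫ := by
  obtain ⟨J, hJ, hdJ, hJd⟩ := exists_meanZeroPrimitive hℓ
  obtain ⟨ι, hι⟩ := exists_valL ℓ
  -- The middle factor L² carries ψ_x, and ψ is recovered as the image of ψ_x under `J`, so no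
  -- separate Hilbert space structure on H¹_* is needed.
  let V := WithLp 2 (H10Space ℓ × WithLp 2 (L2 ℓ × H10Space ℓ))
  let D : H10Space ℓ →L[ℝ] L2 ℓ := (H10Space.dxIsometry ℓ).toContinuousLinearMap
  let p1 : V →L[ℝ] H10Space ℓ := WithLp.fstL 2 ℝ _ _
  let p23 : V →L[ℝ] WithLp 2 (L2 ℓ × H10Space ℓ) := WithLp.sndL 2 ℝ _ _
  let p2 : V →L[ℝ] L2 ℓ := (WithLp.fstL 2 ℝ _ _).comp p23
  let p3 : V →L[ℝ] H10Space ℓ := (WithLp.sndL 2 ℝ _ _).comp p23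
  have hnorm : ∀ u : V, ‖u‖ ^ 2 = ‖D (p1 u)‖ ^ 2 + (‖p2 u‖ ^ 2 + ‖D (p3 u)‖ ^ 2) := fun u => by
    rw [show ‖D (p1 u)‖ = ‖p1 u‖ from (H10Space.dxIsometry ℓ).norm_map _,
      show ‖D (p3 u)‖ = ‖p3 u‖ from (H10Space.dxIsometry ℓ).norm_map _]
    rw [WithLp.prod_norm_sq_eq_of_L2, WithLp.prod_norm_sq_eq_of_L2 u.snd]
    rfl
  let φ := ι.comp p1
  let φx := D.comp p1
  let ψ := J.comp p2
  let θ := ι.comp p3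
  let θx := D.comp p3
  let B : V →L[ℝ] V →L[ℝ] ℝ := r₁ • pullbackInner φ φ + κ • pullbackInner (φx + ψ) (φx + ψ)
    + r₂ • pullbackInner ψ ψ + b • pullbackInner p2 p2 + r₃ • pullbackInner θ θ
    + a • pullbackInner θx θx + δ • pullbackInner θx ψ + δ • pullbackInner p2 θ
  let F : V →L[ℝ] ℝ := (innerSL ℝ F₁).comp φ + (innerSL ℝ F₂).comp ψ + (innerSL ℝ F₃).comp θ
    + (innerSL ℝ Q).comp θx
  have hBapp : ∀ u v, B u v = r₁ * ⟪φ u, φ v⟫ + κ * ⟪φx u + ψ u, φx v + ψ v⟫ + r₂ * ⟪ψ u, ψ v⟫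
      + b * ⟪p2 u, p2 v⟫ + r₃ * ⟪θ u, θ v⟫ + a * ⟪θx u, θx v⟫ + δ * ⟪θx u, ψ v⟫
      + δ * ⟪p2 u, θ v⟫ := fun u v => rfl
  have hFapp : ∀ v, F v = ⟪F₁, φ v⟫ + ⟪F₂, ψ v⟫ + ⟪F₃, θ v⟫ + ⟪Q, θx v⟫ := fun v => rfl
  have hcoer : IsCoercive B := by
    -- The halves compensate the factor 2 in ‖φ_x‖² ≤ 2‖φ_x + ψ‖² + 2‖ψ‖², by which φ_x is
    -- controlled.
    set m := min (min (κ / 2) (r₂ / 2)) (min b a) with hm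
    have hmpos : 0 < m := by positivity
    have m1 : m ≤ κ / 2 := (min_le_left _ _).trans (min_le_left _ _)
    have m2 : m ≤ r₂ / 2 := (min_le_left _ _).trans (min_le_right _ _)
    have m3 : m ≤ b := (min_le_right _ _).trans (min_le_left _ _)
    have m4 : m ≤ a := (min_le_right _ _).trans (min_le_right _ _)
    refine ⟨m, hmpos, fun u => ?_⟩
    -- The thermal coupling is skew, since ⟨θ_x, ψ⟩ = −⟨θ, ψ_x⟩ for θ ∈ H¹₀. It drops out of the
    -- quadratic form, so δ needs neither sign nor smallness.
    have hskew : ⟪θx u, ψ u⟫ + ⟪p2 u, θ u⟫ = 0 := by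
      have h1 := inner_dx_eq (hJ (p2 u)).1 (p3 u).val_mem
      rw [hdJ] at h1
      change ⟪dx (p3 u).val, J (p2 u)⟫ + ⟪p2 u, ι (p3 u)⟫ = 0
      rw [hι, h1, real_inner_comm, add_neg_cancel]
    have htri : ‖φx u‖ ^ 2 ≤ 2 * ‖φx u + ψ u‖ ^ 2 + 2 * ‖ψ u‖ ^ 2 := by
      have h1 := norm_sub_le (φx u + ψ u) (ψ u)
      rw [add_sub_cancel_right] at h1
      nlinarith [sq_nonneg (‖φx u + ψ u‖ - ‖ψ u‖), norm_nonneg (φx u)]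
    rw [hBapp, mul_assoc, ← pow_two, hnorm]
    simp only [real_inner_self_eq_norm_sq]
    change m * (‖φx u‖ ^ 2 + (‖p2 u‖ ^ 2 + ‖θx u‖ ^ 2)) ≤ _
    have e1 : m * ‖φx u‖ ^ 2 ≤ κ * ‖φx u + ψ u‖ ^ 2 + r₂ * ‖ψ u‖ ^ 2 := by
      have := mul_le_mul_of_nonneg_left htri hmpos.le
      have := mul_le_mul_of_nonneg_right m1 (sq_nonneg ‖φx u + ψ u‖)
      have := mul_le_mul_of_nonneg_right m2 (sq_nonneg ‖ψ u‖)
      linarith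
    have e2 := mul_le_mul_of_nonneg_right m3 (sq_nonneg ‖p2 u‖)
    have e3 := mul_le_mul_of_nonneg_right m4 (sq_nonneg ‖θx u‖)
    have e4 : 0 ≤ r₁ * ‖φ u‖ ^ 2 := by positivity
    have e5 : 0 ≤ r₃ * ‖θ u‖ ^ 2 := by positivity
    have e6 : δ * ⟪θx u, ψ u⟫ + δ * ⟪p2 u, θ u⟫ = 0 := by rw [← mul_add, hskew, mul_zero]
    linarith
  obtain ⟨u, hu⟩ := exists_forall_bilin_eq hcoer F
  let mkV : H10Space ℓ → L2 ℓ → H10Space ℓ → V := fun x y z =>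
    WithLp.toLp 2 (x, WithLp.toLp 2 (y, z))
  have hψx : dx (ψ u) = p2 u := hdJ _
  have hφx : dx (p1 u).val = φx u := rfl
  have hθx : dx (p3 u).val = θx u := rfl
  have hφ : (p1 u).val = φ u := (hι _).symm
  have hθ : (p3 u).val = θ u := (hι _).symm
  refine ⟨(p1 u).val, ψ u, (p3 u).val, (p1 u).val_mem, hJ _, (p3 u).val_mem, ?_, ?_, ?_⟩
  · intro v hv
    -- Test vectors with a single nonzero component separate the three equations.
    have h := hu (mkV (H10Space.mk v hv) 0 0)
    have e1 : φ (mkV (H10Space.mk v hv) 0 0) = v := hι _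
    have e2 : φx (mkV (H10Space.mk v hv) 0 0) = dx v := rfl
    have e3 : ψ (mkV (H10Space.mk v hv) 0 0) = 0 := J.map_zero
    have e4 : p2 (mkV (H10Space.mk v hv) 0 0) = 0 := rfl
    have e5 : θ (mkV (H10Space.mk v hv) 0 0) = 0 := ι.map_zero
    have e6 : θx (mkV (H10Space.mk v hv) 0 0) = 0 := D.map_zero
    rw [hBapp, hFapp, e1, e2, e3, e4, e5, e6] at h
    simp only [inner_zero_right, add_zero, mul_zero] at h
    rw [hφx, hφ]
    exact h
  · intro v hv
    have h := hu (mkV 0 (dx v) 0)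
    have e1 : φ (mkV 0 (dx v) 0) = 0 := ι.map_zero
    have e2 : φx (mkV 0 (dx v) 0) = 0 := D.map_zero
    have e3 : ψ (mkV 0 (dx v) 0) = v := hJd v hv
    have e4 : p2 (mkV 0 (dx v) 0) = dx v := rfl
    have e5 : θ (mkV 0 (dx v) 0) = 0 := ι.map_zero
    have e6 : θx (mkV 0 (dx v) 0) = 0 := D.map_zero
    rw [hBapp, hFapp, e1, e2, e3, e4, e5, e6] at h
    simp only [inner_zero_right, add_zero, zero_add, mul_zero] at h
    rw [hφx, hψx, hθx]
    exact h
  · intro v hv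
    have h := hu (mkV 0 0 (H10Space.mk v hv))
    have e1 : φ (mkV 0 0 (H10Space.mk v hv)) = 0 := ι.map_zero
    have e2 : φx (mkV 0 0 (H10Space.mk v hv)) = 0 := D.map_zero
    have e3 : ψ (mkV 0 0 (H10Space.mk v hv)) = 0 := J.map_zero
    have e4 : p2 (mkV 0 0 (H10Space.mk v hv)) = 0 := rfl
    have e5 : θ (mkV 0 0 (H10Space.mk v hv)) = v := hι _
    have e6 : θx (mkV 0 0 (H10Space.mk v hv)) = dx v := rfl
    rw [hBapp, hFapp, e1, e2, e3, e4, e5, e6] at h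
    simp only [inner_zero_right, add_zero, zero_add, mul_zero] at h
    rw [hψx, hθx, hθ]
    exact h

/-! ### Completeness of the phase space. -/

namespace BeamData

namespace PhaseSpace

variable {P : BeamData}

lemma inner_def (z w : P.PhaseSpace) : ⟪z, w⟫ =
    P.κ * ⟪z.shear, w.shear⟫ + P.ρ₁ * ⟪z.phiT, w.phiT⟫ + P.b * ⟪z.psiX, w.psiX⟫
    + P.ρ₂ * ⟪(z.psiT : L2 P.ℓ), (w.psiT : L2 P.ℓ)⟫ + P.ρ₃ * ⟪z.theta, w.theta⟫
    + (1 / P.β) * ⟪z.eta, w.eta⟫ := rfl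

/-- The component `shear` as a linear map. -/
def shearₗ : P.PhaseSpace →ₗ[ℝ] L2 P.ℓ := ⟨⟨shear, shear_add⟩, fun c z => shear_smul z c⟩

/-- The component `phiT` as a linear map. -/
def phiTₗ : P.PhaseSpace →ₗ[ℝ] L2 P.ℓ := ⟨⟨phiT, phiT_add⟩, fun c z => phiT_smul z c⟩

/-- The component `psiX` as a linear map. -/
def psiXₗ : P.PhaseSpace →ₗ[ℝ] L2 P.ℓ := ⟨⟨psiX, psiX_add⟩, fun c z => psiX_smul z c⟩

/-- The component `psiT` as a linear map. -/
def psiTₗ : P.PhaseSpace →ₗ[ℝ] L2s P.ℓ := ⟨⟨psiT, psiT_add⟩, fun c z => psiT_smul z c⟩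

/-- The component `theta` as a linear map. -/
def thetaₗ : P.PhaseSpace →ₗ[ℝ] L2 P.ℓ := ⟨⟨theta, theta_add⟩, fun c z => theta_smul z c⟩

/-- The component `eta` as a linear map. -/
def etaₗ : P.PhaseSpace →ₗ[ℝ] Memory P.kernel P.ℓ := ⟨⟨eta, eta_add⟩, fun c z => eta_smul z c⟩

lemma norm_sq_eq (z : P.PhaseSpace) : ‖z‖ ^ 2 =
    P.κ * ‖shearₗ z‖ ^ 2 + P.ρ₁ * ‖phiTₗ z‖ ^ 2 + P.b * ‖psiXₗ z‖ ^ 2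
      + P.ρ₂ * ‖psiTₗ z‖ ^ 2 + P.ρ₃ * ‖thetaₗ z‖ ^ 2 + (1 / P.β) * ‖etaₗ z‖ ^ 2 :=
  norm_sq z

lemma exists_tendsto_of_cauchySeq {Y : Type*} [NormedAddCommGroup Y] [NormedSpace ℝ Y]
    [CompleteSpace Y] (f : P.PhaseSpace →ₗ[ℝ] Y) {c : ℝ} (hc : 0 < c)
    (h : ∀ z, c * ‖f z‖ ^ 2 ≤ ‖z‖ ^ 2) {u : ℕ → P.PhaseSpace} (hu : CauchySeq u) :
    ∃ y, Tendsto (fun n => f (u n)) atTop (𝓝 y) := by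
  have hb : ∀ z, ‖f z‖ ≤ √(1 / c) * ‖z‖ := fun z => by
    refine abs_le_of_sq_le_sq' ?_ (by positivity) |>.2
    rw [mul_pow, Real.sq_sqrt (by positivity), one_div, ← div_eq_inv_mul, le_div_iff₀' hc]
    exact h z
  exact cauchySeq_tendsto_of_complete
    (hu.map (AddMonoidHomClass.uniformContinuous_of_bound f _ hb))

/-- The norm controls φ_x + ψ rather than φ_x. The limit of ψ is recovered from that of ψ_x by the
bounded primitive `J`; subtracting it gives the limit of φ_x, which is again the derivative of an
H¹₀ function because that range is closed. -/
instance : CompleteSpace P.PhaseSpace := by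
  have hκ := P.κ_pos; have hρ₁ := P.ρ₁_pos; have hb := P.b_pos; have hρ₂ := P.ρ₂_pos
  have hρ₃ := P.ρ₃_pos; have hβ : 0 < 1 / P.β := one_div_pos.2 P.β_pos
  have hbd : ∀ z : P.PhaseSpace, P.κ * ‖shearₗ z‖ ^ 2 ≤ ‖z‖ ^ 2 ∧ P.ρ₁ * ‖phiTₗ z‖ ^ 2 ≤ ‖z‖ ^ 2 ∧
      P.b * ‖psiXₗ z‖ ^ 2 ≤ ‖z‖ ^ 2 ∧ P.ρ₂ * ‖psiTₗ z‖ ^ 2 ≤ ‖z‖ ^ 2 ∧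
      P.ρ₃ * ‖thetaₗ z‖ ^ 2 ≤ ‖z‖ ^ 2 ∧ (1 / P.β) * ‖etaₗ z‖ ^ 2 ≤ ‖z‖ ^ 2 := fun z => by
    have h := norm_sq_eq z
    have p1 : 0 ≤ P.κ * ‖shearₗ z‖ ^ 2 := by positivity
    have p2 : 0 ≤ P.ρ₁ * ‖phiTₗ z‖ ^ 2 := by positivity
    have p3 : 0 ≤ P.b * ‖psiXₗ z‖ ^ 2 := by positivity
    have p4 : 0 ≤ P.ρ₂ * ‖psiTₗ z‖ ^ 2 := by positivity
    have p5 : 0 ≤ P.ρ₃ * ‖thetaₗ z‖ ^ 2 := by positivity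
    have p6 : 0 ≤ (1 / P.β) * ‖etaₗ z‖ ^ 2 := by positivity
    refine ⟨?_, ?_, ?_, ?_, ?_, ?_⟩ <;> linarith
  obtain ⟨J, hJ, hdJ, hJd⟩ := exists_meanZeroPrimitive P.ℓ_pos
  refine Metric.complete_of_cauchySeq_tendsto fun u hu => ?_
  obtain ⟨s, hs⟩ := exists_tendsto_of_cauchySeq shearₗ hκ (fun z => (hbd z).1) hu
  obtain ⟨φ', hφ'⟩ := exists_tendsto_of_cauchySeq phiTₗ hρ₁ (fun z => (hbd z).2.1) hu
  obtain ⟨g, hg⟩ := exists_tendsto_of_cauchySeq psiXₗ hb (fun z => (hbd z).2.2.1) hu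
  obtain ⟨ψ', hψ'⟩ := exists_tendsto_of_cauchySeq psiTₗ hρ₂ (fun z => (hbd z).2.2.2.1) hu
  obtain ⟨θ, hθ⟩ := exists_tendsto_of_cauchySeq thetaₗ hρ₃ (fun z => (hbd z).2.2.2.2.1) hu
  obtain ⟨η, hη⟩ := exists_tendsto_of_cauchySeq etaₗ hβ (fun z => (hbd z).2.2.2.2.2) hu
  have hψ : Tendsto (fun n => J (psiXₗ (u n))) atTop (𝓝 (J g)) := (J.continuous.tendsto g).comp hg
  have hφx : Tendsto (fun n => H10Space.dxIsometry P.ℓ (u n).phi) atTop (𝓝 (s - J g)) := by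
    refine (hs.sub hψ).congr fun n => ?_
    have : J (psiXₗ (u n)) = (u n).psi := hJd _ (u n).psi.2
    rw [this]
    exact add_sub_cancel_right _ _
  have hcl : IsClosed (range (H10Space.dxIsometry P.ℓ)) :=
    (H10Space.dxIsometry P.ℓ).isometry.isClosedEmbedding.isClosed_range
  obtain ⟨φ, hφ⟩ := hcl.mem_of_tendsto hφx (Eventually.of_forall fun n => mem_range_self _)
  let z : P.PhaseSpace := ofComponents φ φ' ⟨J g, hJ g⟩ ψ' θ η
  have hzs : shearₗ z = s := by
    change H10Space.dxIsometry P.ℓ φ + J g = s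
    rw [hφ, sub_add_cancel]
  have hzg : psiXₗ z = g := hdJ g
  refine ⟨z, tendsto_iff_norm_sub_tendsto_zero.2 ?_⟩
  have hsq : Tendsto (fun n => ‖u n - z‖ ^ 2) atTop (𝓝 0) := by
    have key : ∀ {Y : Type} [NormedAddCommGroup Y] [NormedSpace ℝ Y] (f : P.PhaseSpace →ₗ[ℝ] Y)
        (y : Y) (c : ℝ), f z = y → Tendsto (fun n => f (u n)) atTop (𝓝 y) →
        Tendsto (fun n => c * ‖f (u n - z)‖ ^ 2) atTop (𝓝 0) := by
      intro Y _ _ f y c hz h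
      have h1 := ((h.sub_const y).norm.pow 2).const_mul c
      rw [sub_self, norm_zero, zero_pow two_ne_zero, mul_zero] at h1
      refine h1.congr fun n => ?_
      rw [_root_.map_sub, hz]
    simp only [norm_sq_eq]
    simpa using (((((key shearₗ s P.κ hzs hs).add (key phiTₗ φ' P.ρ₁ rfl hφ')).add
      (key psiXₗ g P.b hzg hg)).add (key psiTₗ ψ' P.ρ₂ rfl hψ')).add
      (key thetaₗ θ P.ρ₃ rfl hθ)).add (key etaₗ η (1 / P.β) rfl hη)
  have := (Real.continuous_sqrt.tendsto 0).comp hsq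
  rw [Real.sqrt_zero] at this
  refine this.congr fun n => ?_
  rw [Function.comp_apply, Real.sqrt_sq (norm_nonneg _)]

end PhaseSpace

/-! ### Dissipativity and range of the operator A. -/

open PhaseSpace

variable (P : BeamData)

lemma mem_graph_A {z w : P.PhaseSpace} (h : z.InDomain) (hw : w =
    ofComponents (A1 z h) (A2 z) (A3 z h) (A4 z h) (A5 z) (A6 z h)) : (z, w) ∈ P.A.graph := by
  rw [hw]
  exact P.A.mem_graph ⟨z, h⟩

/-- Integration by parts cancels the κ-, b- and δ-terms between the equations. The pairing of the
constant function θ with η is ⟨θ_x, (∫ μη)_x⟩, which cancels the heat flux term. Only (1/β)⟨Tη, η⟩ ≤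
0 survives. -/
lemma isDissipative_A : IsDissipative P.A.graph := by
  rintro z w h
  obtain ⟨⟨z, hz⟩, rfl, rfl⟩ := (LinearPMap.mem_graph_iff _).1 h
  have hz' : z.InDomain := hz
  have hκ := P.κ_pos; have hρ₁ := P.ρ₁_pos; have hρ₂ := P.ρ₂_pos
  have hρ₃ := P.ρ₃_pos; have hβ := P.β_pos
  change ⟪ofComponents (A1 z hz') (A2 z) (A3 z hz') (A4 z hz') (A5 z) (A6 z hz'), z⟫ ≤ 0
  rw [inner_def]
  change P.κ * ⟪dx z.phiT + (z.psiT : L2 P.ℓ), z.shear⟫ + P.ρ₁ * ⟪A2 z, z.phiT⟫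
    + P.b * ⟪dx (z.psiT : L2 P.ℓ), z.psiX⟫ + P.ρ₂ * ⟪(A4 z hz' : L2 P.ℓ), (z.psiT : L2 P.ℓ)⟫
    + P.ρ₃ * ⟪A5 z, z.theta⟫ + (1 / P.β) * ⟪A6 z hz', z.eta⟫ ≤ 0
  have e2 : P.ρ₁ * ⟪A2 z, z.phiT⟫ = -(P.κ * ⟪dx z.phiT, z.shear⟫) := by
    rw [A2_eq, real_inner_smul_left, inner_dx_eq (u := z.shear) hz'.shear_mem hz'.phiT_mem,
      real_inner_comm]
    field_simp
  have e3 : ⟪dx (z.psiT : L2 P.ℓ), z.psiX⟫ = -⟪dx z.psiX, (z.psiT : L2 P.ℓ)⟫ := by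
    have hv : z.psiX ∈ H10 P.ℓ := hz'.psiX_mem
    rw [inner_dx_eq hz'.psiT_mem.1 hv, real_inner_comm]
  have e4 : P.ρ₂ * ⟪(A4 z hz' : L2 P.ℓ), (z.psiT : L2 P.ℓ)⟫ =
      P.b * ⟪dx z.psiX, (z.psiT : L2 P.ℓ)⟫ - P.κ * ⟪(z.psiT : L2 P.ℓ), z.shear⟫
        - P.δ * ⟪dx z.theta, (z.psiT : L2 P.ℓ)⟫ := by
    rw [coe_A4, inner_sub_left, inner_sub_left, real_inner_smul_left, real_inner_smul_left,
      real_inner_smul_left, real_inner_comm (z.psiT : L2 P.ℓ) z.shear]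
    field_simp
  have e5 : P.ρ₃ * ⟪A5 z, z.theta⟫ = -((1 / P.β) * ⟪dx z.theta, dx z.etaMean.val⟫)
      + P.δ * ⟪dx z.theta, (z.psiT : L2 P.ℓ)⟫ := by
    rw [A5, inner_sub_left, real_inner_smul_left, real_inner_smul_left,
      inner_dx_eq hz'.etaMean_mem.2 hz'.theta_mem, inner_dx_eq hz'.psiT_mem.1 hz'.theta_mem,
      real_inner_comm (dx z.theta), real_inner_comm (dx z.theta)]
    field_simp
    ring
  have e6 : ⟪A6 z hz', z.eta⟫ = ⟪Memory.T P.kernel P.ℓ ⟨z.eta, hz'.eta_mem⟩, z.eta⟫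
      + ⟪dx z.theta, dx z.etaMean.val⟫ := by
    rw [A6, inner_add_left, Memory.inner_const]
    rfl
  have hT := Memory.inner_T_nonpos hz'.eta_mem
  have hT' : (1 / P.β) * ⟪Memory.T P.kernel P.ℓ ⟨z.eta, hz'.eta_mem⟩, z.eta⟫ ≤ 0 :=
    mul_nonpos_of_nonneg_of_nonpos (by positivity) hT
  rw [e2, e3, e4, e5, e6, inner_add_left]
  linarith

/-- Eliminating φ̃, ψ̃ and η leaves a weak elliptic problem for φ, ψ, θ. The rest of the argument
reads regularity and boundary conditions off its three equations and substitutes back. -/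
lemma hasFullRange_A : HasFullRange P.A.graph 1 := by
  intro f
  have hκ := P.κ_pos; have hρ₁ := P.ρ₁_pos; have hb := P.b_pos; have hρ₂ := P.ρ₂_pos
  have hρ₃ := P.ρ₃_pos; have hβ := P.β_pos
  have hc := Memory.resolventMass_pos P.kernel
  set c := Memory.resolventMass P.kernel
  obtain ⟨η₁, hη₁, hTη₁⟩ := Memory.exists_sub_T_eq f.eta
  set q : H10Space P.ℓ := ∫ s, η₁ s ∂P.kernel.measure with hq
  have hf3 : (f.psi : L2 P.ℓ) ∈ H1s P.ℓ := f.psi.2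
  -- The mean of η will be q + cθ: the part cθ yields the diffusion coefficient c/β > 0. The part q
  -- enters as a functional of w_x, because q_x need not lie in H¹.
  obtain ⟨φ, ψ, θ, hφ, hψ, hθ, E1, E2, E3⟩ := exists_weak_solution P.ℓ_pos hκ hρ₁ hρ₂ hρ₃ hb
    (div_pos hc hβ) P.δ (P.ρ₁ • (f.phi.val + f.phiT)) (P.ρ₂ • ((f.psi : L2 P.ℓ) + f.psiT))
    (P.ρ₃ • f.theta + P.δ • dx (f.psi : L2 P.ℓ)) (-(1 / P.β) • dx q.val)
  obtain ⟨η₂, hη₂, hTη₂, hη₂m⟩ := Memory.exists_sub_T_eq_const (k := P.kernel)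
    (H10Space.mk θ hθ)
  set φ₀ : H10Space P.ℓ := H10Space.mk φ hφ with hφ₀
  set S : L2 P.ℓ := dx φ + ψ with hS
  have hnψ : (-1 : ℝ) • (f.psi : L2 P.ℓ) ∈ H1 P.ℓ := (H1 P.ℓ).smul_mem _ hf3.1
  have hSs : S ∈ L2s P.ℓ := (L2s P.ℓ).add_mem (dx_mem_L2s hφ) hψ.2
  obtain ⟨hS1, hdS⟩ := mem_H1_of_forall_inner P.ℓ_pos (u := S)
    (h := (P.ρ₁ / P.κ) • (φ - (f.phi.val + f.phiT))) fun v hv => by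
      have := E1 v hv
      rw [real_inner_smul_left] at this
      rw [real_inner_smul_left, inner_sub_left]
      field_simp
      linarith
  -- The second equation holds for all test functions in H¹_*, without boundary conditions, and this
  -- forces ψ_x into H¹₀; the right-hand side must have zero mean for this.
  obtain ⟨hp, hdp⟩ := mem_H10_of_forall_inner P.ℓ_pos (p := dx ψ)
    (h := (1 / P.b) • (P.ρ₂ • ((f.psi : L2 P.ℓ) + f.psiT - ψ) - P.κ • S - P.δ • dx θ))
    ((L2s P.ℓ).smul_mem _ ((L2s P.ℓ).sub_mem ((L2s P.ℓ).sub_mem ((L2s P.ℓ).smul_mem _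
      ((L2s P.ℓ).sub_mem ((L2s P.ℓ).add_mem hf3.2 f.psiT.2) hψ.2)) ((L2s P.ℓ).smul_mem _ hSs))
      ((L2s P.ℓ).smul_mem _ (dx_mem_L2s hθ)))) fun v hv => by
      have := E2 v hv
      rw [real_inner_smul_left] at this
      simp only [real_inner_smul_left, inner_sub_left]
      field_simp
      linarith
  let z : P.PhaseSpace := ofComponents φ₀ (φ - f.phi.val) ⟨ψ, hψ⟩
    ⟨ψ - f.psi, (L2s P.ℓ).sub_mem hψ.2 hf3.2⟩ θ (η₁ + η₂)
  have hm : z.etaMean = q + c • H10Space.mk θ hθ := by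
    rw [← hη₂m, hq, ← integral_add η₁.integrable η₂.integrable]
    exact integral_congr_ae (Lp.coeFn_add η₁ η₂)
  have hdm : dx z.etaMean.val = dx q.val + c • dx θ := by
    rw [hm]
    exact (map_add H10Space.D _ _).trans (congrArg _ (map_smul H10Space.D _ _))
  -- Only the sum q_x + cθ_x is shown to be in H¹, which is exactly what the domain of A asks of the
  -- mean of η.
  obtain ⟨hm1, hdm1⟩ := mem_H1_of_forall_inner P.ℓ_pos (u := dx z.etaMean.val)
    (h := P.β • (P.ρ₃ • θ + P.δ • dx ψ - (P.ρ₃ • f.theta + P.δ • dx (f.psi : L2 P.ℓ))))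
    fun v hv => by
      have := E3 v hv
      rw [real_inner_smul_left] at this
      rw [hdm]
      simp only [real_inner_smul_left, inner_sub_left, inner_add_left] at this ⊢
      field_simp at this
      linarith
  have hz : z.InDomain :=
    { phi_mem := ⟨hφ.1, by
        have : dx φ = S - ψ := by rw [hS, add_sub_cancel_right]
        change dx φ ∈ H1 P.ℓ
        rw [this]
        exact (H1 P.ℓ).sub_mem hS1 hψ.1⟩
      phiT_mem := (H10 P.ℓ).sub_mem hφ f.phi.val_mem
      psiX_mem := hp
      psiT_mem := (H1s P.ℓ).sub_mem hψ hf3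
      theta_mem := hθ
      eta_mem := (Memory.domT P.kernel P.ℓ).add_mem hη₁ hη₂
      etaMean_mem := ⟨z.etaMean.val_mem_H1, hm1⟩ }
  refine ⟨z, _, P.mem_graph_A hz rfl, ?_⟩
  have h1 : φ₀ - A1 z hz = f.phi := by
    refine H10Space.val_injective ?_
    rw [map_sub]
    exact sub_sub_cancel φ f.phi.val
  have h2 : (φ - f.phi.val) - A2 z = f.phiT := by
    have e : A2 z = (P.κ / P.ρ₁) • dx S := rfl
    rw [e, hdS, smul_smul, div_mul_div_cancel₀ hρ₁.ne', div_self hκ.ne', one_smul]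
    abel
  have h3 : (⟨ψ, hψ⟩ : H1s P.ℓ) - A3 z hz = f.psi :=
    Subtype.ext (sub_sub_cancel ψ (f.psi : L2 P.ℓ))
  have h4 : z.psiT - A4 z hz = f.psiT := by
    refine Subtype.ext ?_
    rw [Submodule.coe_sub, coe_A4]
    change (ψ - f.psi) - ((P.b / P.ρ₂) • dx (dx ψ) - (P.κ / P.ρ₂) • S - (P.δ / P.ρ₂) • dx θ) = _
    rw [hdp]
    match_scalars <;> field_simp <;> ring
  have h5 : θ - A5 z = f.theta := by
    have e : dx (ψ - (f.psi : L2 P.ℓ)) = dx ψ - dx (f.psi : L2 P.ℓ) := by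
      rw [sub_eq_add_neg, ← neg_one_smul ℝ (f.psi : L2 P.ℓ), dx_add hψ.1 hnψ, dx_smul _ hf3.1,
        neg_one_smul, ← sub_eq_add_neg]
    change θ - ((1 / (P.β * P.ρ₃)) • dx (dx z.etaMean.val)
      - (P.δ / P.ρ₃) • dx (ψ - (f.psi : L2 P.ℓ))) = _
    rw [hdm1, e]
    match_scalars <;> field_simp <;> ring
  have h6 : (η₁ + η₂) - A6 z hz = f.eta := by
    have e : Memory.T P.kernel P.ℓ ⟨z.eta, hz.eta_mem⟩ =
        Memory.T P.kernel P.ℓ ⟨η₁, hη₁⟩ + Memory.T P.kernel P.ℓ ⟨η₂, hη₂⟩ :=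
      LinearPMap.map_add _ ⟨η₁, hη₁⟩ ⟨η₂, hη₂⟩
    rw [A6, e]
    change (η₁ + η₂) - (_ + _ + Lp.const 2 P.kernel.measure (H10Space.mk θ hθ)) = _
    rw [← hTη₂, ← hTη₁]
    abel
  rw [one_smul]
  exact Prod.ext h1 (Prod.ext h2 (Prod.ext h3 (Prod.ext h4 (Prod.ext h5 h6))))

end BeamData

end TimoGP

end

theorem theorem4p1 (P : TimoGP.BeamData) :
    ∃! S : TimoGP.ContractionSemigroup P.PhaseSpace, S.generator = P.A :=
  TimoGP.existsUnique_contractionSemigroup P.A P.isDissipative_A P.hasFullRange_A
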